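/- A 3-graph $H$ consists of a finite vertex set $V(H)$ and a set $E(H)$ of 3-element subsets of $V(H)$, called edges; its minimum degree $\delta_1(H)$ is the smallest number of edges containing a given vertex. A copy of a 3-graph $F$ in $H$ is a (not necessarily induced) subgraph of $H$ isomorphic to $F$, and $H$ has an $F$-covering if every vertex of $H$ lies in some copy of $F$ in $H$. Let $$c_1(n,F)=\max\{\delta_1(H): H \text{ is a 3-graph on } n \text{ vertices with no } F\text{-covering}\}.$$ Writing $abc$ for $\{a,b,c\}$ and $[m]=\{1,\dots,m\}$, let $LP_3=([7],\{123,345,567\})$, $TP_3=([5],\{123,234,345\})$, $GP_3=([6],\{123,234,456\})$, $K_{1,1,3}=([5],\{123,124,125\})$, $S_3=([7],\{123,145,167\})$ and $GS_3=([6],\{123,124,156\})$. Then: 1. $c_1(n,LP_3)=n-2$ for all $n\ge 13$; 2. for all $n\ge 6$, $c_1(n,TP_3)=n-1$ if $n\equiv 1 \pmod 3$ and $n\ne 7$, and $c_1(n,TP_3)=n-2$ otherwise (in particular $c_1(7,TP_3)=5$); 3. $c_1(n,GP_3)=n-2$ for all $n\ge 14$; 4. $c_1(n,K_{1,1,3})=n-1$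 for all $n\ge 9$; 5. $c_1(n,S_3)=n-1$ for all $n\ge 11$; 6. $c_1(n,GS_3)=\lfloor (n-1)/2\rfloor$ for all $n\ge 13$. -/

import Mathlib

/-- A (simple) `k`-uniform hypergraph on the vertex set `V`: a finite set of `k`-element subsets
of `V`, called edges. -/
structure UniformHypergraph (V : Type*) (k : ℕ) where
  edges : Finset (Finset V)
  card_of_mem_edges : ∀ e ∈ edges, e.card = k

namespace UniformHypergraph

/-- The degree of a vertex set `S`: the number of edges containing `S`
(equivalently, the number of sets `T` disjoint from `S` such that `T ∪ S` is an edge). -/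
def degree {V : Type*} [DecidableEq V] {k : ℕ} (H : UniformHypergraph V k) (S : Finset V) : ℕ :=
  (H.edges.filter (fun e => S ⊆ e)).card

/-- The minimum `i`-degree: the minimum of the degrees of all `i`-element vertex sets
(meaningful when there is such a set, that is, when `i` is at most the number of vertices). -/
noncomputable def minDegree {V : Type*} [DecidableEq V] {k : ℕ} (H : UniformHypergraph V k)
    (i : ℕ) : ℕ :=
  sInf {d : ℕ | ∃ S : Finset V, S.card = i ∧ H.degree S = d}

/-- `φ` is an embedding of `F` as a (not necessarily induced) subgraph of `H`; its image is a
copy of `F` in `H`. -/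
def IsCopy {W V : Type*} {k : ℕ} (F : UniformHypergraph W k) (H : UniformHypergraph V k)
    (φ : W ↪ V) : Prop :=
  ∀ e ∈ F.edges, e.map φ ∈ H.edges

/-- `H` has an `F`-covering: every vertex of `H` is a vertex of some copy of `F` in `H`. -/
def HasCovering {W V : Type*} {k : ℕ} (F : UniformHypergraph W k) (H : UniformHypergraph V k) :
    Prop :=
  ∀ v : V, ∃ φ : W ↪ V, F.IsCopy H φ ∧ ∃ w : W, φ w = v

/-- `c` is the `i`-degree threshold `c_i(n, F)` for `F`-covering: the maximum of the minimum
`i`-degrees of the `k`-graphs on `n` vertices that have no `F`-covering (in particular, the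
maximum is attained). -/
def IsCoveringThreshold {W : Type*} {k : ℕ} (F : UniformHypergraph W k) (i n c : ℕ) : Prop :=
  IsGreatest {d : ℕ | ∃ G : UniformHypergraph (Fin n) k,
    ¬ F.HasCovering G ∧ G.minDegree i = d} c

end UniformHypergraph

/-! The six 3-graphs. The vertices are numbered from `0`, so that the vertex `j` of `[m]` is
`j - 1` here. -/

/-- The linear path `LP_3 = ([7], {123, 345, 567})`. -/
def LP3 : UniformHypergraph (Fin 7) 3 where
  edges := {{0, 1, 2}, {2, 3, 4}, {4, 5, 6}}
  card_of_mem_edges := by simp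

/-- The tight path `TP_3 = ([5], {123, 234, 345})`. -/
def TP3 : UniformHypergraph (Fin 5) 3 where
  edges := {{0, 1, 2}, {1, 2, 3}, {2, 3, 4}}
  card_of_mem_edges := by simp

/-- `GP_3 = ([6], {123, 234, 456})`. -/
def GP3 : UniformHypergraph (Fin 6) 3 where
  edges := {{0, 1, 2}, {1, 2, 3}, {3, 4, 5}}
  card_of_mem_edges := by simp

/-- The complete 3-partite 3-graph `K_{1,1,3} = ([5], {123, 124, 125})`. -/
def K113 : UniformHypergraph (Fin 5) 3 where
  edges := {{0, 1, 2}, {0, 1, 3}, {0, 1, 4}}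
  card_of_mem_edges := by simp

/-- The linear star `S_3 = ([7], {123, 145, 167})`. -/
def S3 : UniformHypergraph (Fin 7) 3 where
  edges := {{0, 1, 2}, {0, 3, 4}, {0, 5, 6}}
  card_of_mem_edges := by simp

/-- `GS_3 = ([6], {123, 124, 156})`. -/
def GS3 : UniformHypergraph (Fin 6) 3 where
  edges := {{0, 1, 2}, {0, 1, 3}, {0, 4, 5}}
  card_of_mem_edges := by simp

/-! Everything is read off the link of a vertex `v`: the graph on the other vertices whose edges are
the pairs completing `v` to an edge. Here `nbr v x` is the neighbourhood of `x` in this graph, and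
its size is called the link degree of `x`. If `v` lies in no copy of `F`, small configurations are
forbidden in the link, or in the link together with an edge avoiding `v`. The degree of a vertex `y`
is its link degree plus the number of edges at `y` avoiding `v`. Each upper bound finds a vertex,
`v` or one near it, for which this count is too small.

For `K113` the link has maximum degree two. For `TP3` it has no path with three edges, so a link
with `n - 1` edges is a disjoint union of triangles and `3 ∣ n - 1`; for `n = 7`, two triangles
leave too few edges at the other vertices. For `GS3` no two-edge path of the link misses a link
edge, so the link is a star or a matching (`star_or_matching`), and a star forces a leaf of small
degree. For `S3` the link has no three disjoint edges, and the link of a neighbour is nearly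
intersecting, hence nearly a star or a triangle (`star_or_triangle`).

For `GP3` and `LP3` the main case is a two-edge path of the link together with a disjoint link edge.
The forbidden configurations then confine the edges avoiding `v` to a few pairs, which pushes link
degrees up. Once enough vertices have large link degree, an edge at one of them avoiding `v` would
have to contain three further vertices. So that vertex has no such edge and degree at most `n - 2`.

The lower bounds are explicit: the full star for `LP3` and `GP3`; for `TP3`, links that are a star
or disjoint triangles; for `S3`, a link covered by two vertices; for `K113`, a link that is a cycle.
For `GS3` one uses hypergraphs in which most vertices have a link that is a matching, built from
addition in a cyclic group (even `n`) or in an elementary abelian 2-group (odd `n`). -/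

namespace UniformHypergraph

/-! ### Edges, links, codegrees and counting -/

section Basic

variable {V : Type*} [DecidableEq V]

/-- `{a, b, c}` is an edge. -/
def IsEdge (H : UniformHypergraph V 3) (a b c : V) : Prop := {a, b, c} ∈ H.edges

instance (H : UniformHypergraph V 3) (a b c : V) : Decidable (H.IsEdge a b c) := by
  unfold IsEdge; infer_instance

variable {H : UniformHypergraph V 3}

theorem IsEdge.swap {a b c : V} (h : H.IsEdge a b c) : H.IsEdge b a c := by
  unfold IsEdge at *; rwa [Finset.insert_comm]

theorem IsEdge.swap_right {a b c : V} (h : H.IsEdge a b c) : H.IsEdge a c b := by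
  unfold IsEdge at *; rwa [Finset.pair_comm]

theorem IsEdge.rot {a b c : V} (h : H.IsEdge a b c) : H.IsEdge b c a := h.swap.swap_right

theorem IsEdge.ne {a b c : V} (h : H.IsEdge a b c) : a ≠ b ∧ a ≠ c ∧ b ≠ c := by
  have := Finset.card_eq_three.1 (H.card_of_mem_edges _ h)
  obtain ⟨x, y, z, hxy, hxz, hyz, he⟩ := this
  have h2 := Finset.card_eq_three.2 ⟨x, y, z, hxy, hxz, hyz, he⟩
  have h3 : ∀ p q : V, ({a, b, c} : Finset V) = {p, q} → False := by
    intro p q hpq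
    rw [hpq] at h2
    have := Finset.card_le_two (a := p) (b := q)
    omega
  refine ⟨?_, ?_, ?_⟩ <;> rintro rfl
  · exact h3 a c (by simp)
  · exact h3 a b (by ext; simp; tauto)
  · exact h3 a b (by simp)

theorem exists_isEdge_of_mem {e : Finset V} (he : e ∈ H.edges) {y : V} (hy : y ∈ e) :
    ∃ p q, e = {y, p, q} ∧ H.IsEdge y p q := by
  have h3 := H.card_of_mem_edges _ he
  have h2 : (e.erase y).card = 2 := by rw [Finset.card_erase_of_mem hy, h3]
  obtain ⟨p, q, -, hpq⟩ := Finset.card_eq_two.1 h2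
  have : e = {y, p, q} := by rw [← hpq, Finset.insert_erase hy]
  exact ⟨p, q, this, by unfold IsEdge; rwa [← this]⟩

/-- The edges through `y` that avoid `X`. -/
def off (H : UniformHypergraph V 3) (y : V) (X : Finset V) : Finset (Finset V) :=
  H.edges.filter fun e => y ∈ e ∧ ∀ x ∈ X, x ∉ e

theorem degree_singleton (H : UniformHypergraph V 3) (y : V) :
    H.degree {y} = (H.off y ∅).card := by
  simp [degree, off]

/-- Erasing `y` is injective on the edges through `y`, so a list `P` of the possible remaining pairs
bounds their number. Most degree estimates for the upper bounds are such lists. -/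
theorem off_le_card (y : V) (X : Finset V) (P : Finset (Finset V))
    (h : ∀ p q, H.IsEdge y p q → p ∉ X → q ∉ X → {p, q} ∈ P) : (H.off y X).card ≤ P.card := by
  refine Finset.card_le_card_of_injOn (fun e => e.erase y) ?_ ?_
  · intro e he
    simp only [off, Finset.coe_filter, Set.mem_ofPred_eq] at he
    obtain ⟨p, q, rfl, hpq⟩ := exists_isEdge_of_mem he.1 he.2.1
    have hn := hpq.ne
    have : ({y, p, q} : Finset V).erase y = {p, q} := by
      ext z; simp only [Finset.mem_erase, Finset.mem_insert, Finset.mem_singleton]; grind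
    simp only [this, Finset.mem_coe]
    apply h p q hpq
    · intro hx; exact he.2.2 p hx (by simp)
    · intro hx; exact he.2.2 q hx (by simp)
  · intro e he f hf hef
    simp only [off, Finset.coe_filter, Set.mem_ofPred_eq] at he hf
    rw [← Finset.insert_erase he.2.1, ← Finset.insert_erase hf.2.1]
    simp only at hef
    rw [hef]

theorem off_eq_zero (y : V) (X : Finset V)
    (h : ∀ p q, H.IsEdge y p q → p ∉ X → q ∉ X → False) : (H.off y X).card = 0 := by
  have := off_le_card (H := H) y X ∅ (fun p q h1 h2 h3 => (h p q h1 h2 h3).elim)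
  simpa using this

variable [Fintype V]

/-- The vertices forming an edge with `a` and `b`. -/
def nbr (H : UniformHypergraph V 3) (a b : V) : Finset V :=
  Finset.univ.filter fun c => H.IsEdge a b c

@[simp] theorem mem_nbr {a b c : V} : c ∈ H.nbr a b ↔ H.IsEdge a b c := by simp [nbr]

theorem nbr_comm (H : UniformHypergraph V 3) (a b : V) : H.nbr a b = H.nbr b a := by
  ext c; simp only [mem_nbr]; exact ⟨IsEdge.swap, IsEdge.swap⟩

/-- Peels off the edges through one more vertex `a`. Running through a vertex cover of the link of
`y` bounds its degree by a sum of codegrees. -/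
theorem off_le_step (H : UniformHypergraph V 3) (y : V) (X : Finset V) {a : V}
    (hay : a ≠ y) :
    (H.off y X).card ≤ (H.nbr y a \ X).card + (H.off y (insert a X)).card := by
  have h1 : H.off y X ⊆
      (H.nbr y a \ X).image (fun z => ({y, a, z} : Finset V)) ∪ H.off y (insert a X) := by
    intro e he
    simp only [off, Finset.mem_filter] at he
    rw [Finset.mem_union]
    by_cases ha : a ∈ e
    · left
      obtain ⟨p, q, rfl, hpq⟩ := exists_isEdge_of_mem he.1 he.2.1
      simp only [Finset.mem_image, Finset.mem_sdiff, mem_nbr]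
      simp only [Finset.mem_insert, Finset.mem_singleton] at ha
      rcases ha with rfl | rfl | rfl
      · exact absurd rfl hay
      · exact ⟨q, ⟨hpq, fun hx => he.2.2 q hx (by simp)⟩, rfl⟩
      · refine ⟨p, ⟨hpq.swap_right, fun hx => he.2.2 p hx (by simp)⟩, ?_⟩
        rw [Finset.pair_comm]
    · right
      simp only [off, Finset.mem_filter]
      refine ⟨he.1, he.2.1, fun x hx => ?_⟩
      rcases Finset.mem_insert.1 hx with rfl | hx
      · exact ha
      · exact he.2.2 x hx
  calc _ ≤ _ := Finset.card_le_card h1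
    _ ≤ _ := Finset.card_union_le _ _
    _ ≤ _ := by gcongr; exact Finset.card_image_le

theorem nbr_self (H : UniformHypergraph V 3) (a : V) : H.nbr a a = ∅ := by
  ext c; simp only [mem_nbr, Finset.notMem_empty, iff_false]
  exact fun h => h.ne.1 rfl

theorem card_nbr_eq (H : UniformHypergraph V 3) {v x : V} (hvx : x ≠ v) :
    (H.nbr v x).card = ((H.off v ∅).filter fun e => x ∈ e).card := by
  refine Finset.card_bij (fun y _ => {v, x, y}) ?_ ?_ ?_
  · intro y hy
    simp only [off, Finset.mem_filter]
    exact ⟨⟨mem_nbr.1 hy, by simp⟩, by simp⟩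
  · intro y hy z hz h
    have hn := (mem_nbr.1 hy).ne
    have : y ∈ ({v, x, z} : Finset V) := by rw [← h]; simp
    simp only [Finset.mem_insert, Finset.mem_singleton] at this
    grind
  · intro e he
    simp only [off, Finset.mem_filter] at he
    obtain ⟨p, q, rfl, hpq⟩ := exists_isEdge_of_mem he.1.1 he.1.2.1
    have := he.2
    simp only [Finset.mem_insert, Finset.mem_singleton] at this
    rcases this with rfl | rfl | rfl
    · exact absurd rfl hvx
    · exact ⟨q, mem_nbr.2 hpq, rfl⟩
    · exact ⟨p, mem_nbr.2 hpq.swap_right, by rw [Finset.pair_comm]⟩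

/-- Handshake: the codegrees of `v` with the other vertices sum to twice its degree. -/
theorem sum_card_nbr (H : UniformHypergraph V 3) (v : V) :
    ∑ x, (H.nbr v x).card = 2 * H.degree {v} := by
  have h1 : ∑ x, (H.nbr v x).card =
      ∑ x ∈ Finset.univ.erase v, ((H.off v ∅).filter fun e => x ∈ e).card := by
    rw [← Finset.add_sum_erase _ _ (Finset.mem_univ v), nbr_self, Finset.card_empty, zero_add]
    exact Finset.sum_congr rfl fun x hx => card_nbr_eq H (Finset.ne_of_mem_erase hx)
  have h2 : ∀ e ∈ H.off v ∅, ((Finset.univ.erase v).filter fun x => x ∈ e).card = 2 := by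
    intro e he
    simp only [off, Finset.mem_filter] at he
    have : ((Finset.univ.erase v).filter fun x => x ∈ e) = e.erase v := by ext; simp
    rw [this, Finset.card_erase_of_mem he.2.1, H.card_of_mem_edges _ he.1]
  rw [h1, degree_singleton]
  have := Finset.sum_card_bipartiteAbove_eq_sum_card_bipartiteBelow
    (s := Finset.univ.erase v) (t := H.off v ∅) (fun x e => x ∈ e)
  simp only [Finset.bipartiteAbove, Finset.bipartiteBelow] at this
  rw [this, Finset.sum_congr rfl h2]
  simp [mul_comm]

theorem card_mul_le_two_mul_degree (H : UniformHypergraph V 3) (v : V) (S : Finset V) (t : ℕ)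
    (h : ∀ x ∈ S, t ≤ (H.nbr v x).card) : S.card * t ≤ 2 * H.degree {v} := by
  rw [← sum_card_nbr, ← smul_eq_mul]
  exact (Finset.card_nsmul_le_sum _ _ _ h).trans
    (Finset.sum_le_sum_of_subset (Finset.subset_univ _))

theorem card_nbr_le_degree (H : UniformHypergraph V 3) (v x : V) :
    (H.nbr v x).card ≤ H.degree {v} := by
  by_cases h : x = v
  · subst h; simp [nbr_self]
  · rw [card_nbr_eq H h, degree_singleton]
    exact Finset.card_filter_le _ _

/-- Only the edge `{v, x, y}` can be counted twice. -/
theorem card_nbr_add_le (H : UniformHypergraph V 3) (v : V) {x y : V} (hxy : x ≠ y) :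
    (H.nbr v x).card + (H.nbr v y).card ≤ H.degree {v} + 1 := by
  by_cases hx : x = v
  · subst hx; simp only [nbr_self, Finset.card_empty]; have := card_nbr_le_degree H x y; omega
  by_cases hy : y = v
  · subst hy; simp only [nbr_self, Finset.card_empty]; have := card_nbr_le_degree H y x; omega
  rw [card_nbr_eq H hx, card_nbr_eq H hy, degree_singleton, ← Finset.card_union_add_card_inter]
  refine Nat.add_le_add (Finset.card_le_card ?_) ?_
  · exact Finset.union_subset (Finset.filter_subset _ _) (Finset.filter_subset _ _)
  · rw [Finset.card_le_one]
    intro e he f hf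
    simp only [off, Finset.mem_filter, Finset.mem_inter] at he hf
    have key : ∀ e ∈ H.edges, v ∈ e → x ∈ e → y ∈ e → e = {v, x, y} := by
      intro e he h1 h2 h3
      refine (Finset.eq_of_subset_of_card_le ?_ ?_).symm
      · intro z hz; simp only [Finset.mem_insert, Finset.mem_singleton] at hz; grind
      · rw [H.card_of_mem_edges _ he, Finset.card_eq_three.2 ⟨v, x, y, Ne.symm hx, Ne.symm hy, hxy, rfl⟩]
    rw [key e he.1.1.1 he.1.1.2.1 he.1.2 he.2.2, key f hf.1.1.1 hf.1.1.2.1 hf.1.2 hf.2.2]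

theorem card_nbr_add_le_of_not_isEdge (H : UniformHypergraph V 3) (v : V) {x y : V} (hxy : x ≠ y)
    (h : ¬ H.IsEdge v x y) : (H.nbr v x).card + (H.nbr v y).card ≤ H.degree {v} := by
  by_cases hx : x = v
  · subst hx; simp only [nbr_self, Finset.card_empty]; have := card_nbr_le_degree H x y; omega
  by_cases hy : y = v
  · subst hy; simp only [nbr_self, Finset.card_empty]; have := card_nbr_le_degree H y x; omega
  rw [card_nbr_eq H hx, card_nbr_eq H hy, degree_singleton, ← Finset.card_union_of_disjoint]
  · exact Finset.card_le_card
      (Finset.union_subset (Finset.filter_subset _ _) (Finset.filter_subset _ _))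
  · rw [Finset.disjoint_left]
    intro e he hf
    simp only [off, Finset.mem_filter] at he hf
    obtain ⟨p, q, rfl, hpq⟩ := exists_isEdge_of_mem he.1.1 he.1.2.1
    have h1 := he.2
    have h2 := hf.2
    simp only [Finset.mem_insert, Finset.mem_singleton] at h1 h2
    have := hpq.swap_right
    grind

theorem nbr_subset (H : UniformHypergraph V 3) (a b : V) :
    H.nbr a b ⊆ Finset.univ \ {a, b} := by
  intro c hc
  have := (mem_nbr.1 hc).ne
  simp only [Finset.mem_sdiff, Finset.mem_univ, Finset.mem_insert, Finset.mem_singleton]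
  grind

theorem card_nbr_add_two_le (H : UniformHypergraph V 3) {a b : V} (hab : a ≠ b) :
    (H.nbr a b).card + 2 ≤ Fintype.card V := by
  have h := Finset.card_le_card (nbr_subset H a b)
  rw [Finset.card_sdiff_of_subset (Finset.subset_univ _), Finset.card_pair hab,
    Finset.card_univ] at h
  have : ({a, b} : Finset V).card ≤ Fintype.card V := Finset.card_le_univ _
  rw [Finset.card_pair hab] at this
  omega

end Basic

/-! ### Hypergraphs given by a symmetric ternary relation -/

section OfRel

variable {V : Type*} [DecidableEq V] [Fintype V]

/-- The 3-graph whose edges are the triples of distinct vertices satisfying `R`. -/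
noncomputable def ofRel (R : V → V → V → Prop) : UniformHypergraph V 3 where
  edges := (Set.toFinite
    {e : Finset V | ∃ a b c, a ≠ b ∧ a ≠ c ∧ b ≠ c ∧ R a b c ∧ e = {a, b, c}}).toFinset
  card_of_mem_edges := by
    intro e he
    obtain ⟨a, b, c, h1, h2, h3, -, rfl⟩ := (Set.Finite.mem_toFinset _).1 he
    exact Finset.card_eq_three.2 ⟨a, b, c, h1, h2, h3, rfl⟩

theorem isEdge_ofRel {R : V → V → V → Prop} (h1 : ∀ a b c, R a b c → R b a c)
    (h2 : ∀ a b c, R a b c → R a c b) {a b c : V} :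
    (ofRel R).IsEdge a b c ↔ a ≠ b ∧ a ≠ c ∧ b ≠ c ∧ R a b c := by
  constructor
  · intro h
    have hn := h.ne
    refine ⟨hn.1, hn.2.1, hn.2.2, ?_⟩
    obtain ⟨x, y, z, hxy, hxz, hyz, hR, he⟩ := (Set.Finite.mem_toFinset _).1 h
    have ha : a ∈ ({x, y, z} : Finset V) := by rw [← he]; simp
    have hb : b ∈ ({x, y, z} : Finset V) := by rw [← he]; simp
    have hc : c ∈ ({x, y, z} : Finset V) := by rw [← he]; simp
    simp only [Finset.mem_insert, Finset.mem_singleton] at ha hb hc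
    rcases ha with rfl | rfl | rfl <;> rcases hb with rfl | rfl | rfl <;>
      rcases hc with rfl | rfl | rfl <;> first | exact hR | (exfalso; tauto) | grind
  · rintro ⟨hab, hac, hbc, hR⟩
    exact (Set.Finite.mem_toFinset _).2 ⟨a, b, c, hab, hac, hbc, hR, rfl⟩

end OfRel

/-! ### Reduction of the threshold to a construction and a covering statement -/

section Threshold

theorem le_minDegree_one {n c : ℕ} (hn : 0 < n) {G : UniformHypergraph (Fin n) 3}
    (h : ∀ v, c ≤ G.degree {v}) : c ≤ G.minDegree 1 := by
  -- A vertex is needed here: the infimum of the empty set of naturals is `0`.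
  refine le_csInf ⟨G.degree {⟨0, hn⟩}, {⟨0, hn⟩}, by simp, rfl⟩ ?_
  rintro d ⟨S, hS, rfl⟩
  obtain ⟨v, rfl⟩ := Finset.card_eq_one.1 hS
  exact h v

theorem minDegree_one_le {n : ℕ} {G : UniformHypergraph (Fin n) 3} (v : Fin n) :
    G.minDegree 1 ≤ G.degree {v} :=
  Nat.sInf_le ⟨{v}, by simp, rfl⟩

/-- Every vertex of the 3-graph `F` on `Fin m` is covered as soon as all degrees exceed `c`. -/
def CoveredAbove {m : ℕ} (F : UniformHypergraph (Fin m) 3) (n c : ℕ) : Prop :=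
  ∀ (H : UniformHypergraph (Fin n) 3) (v : Fin n), (∀ x, c + 1 ≤ H.degree {x}) →
    (∀ φ : Fin m ↪ Fin n, F.IsCopy H φ → ∀ w, φ w ≠ v) → False

/-- Some 3-graph on `n` vertices with all degrees at least `c` has a vertex in no copy of `F`. -/
def HasUncovered {m : ℕ} (F : UniformHypergraph (Fin m) 3) (n c : ℕ) : Prop :=
  ∃ (V : Type) (_ : Fintype V) (_ : DecidableEq V) (H : UniformHypergraph V 3) (v : V),
    Fintype.card V = n ∧ (∀ x, c ≤ H.degree {x}) ∧
      ∀ φ : Fin m ↪ V, F.IsCopy H φ → ∀ w, φ w ≠ v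

/-- The construction may live on any vertex type of size `n` and is transported to `Fin n`. It only
needs minimum degree at least `c`; equality follows from the upper bound applied to the construction
itself. -/
theorem isCoveringThreshold_of {m n c : ℕ} (hn : 0 < n) {F : UniformHypergraph (Fin m) 3}
    (hlow : HasUncovered F n c) (hup : CoveredAbove F n c) : F.IsCoveringThreshold 1 n c := by
  obtain ⟨V, _, _, H, v, hV, hdeg, hv⟩ := hlow
  obtain ⟨e⟩ : Nonempty (Fin n ≃ V) := ⟨(Fintype.equivFinOfCardEq hV).symm⟩
  set G : UniformHypergraph (Fin n) 3 := ofRel fun a b c => H.IsEdge (e a) (e b) (e c) with hG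
  have hE : ∀ a b c, G.IsEdge a b c ↔ H.IsEdge (e a) (e b) (e c) := by
    intro a b c
    refine (isEdge_ofRel (R := fun a b c => H.IsEdge (e a) (e b) (e c))
      (fun _ _ _ => IsEdge.swap) (fun _ _ _ => IsEdge.swap_right)).trans ?_
    refine ⟨fun h => h.2.2.2, fun h => ?_⟩
    have := h.ne
    exact ⟨fun h => this.1 (by rw [h]), fun h => this.2.1 (by rw [h]),
      fun h => this.2.2 (by rw [h]), h⟩
  have hD : ∀ a, G.degree {a} = H.degree {e a} := by
    intro a
    have h1 : ∀ x, (G.nbr a x).card = (H.nbr (e a) (e x)).card := by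
      intro x
      rw [← Finset.card_map e.toEmbedding]
      congr 1
      ext y
      simp only [Finset.mem_map_equiv, mem_nbr, hE, Equiv.apply_symm_apply]
    -- Degrees are compared through the handshake sums of codegrees, which avoids a bijection
    -- between edge sets.
    have h2 := sum_card_nbr G a
    rw [Finset.sum_congr rfl (fun x _ => h1 x),
      Equiv.sum_comp e (fun x => (H.nbr (e a) x).card), sum_card_nbr] at h2
    omega
  have hcov : ¬ F.HasCovering G := by
    intro hc
    obtain ⟨φ, hφ, w, hw⟩ := hc (e.symm v)
    refine hv (φ.trans e.toEmbedding) ?_ w (by simp [hw])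
    intro f hf
    obtain ⟨a, b, c, -, -, -, rfl⟩ := Finset.card_eq_three.1 (F.card_of_mem_edges f hf)
    have h1 := hφ _ hf
    have h2 : G.IsEdge (φ a) (φ b) (φ c) := by
      unfold IsEdge; simpa [Finset.map_insert] using h1
    have h3 := (hE _ _ _).1 h2
    unfold IsEdge at h3
    simpa [Finset.map_insert] using h3
  have hup' : ∀ G : UniformHypergraph (Fin n) 3, ¬ F.HasCovering G → G.minDegree 1 ≤ c := by
    intro G hG
    by_contra hlt
    unfold HasCovering at hG
    push Not at hG
    obtain ⟨v, hv⟩ := hG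
    exact hup G v (fun x => (not_le.1 hlt).trans_le (minDegree_one_le x)) hv
  refine ⟨⟨G, hcov, le_antisymm (hup' G hcov) (le_minDegree_one hn fun a => ?_)⟩, ?_⟩
  · rw [hD]; exact hdeg _
  · rintro d ⟨G', hG', rfl⟩
    exact hup' G' hG'

end Threshold

/-- The vertex `v` lies in no copy of `F` in `H`. -/
abbrev Avoids {W V : Type*} {k : ℕ} (F : UniformHypergraph W k) (H : UniformHypergraph V k)
    (v : V) : Prop :=
  ∀ φ : W ↪ V, F.IsCopy H φ → ∀ w, φ w ≠ v

/-! ### Copies of the six hypergraphs listed by their vertices -/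

section Copies

variable {V : Type*} {H : UniformHypergraph V 3}

/-- The embedding of `Fin m` listing a duplicate-free list of length `m`. -/
def listEmb {m : ℕ} (l : List V) (hl : l.Nodup) (hm : m = l.length) : Fin m ↪ V :=
  ⟨fun i => l.get (i.cast hm), fun i j h => by
    have := List.nodup_iff_injective_get.1 hl h
    simpa using this⟩

/-- The values of `φ` are returned as equations so that callers can replace the named vertices by `φ
i` and apply the `isCopy` criteria. -/
theorem avoid_five {F : UniformHypergraph (Fin 5) 3} {v : V}
    (h : ∀ φ : Fin 5 ↪ V, F.IsCopy H φ → ∀ w, φ w ≠ v) {a b c d e : V}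
    (hn : [a, b, c, d, e].Nodup) (hv : v ∈ [a, b, c, d, e]) :
    ∃ φ : Fin 5 ↪ V, φ 0 = a ∧ φ 1 = b ∧ φ 2 = c ∧ φ 3 = d ∧ φ 4 = e ∧ ¬ F.IsCopy H φ := by
  refine ⟨listEmb _ hn rfl, rfl, rfl, rfl, rfl, rfl, fun hc => ?_⟩
  obtain ⟨i, hi⟩ := List.get_of_mem hv
  exact h _ hc i hi

theorem avoid_six {F : UniformHypergraph (Fin 6) 3} {v : V}
    (h : ∀ φ : Fin 6 ↪ V, F.IsCopy H φ → ∀ w, φ w ≠ v) {a b c d e f : V}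
    (hn : [a, b, c, d, e, f].Nodup) (hv : v ∈ [a, b, c, d, e, f]) :
    ∃ φ : Fin 6 ↪ V, φ 0 = a ∧ φ 1 = b ∧ φ 2 = c ∧ φ 3 = d ∧ φ 4 = e ∧ φ 5 = f ∧
      ¬ F.IsCopy H φ := by
  refine ⟨listEmb _ hn rfl, rfl, rfl, rfl, rfl, rfl, rfl, fun hc => ?_⟩
  obtain ⟨i, hi⟩ := List.get_of_mem hv
  exact h _ hc i hi

theorem avoid_seven {F : UniformHypergraph (Fin 7) 3} {v : V}
    (h : ∀ φ : Fin 7 ↪ V, F.IsCopy H φ → ∀ w, φ w ≠ v) {a b c d e f g : V}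
    (hn : [a, b, c, d, e, f, g].Nodup) (hv : v ∈ [a, b, c, d, e, f, g]) :
    ∃ φ : Fin 7 ↪ V, φ 0 = a ∧ φ 1 = b ∧ φ 2 = c ∧ φ 3 = d ∧ φ 4 = e ∧ φ 5 = f ∧ φ 6 = g ∧
      ¬ F.IsCopy H φ := by
  refine ⟨listEmb _ hn rfl, rfl, rfl, rfl, rfl, rfl, rfl, rfl, fun hc => ?_⟩
  obtain ⟨i, hi⟩ := List.get_of_mem hv
  exact h _ hc i hi

variable [DecidableEq V]

theorem isCopy_LP3 {φ : Fin 7 ↪ V} : LP3.IsCopy H φ ↔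
    H.IsEdge (φ 0) (φ 1) (φ 2) ∧ H.IsEdge (φ 2) (φ 3) (φ 4) ∧ H.IsEdge (φ 4) (φ 5) (φ 6) := by
  simp [IsCopy, LP3, IsEdge, Finset.map_insert]

theorem isCopy_TP3 {φ : Fin 5 ↪ V} : TP3.IsCopy H φ ↔
    H.IsEdge (φ 0) (φ 1) (φ 2) ∧ H.IsEdge (φ 1) (φ 2) (φ 3) ∧ H.IsEdge (φ 2) (φ 3) (φ 4) := by
  simp [IsCopy, TP3, IsEdge, Finset.map_insert]

theorem isCopy_GP3 {φ : Fin 6 ↪ V} : GP3.IsCopy H φ ↔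
    H.IsEdge (φ 0) (φ 1) (φ 2) ∧ H.IsEdge (φ 1) (φ 2) (φ 3) ∧ H.IsEdge (φ 3) (φ 4) (φ 5) := by
  simp [IsCopy, GP3, IsEdge, Finset.map_insert]

theorem isCopy_K113 {φ : Fin 5 ↪ V} : K113.IsCopy H φ ↔
    H.IsEdge (φ 0) (φ 1) (φ 2) ∧ H.IsEdge (φ 0) (φ 1) (φ 3) ∧ H.IsEdge (φ 0) (φ 1) (φ 4) := by
  simp [IsCopy, K113, IsEdge, Finset.map_insert]

theorem isCopy_S3 {φ : Fin 7 ↪ V} : S3.IsCopy H φ ↔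
    H.IsEdge (φ 0) (φ 1) (φ 2) ∧ H.IsEdge (φ 0) (φ 3) (φ 4) ∧ H.IsEdge (φ 0) (φ 5) (φ 6) := by
  simp [IsCopy, S3, IsEdge, Finset.map_insert]

theorem isCopy_GS3 {φ : Fin 6 ↪ V} : GS3.IsCopy H φ ↔
    H.IsEdge (φ 0) (φ 1) (φ 2) ∧ H.IsEdge (φ 0) (φ 1) (φ 3) ∧ H.IsEdge (φ 0) (φ 4) (φ 5) := by
  simp [IsCopy, GS3, IsEdge, Finset.map_insert]

theorem no_LP3 {v : V} (h : ∀ φ : Fin 7 ↪ V, LP3.IsCopy H φ → ∀ w, φ w ≠ v)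
    {a b c d e f g : V} (h1 : H.IsEdge a b c) (h2 : H.IsEdge c d e) (h3 : H.IsEdge e f g)
    (hn : [a, b, c, d, e, f, g].Nodup) (hv : v ∈ [a, b, c, d, e, f, g]) : False := by
  obtain ⟨φ, rfl, rfl, rfl, rfl, rfl, rfl, rfl, hφ⟩ := avoid_seven h hn hv
  exact hφ (isCopy_LP3.2 ⟨h1, h2, h3⟩)

theorem no_S3 {v : V} (h : ∀ φ : Fin 7 ↪ V, S3.IsCopy H φ → ∀ w, φ w ≠ v)
    {a b c d e f g : V} (h1 : H.IsEdge a b c) (h2 : H.IsEdge a d e) (h3 : H.IsEdge a f g)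
    (hn : [a, b, c, d, e, f, g].Nodup) (hv : v ∈ [a, b, c, d, e, f, g]) : False := by
  obtain ⟨φ, rfl, rfl, rfl, rfl, rfl, rfl, rfl, hφ⟩ := avoid_seven h hn hv
  exact hφ (isCopy_S3.2 ⟨h1, h2, h3⟩)

theorem no_GP3 {v : V} (h : ∀ φ : Fin 6 ↪ V, GP3.IsCopy H φ → ∀ w, φ w ≠ v)
    {a b c d e f : V} (h1 : H.IsEdge a b c) (h2 : H.IsEdge b c d) (h3 : H.IsEdge d e f)
    (hn : [a, b, c, d, e, f].Nodup) (hv : v ∈ [a, b, c, d, e, f]) : False := by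
  obtain ⟨φ, rfl, rfl, rfl, rfl, rfl, rfl, hφ⟩ := avoid_six h hn hv
  exact hφ (isCopy_GP3.2 ⟨h1, h2, h3⟩)

theorem no_GS3 {v : V} (h : ∀ φ : Fin 6 ↪ V, GS3.IsCopy H φ → ∀ w, φ w ≠ v)
    {a b c d e f : V} (h1 : H.IsEdge a b c) (h2 : H.IsEdge a b d) (h3 : H.IsEdge a e f)
    (hn : [a, b, c, d, e, f].Nodup) (hv : v ∈ [a, b, c, d, e, f]) : False := by
  obtain ⟨φ, rfl, rfl, rfl, rfl, rfl, rfl, hφ⟩ := avoid_six h hn hv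
  exact hφ (isCopy_GS3.2 ⟨h1, h2, h3⟩)

theorem no_TP3 {v : V} (h : ∀ φ : Fin 5 ↪ V, TP3.IsCopy H φ → ∀ w, φ w ≠ v)
    {a b c d e : V} (h1 : H.IsEdge a b c) (h2 : H.IsEdge b c d) (h3 : H.IsEdge c d e)
    (hn : [a, b, c, d, e].Nodup) (hv : v ∈ [a, b, c, d, e]) : False := by
  obtain ⟨φ, rfl, rfl, rfl, rfl, rfl, hφ⟩ := avoid_five h hn hv
  exact hφ (isCopy_TP3.2 ⟨h1, h2, h3⟩)

theorem no_K113 {v : V} (h : ∀ φ : Fin 5 ↪ V, K113.IsCopy H φ → ∀ w, φ w ≠ v)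
    {a b c d e : V} (h1 : H.IsEdge a b c) (h2 : H.IsEdge a b d) (h3 : H.IsEdge a b e)
    (hn : [a, b, c, d, e].Nodup) (hv : v ∈ [a, b, c, d, e]) : False := by
  obtain ⟨φ, rfl, rfl, rfl, rfl, rfl, hφ⟩ := avoid_five h hn hv
  exact hφ (isCopy_K113.2 ⟨h1, h2, h3⟩)

end Copies

/-! ### Lower bounds for `LP3` and `GP3`: the full star -/

section Star

/-- In the hypergraph of all triples through `o` any two edges meet, so it contains no copy at all
of an `F` with two disjoint edges. A vertex other than `o` has degree exactly `n - 2`. -/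
theorem exists_star {n m : ℕ} (hn : 3 ≤ n) (F : UniformHypergraph (Fin m) 3)
    (hF : ∀ {V : Type} [DecidableEq V] (H : UniformHypergraph V 3) (φ : Fin m ↪ V),
      F.IsCopy H φ → ∃ a b c d e f, H.IsEdge (φ a) (φ b) (φ c) ∧ H.IsEdge (φ d) (φ e) (φ f) ∧
        Disjoint ({a, b, c} : Finset (Fin m)) {d, e, f}) : HasUncovered F n (n - 2) := by
  let o : Fin n := ⟨0, by omega⟩
  let R : Fin n → Fin n → Fin n → Prop := fun a b c => a = o ∨ b = o ∨ c = o
  have hE : ∀ a b c, (ofRel R).IsEdge a b c ↔ a ≠ b ∧ a ≠ c ∧ b ≠ c ∧ R a b c := fun a b c =>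
    isEdge_ofRel (by intro a b c; simp only [R]; tauto) (by intro a b c; simp only [R]; tauto)
  refine ⟨Fin n, inferInstance, inferInstance, ofRel R, o, by simp, fun x => ?_, ?_⟩
  · by_cases hx : x = o
    · let w : Fin n := ⟨1, by omega⟩
      have hw : w ≠ o := by simp [w, o, Fin.ext_iff]
      refine le_trans ?_ (card_nbr_le_degree _ x w)
      have : Finset.univ \ {x, w} ⊆ (ofRel R).nbr x w := by
        intro z hz
        simp only [Finset.mem_sdiff, Finset.mem_univ, Finset.mem_insert, Finset.mem_singleton] at hz
        rw [mem_nbr, hE]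
        simp only [R]; grind
      refine le_trans ?_ (Finset.card_le_card this)
      have := Finset.le_card_sdiff ({x, w} : Finset (Fin n)) Finset.univ
      rw [Finset.card_univ, Fintype.card_fin] at this
      have := Finset.card_le_two (a := x) (b := w)
      omega
    · refine le_trans ?_ (card_nbr_le_degree _ x o)
      have : Finset.univ \ {x, o} ⊆ (ofRel R).nbr x o := by
        intro z hz
        simp only [Finset.mem_sdiff, Finset.mem_univ, Finset.mem_insert, Finset.mem_singleton] at hz
        rw [mem_nbr, hE]
        simp only [R]; grind
      refine le_trans ?_ (Finset.card_le_card this)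
      have := Finset.le_card_sdiff ({x, o} : Finset (Fin n)) Finset.univ
      rw [Finset.card_univ, Fintype.card_fin] at this
      have := Finset.card_le_two (a := x) (b := o)
      omega
  · intro φ hφ
    exfalso
    obtain ⟨a, b, c, d, e, f, h1, h2, hd⟩ := hF _ φ hφ
    have h1 := ((hE _ _ _).1 h1).2.2.2
    have h2 := ((hE _ _ _).1 h2).2.2.2
    have hi := φ.injective
    have k1 : ∃ i ∈ ({a, b, c} : Finset (Fin m)), φ i = o := by
      rcases h1 with h | h | h
      exacts [⟨a, by simp, h⟩, ⟨b, by simp, h⟩, ⟨c, by simp, h⟩]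
    have k2 : ∃ i ∈ ({d, e, f} : Finset (Fin m)), φ i = o := by
      rcases h2 with h | h | h
      exacts [⟨d, by simp, h⟩, ⟨e, by simp, h⟩, ⟨f, by simp, h⟩]
    obtain ⟨i, hi1, hi2⟩ := k1
    obtain ⟨j, hj1, hj2⟩ := k2
    have : i = j := hi (hi2.trans hj2.symm)
    subst this
    exact Finset.disjoint_left.1 hd hi1 hj1

theorem hasUncovered_LP3 {n : ℕ} (hn : 3 ≤ n) : HasUncovered LP3 n (n - 2) := by
  refine exists_star hn _ fun {V} _ H φ h => ?_
  rw [isCopy_LP3] at h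
  exact ⟨0, 1, 2, 4, 5, 6, h.1, h.2.2, by decide⟩

theorem hasUncovered_GP3 {n : ℕ} (hn : 3 ≤ n) : HasUncovered GP3 n (n - 2) := by
  refine exists_star hn _ fun {V} _ H φ h => ?_
  rw [isCopy_GP3] at h
  exact ⟨0, 1, 2, 3, 4, 5, h.1, h.2.2, by decide⟩

end Star

/-- Lower bound for a codegree from a small set containing all non-neighbours. -/
theorem le_card_nbr {V : Type*} [Fintype V] [DecidableEq V] {H : UniformHypergraph V 3} {a b : V}
    (B : Finset V) (k : ℕ) (hB : B.card ≤ k) (h : ∀ z, z ∉ B → H.IsEdge a b z) :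
    Fintype.card V - k ≤ (H.nbr a b).card := by
  have h1 : Finset.univ \ B ⊆ H.nbr a b := by
    intro z hz
    exact mem_nbr.2 (h z (Finset.mem_sdiff.1 hz).2)
  have h2 := Finset.card_le_card h1
  have h3 := Finset.le_card_sdiff B Finset.univ
  rw [Finset.card_univ] at h3
  omega

theorem card_nbr_of_subset {V : Type*} [Fintype V] [DecidableEq V] {H : UniformHypergraph V 3}
    {a b : V} (B : Finset V) (h : ∀ z ∈ B, H.IsEdge a b z) : B.card ≤ (H.nbr a b).card :=
  Finset.card_le_card fun z hz => mem_nbr.2 (h z hz)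

/-- The edges are the triples containing both `v` and `x` and the triples containing neither. Edges
of different kinds share at most one vertex, so a tight path through `v` uses only the first kind;
its first and last edges would then share both `v` and `x`, but they share just one vertex. -/
theorem hasUncovered_TP3 {n : ℕ} (hn : 6 ≤ n) : HasUncovered TP3 n (n - 2) := by
  let v : Fin n := ⟨0, by omega⟩
  let x : Fin n := ⟨1, by omega⟩
  have hvx : v ≠ x := by simp [v, x, Fin.ext_iff]
  let R : Fin n → Fin n → Fin n → Prop := fun a b c =>
    ((a = v ∨ b = v ∨ c = v) ∧ (a = x ∨ b = x ∨ c = x)) ∨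
      (a ≠ v ∧ b ≠ v ∧ c ≠ v ∧ a ≠ x ∧ b ≠ x ∧ c ≠ x)
  have hE : ∀ a b c, (ofRel R).IsEdge a b c ↔ a ≠ b ∧ a ≠ c ∧ b ≠ c ∧ R a b c := fun a b c =>
    isEdge_ofRel (by intro a b c; simp only [R]; tauto) (by intro a b c; simp only [R]; tauto)
  have hvxd : n - 2 ≤ ((ofRel R).nbr v x).card := by
    have := le_card_nbr (H := ofRel R) (a := v) (b := x) {v, x} 2 Finset.card_le_two (by
      intro z hz
      simp only [Finset.mem_insert, Finset.mem_singleton] at hz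
      rw [hE]; simp only [R]; grind)
    simpa using this
  refine ⟨Fin n, inferInstance, inferInstance, ofRel R, v, by simp, fun y => ?_, ?_⟩
  · by_cases hy : y = v
    · subst hy; exact hvxd.trans (card_nbr_le_degree _ _ _)
    by_cases hy' : y = x
    · subst hy'; rw [nbr_comm] at hvxd; exact hvxd.trans (card_nbr_le_degree _ _ _)
    have hc : ∀ z, z ≠ v → z ≠ x → z ≠ y → n - 4 ≤ ((ofRel R).nbr y z).card := by
      intro z h1 h2 h3
      have := le_card_nbr (H := ofRel R) (a := y) (b := z) {v, x, y, z} 4 Finset.card_le_four (by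
        intro w hw
        simp only [Finset.mem_insert, Finset.mem_singleton] at hw
        rw [hE]; simp only [R]; grind)
      simpa using this
    have h1 : 1 ≤ ((ofRel R).nbr y v).card := by
      refine card_nbr_of_subset (H := ofRel R) (a := y) (b := v) {x} ?_
      intro z hz
      rw [Finset.mem_singleton] at hz
      rw [hE]; simp only [R]; grind
    have h1' : 1 ≤ ((ofRel R).nbr y x).card := by
      refine card_nbr_of_subset (H := ofRel R) (a := y) (b := x) {v} ?_
      intro z hz
      rw [Finset.mem_singleton] at hz
      rw [hE]; simp only [R]; grind
    have h2 := sum_card_nbr (ofRel R) y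
    have h3 : ({v, x, y} : Finset (Fin n)).card = 3 :=
      Finset.card_eq_three.2 ⟨v, x, y, hvx, Ne.symm hy, Ne.symm hy', rfl⟩
    have h4 : (n - 3) * (n - 4) ≤ ∑ z ∈ Finset.univ \ {v, x, y}, ((ofRel R).nbr y z).card := by
      have h5 : (Finset.univ \ {v, x, y} : Finset (Fin n)).card = n - 3 := by
        rw [Finset.card_sdiff_of_subset (Finset.subset_univ _), h3]; simp
      rw [← h5, ← smul_eq_mul]
      refine Finset.card_nsmul_le_sum _ _ _ fun z hz => ?_
      simp only [Finset.mem_sdiff, Finset.mem_univ, Finset.mem_insert, Finset.mem_singleton] at hz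
      exact hc z (by tauto) (by tauto) (by tauto)
    rw [← Finset.sum_sdiff (Finset.subset_univ ({v, x, y} : Finset (Fin n))),
      Finset.sum_insert (by simp; grind), Finset.sum_pair (Ne.symm hy')] at h2
    obtain ⟨k, rfl⟩ := Nat.exists_eq_add_of_le hn
    have e1 : 6 + k - 3 = k + 3 := by omega
    have e2 : 6 + k - 4 = k + 2 := by omega
    rw [e1, e2] at h4
    -- The handshake sum at `y` is at least `1 + 1 + (n - 3)(n - 4)`, and it must reach `2(n - 2)`;
    -- equality holds at `n = 6`.
    have : 2 * (k + 3) ≤ (k + 3) * (k + 2) := by nlinarith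
    omega
  · intro φ hφ w hw
    rw [isCopy_TP3] at hφ
    simp only [hE, R] at hφ
    obtain ⟨h1, h2, h3⟩ := hφ
    have hi : ∀ i j, φ i = φ j → i = j := fun i j h => φ.injective h
    have n1 : φ 0 ≠ φ 4 := fun h => absurd (hi _ _ h) (by decide)
    have n2 : φ 0 ≠ φ 3 := fun h => absurd (hi _ _ h) (by decide)
    have n3 : φ 1 ≠ φ 4 := fun h => absurd (hi _ _ h) (by decide)
    clear hi
    fin_cases w <;> simp at hw <;> grind

/-! ### Lower bound for `S3` -/

/-- The triples through `w` avoiding `v`, and those through `v` and one of `x`, `y` avoiding `w`. -/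
def StarPairs {V : Type*} (v w x y a b c : V) : Prop :=
  ((a = w ∨ b = w ∨ c = w) ∧ a ≠ v ∧ b ≠ v ∧ c ≠ v) ∨
    ((a = v ∨ b = v ∨ c = v) ∧ a ≠ w ∧ b ≠ w ∧ c ≠ w ∧
      (a = x ∨ b = x ∨ c = x ∨ a = y ∨ b = y ∨ c = y))

section StarPairs

variable {V : Type*} {v w x y a b c : V}

theorem StarPairs.of_eq (h : StarPairs v w x y a b c) (hx : v ≠ x) (hy : v ≠ y) (ha : a = v) :
    b = x ∨ c = x ∨ b = y ∨ c = y := by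
  subst ha
  rcases h with ⟨-, h, -⟩ | ⟨-, -, -, -, h⟩ <;> tauto

theorem StarPairs.of_ne (h : StarPairs v w x y a b c) (ha : a ≠ v) (hb : b ≠ v) (hc : c ≠ v) :
    a = w ∨ b = w ∨ c = w := by
  rcases h with ⟨h, -⟩ | ⟨h, -⟩ <;> tauto

theorem StarPairs.ne (h : StarPairs v w x y a b c) (ha : a = v ∨ b = v ∨ c = v) : a ≠ w := by
  rcases h with ⟨-, h⟩ | ⟨-, h, -⟩
  · tauto
  · exact h

end StarPairs

/-- A linear star with centre `a` whose first edge contains `v`. If `a = v`, the pairs are three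
disjoint link edges, yet each contains `x` or `y`. Otherwise `a ≠ w`, because edges at `v` avoid
`w`; the other two edges avoid `v`, so both contain `w`, which is not the centre. -/
theorem star_pairs_absurd {V : Type*} {v w x y : V} {a p q r s t u : V}
    (hvx : v ≠ x) (hvy : v ≠ y) (hv : a = v ∨ p = v ∨ q = v)
    (m1 : p ≠ r) (m2 : p ≠ s) (m3 : p ≠ t) (m4 : p ≠ u) (m5 : q ≠ r) (m6 : q ≠ s)
    (m7 : q ≠ t) (m8 : q ≠ u) (m9 : r ≠ t) (m10 : r ≠ u) (m11 : s ≠ t) (m12 : s ≠ u)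
    (h1 : StarPairs v w x y a p q)
    (h2 : StarPairs v w x y a r s)
    (h3 : StarPairs v w x y a t u) : False := by
  by_cases ha : a = v
  · have k1 : p = x ∨ q = x ∨ p = y ∨ q = y := h1.of_eq hvx hvy ha
    have k2 : r = x ∨ s = x ∨ r = y ∨ s = y := h2.of_eq hvx hvy ha
    have k3 : t = x ∨ u = x ∨ t = y ∨ u = y := h3.of_eq hvx hvy ha
    clear h1 h2 h3
    rcases k1 with k1 | k1 | k1 | k1 <;> rcases k2 with k2 | k2 | k2 | k2 <;>
      rcases k3 with k3 | k3 | k3 | k3 <;>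
      first
      | exact m1 (k1.trans k2.symm) | exact m2 (k1.trans k2.symm) | exact m5 (k1.trans k2.symm)
      | exact m6 (k1.trans k2.symm) | exact m3 (k1.trans k3.symm) | exact m4 (k1.trans k3.symm)
      | exact m7 (k1.trans k3.symm) | exact m8 (k1.trans k3.symm) | exact m9 (k2.trans k3.symm)
      | exact m10 (k2.trans k3.symm) | exact m11 (k2.trans k3.symm) | exact m12 (k2.trans k3.symm)
  · have k1 : p = v ∨ q = v := hv.resolve_left ha
    have k2 : a ≠ w := h1.ne hv
    have k3 : r = w ∨ s = w := by
      refine (h2.of_ne ha ?_ ?_).resolve_left k2 <;> rcases k1 with rfl | rfl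
      exacts [m1.symm, m5.symm, m2.symm, m6.symm]
    have k4 : t = w ∨ u = w := by
      refine (h3.of_ne ha ?_ ?_).resolve_left k2 <;> rcases k1 with rfl | rfl
      exacts [m3.symm, m7.symm, m4.symm, m8.symm]
    clear h1 h2 h3
    rcases k3 with k3 | k3 <;> rcases k4 with k4 | k4
    · exact m9 (k3.trans k4.symm)
    · exact m10 (k3.trans k4.symm)
    · exact m11 (k3.trans k4.symm)
    · exact m12 (k3.trans k4.symm)

theorem hasUncovered_S3 {n : ℕ} (hn : 6 ≤ n) : HasUncovered S3 n (n - 1) := by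
  let v : Fin n := ⟨0, by omega⟩
  let w : Fin n := ⟨1, by omega⟩
  let x : Fin n := ⟨2, by omega⟩
  let y : Fin n := ⟨3, by omega⟩
  have hvw : v ≠ w := by simp [v, w, Fin.ext_iff]
  have hvx : v ≠ x := by simp [v, x, Fin.ext_iff]
  have hvy : v ≠ y := by simp [v, y, Fin.ext_iff]
  have hwx : w ≠ x := by simp [w, x, Fin.ext_iff]
  have hwy : w ≠ y := by simp [w, y, Fin.ext_iff]
  have hxy : x ≠ y := by simp [x, y, Fin.ext_iff]
  clear_value v w x y
  let R : Fin n → Fin n → Fin n → Prop := StarPairs v w x y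
  have hE : ∀ a b c, (ofRel R).IsEdge a b c ↔ a ≠ b ∧ a ≠ c ∧ b ≠ c ∧ R a b c := by
    refine fun a b c => isEdge_ofRel ?_ ?_ <;> intro a b c
    · rintro (⟨h1, h2, h3, h4⟩ | ⟨h1, h2, h3, h4, h5⟩)
      · exact Or.inl ⟨by tauto, h3, h2, h4⟩
      · exact Or.inr ⟨by tauto, h3, h2, h4, by tauto⟩
    · rintro (⟨h1, h2, h3, h4⟩ | ⟨h1, h2, h3, h4, h5⟩)
      · exact Or.inl ⟨by tauto, h2, h4, h3⟩
      · exact Or.inr ⟨by tauto, h2, h4, h3, by tauto⟩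
  have hb : ∀ a b p : Fin n, (∀ z, z ≠ a → z ≠ b → z ≠ p → (ofRel R).IsEdge a b z) →
      n - 3 ≤ ((ofRel R).nbr a b).card := by
    intro a b p h
    have := le_card_nbr (H := ofRel R) (a := a) (b := b) {a, b, p} 3 Finset.card_le_three
      (fun z hz => by
        simp only [Finset.mem_insert, Finset.mem_singleton, not_or] at hz
        exact h z hz.1 hz.2.1 hz.2.2)
    simpa using this
  have hw : ∀ a, a ≠ v → a ≠ w → n - 3 ≤ ((ofRel R).nbr a w).card := by
    intro a h1 h2
    refine hb a w v fun z _ _ _ => ?_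
    rw [hE]; simp only [R, StarPairs]; grind
  have hv : ∀ a, a = x ∨ a = y → n - 3 ≤ ((ofRel R).nbr a v).card := by
    intro a h1
    refine hb a v w fun z _ _ _ => ?_
    rw [hE]; simp only [R, StarPairs]; grind
  refine ⟨Fin n, inferInstance, inferInstance, ofRel R, v, by simp, fun a => ?_, ?_⟩
  · by_cases ha : a = v
    · subst ha
      have h1 := hv x (Or.inl rfl)
      have h2 := hv y (Or.inr rfl)
      rw [nbr_comm] at h1 h2
      -- The degree is at least `2(n - 3) - 1`, which is at least `n - 1` because `6 ≤ n`.
      have := card_nbr_add_le (ofRel R) a hxy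
      omega
    by_cases ha' : a = w
    · subst ha'
      have h1 := hw x (Ne.symm hvx) (Ne.symm hwx)
      have h2 := hw y (Ne.symm hvy) (Ne.symm hwy)
      rw [nbr_comm] at h1 h2
      have := card_nbr_add_le (ofRel R) a hxy
      omega
    have h1 := hw a ha ha'
    have h2 : 2 ≤ ((ofRel R).nbr a v).card := by
      by_cases hax : a = x ∨ a = y
      · have := hv a hax; omega
      · rw [← Finset.card_pair hxy]
        refine card_nbr_of_subset (H := ofRel R) (a := a) (b := v) {x, y} ?_
        intro z hz
        simp only [Finset.mem_insert, Finset.mem_singleton] at hz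
        rw [hE]; simp only [R, StarPairs]; grind
    have := card_nbr_add_le_of_not_isEdge (ofRel R) a (Ne.symm hvw) (by
      rw [hE]; simp only [R, StarPairs]; grind)
    omega
  · intro φ hφ i hi
    rw [isCopy_S3] at hφ
    have hinj : ∀ i j, i ≠ j → φ i ≠ φ j := fun i j h h' => h (φ.injective h')
    have m13 := hinj 1 3 (by decide)
    have m14 := hinj 1 4 (by decide)
    have m15 := hinj 1 5 (by decide)
    have m16 := hinj 1 6 (by decide)
    have m23 := hinj 2 3 (by decide)
    have m24 := hinj 2 4 (by decide)
    have m25 := hinj 2 5 (by decide)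
    have m26 := hinj 2 6 (by decide)
    have m35 := hinj 3 5 (by decide)
    have m36 := hinj 3 6 (by decide)
    have m45 := hinj 4 5 (by decide)
    have m46 := hinj 4 6 (by decide)
    simp only [hE, R] at hφ
    obtain ⟨⟨-, -, -, h1⟩, ⟨-, -, -, h2⟩, -, -, -, h3⟩ := hφ
    have hv' : i = 0 ∨ i = 1 ∨ i = 2 ∨ i = 3 ∨ i = 4 ∨ i = 5 ∨ i = 6 := by
      clear * -; revert i; decide
    have key : (φ 0 = v ∨ φ 1 = v ∨ φ 2 = v) ∨ (φ 0 = v ∨ φ 3 = v ∨ φ 4 = v) ∨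
        (φ 0 = v ∨ φ 5 = v ∨ φ 6 = v) := by
      rcases hv' with rfl | rfl | rfl | rfl | rfl | rfl | rfl <;> simp [hi]
    rcases key with hv' | hv' | hv'
    · exact star_pairs_absurd hvx hvy hv' m13 m14 m15 m16 m23 m24 m25 m26 m35 m36 m45 m46
        h1 h2 h3
    · exact star_pairs_absurd hvx hvy hv' m13.symm m23.symm m35 m36 m14.symm m24.symm m45 m46
        m15 m16 m25 m26 h2 h1 h3
    · exact star_pairs_absurd hvx hvy hv' m15.symm m25.symm m35.symm m45.symm m16.symm m26.symm
        m36.symm m46.symm m13 m14 m23 m24 h3 h1 h2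

/-- The vertices other than `v` form `k` groups of three. The link of `v` is the union of the
triangles on the groups, and the remaining edges take one vertex from each of three groups. At least
three groups are needed for edges of the second kind, which is why `n = 7` is exceptional. -/
theorem hasUncovered_TP3_of_mod {k : ℕ} (hk : 3 ≤ k) : HasUncovered TP3 (3 * k + 1) (3 * k) := by
  let V := Option (Fin k × Fin 3)
  let v : V := none
  let g : V → Option (Fin k) := Option.map Prod.fst
  let R : V → V → V → Prop := fun a b c =>
    (a = v ∧ g b = g c) ∨ (b = v ∧ g a = g c) ∨ (c = v ∧ g a = g b) ∨
      (a ≠ v ∧ b ≠ v ∧ c ≠ v ∧ g a ≠ g b ∧ g a ≠ g c ∧ g b ≠ g c)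
  have hE : ∀ a b c, (ofRel R).IsEdge a b c ↔ a ≠ b ∧ a ≠ c ∧ b ≠ c ∧ R a b c := fun a b c =>
    isEdge_ofRel (by intro a b c; simp only [R]; grind) (by intro a b c; simp only [R]; grind)
  have hV : Fintype.card V = 3 * k + 1 := by simp [V, mul_comm]
  have hg : ∀ a, g a = none ↔ a = v := by simp [g, v]
  have hfib : ∀ a, a ≠ v → (Finset.univ.filter fun z => g z = g a).card = 3 := by
    intro a ha
    obtain ⟨⟨j, i⟩, rfl⟩ := Option.ne_none_iff_exists'.1 ha
    have : (Finset.univ.filter fun z => g z = g (some (j, i))) =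
        Finset.univ.map ⟨fun i : Fin 3 => (some (j, i) : V), by intro a b; simp⟩ := by
      ext z
      simp only [Finset.mem_filter, Finset.mem_univ, true_and, Finset.mem_map,
        g]
      rcases z with _ | ⟨p, q⟩
      · simp
      · constructor
        · intro h
          simp only [Option.map_some, Option.some.injEq] at h
          exact ⟨q, by rw [← h]; rfl⟩
        · rintro ⟨a, ha⟩
          have : some (j, a) = some (p, q) := ha
          simp only [Option.some.injEq, Prod.mk.injEq] at this
          simp [this.1]
    rw [this, Finset.card_map]; simp
  refine ⟨V, inferInstance, inferInstance, ofRel R, v, hV, fun a => ?_, ?_⟩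
  · by_cases ha : a = v
    · have h := card_mul_le_two_mul_degree (ofRel R) a (Finset.univ.erase v) 2 (by
        intro z hz
        have hz := Finset.ne_of_mem_erase hz
        have h1 : ((Finset.univ.filter fun y => g y = g z).erase z).card = 2 := by
          rw [Finset.card_erase_of_mem (by simp), hfib z hz]
        rw [← h1]
        refine card_nbr_of_subset (H := ofRel R) (a := a) (b := z) _ fun y hy => ?_
        simp only [Finset.mem_erase, Finset.mem_filter, Finset.mem_univ, true_and] at hy
        rw [hE]; simp only [R]; grind)
      rw [Finset.card_erase_of_mem (Finset.mem_univ _), Finset.card_univ, hV] at h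
      omega
    · let B := Finset.univ.filter fun z => g z = g a
      have h := card_mul_le_two_mul_degree (ofRel R) a (Finset.univ \ (insert v B))
        (3 * k - 6) (by
        intro z hz
        simp only [B, Finset.mem_sdiff, Finset.mem_insert, Finset.mem_filter, Finset.mem_univ,
          true_and, not_or] at hz
        have := le_card_nbr (H := ofRel R) (a := a) (b := z)
          (insert v (B ∪ Finset.univ.filter fun y => g y = g z)) 7 (by
            refine (Finset.card_insert_le _ _).trans ?_
            have := Finset.card_union_le B (Finset.univ.filter fun y => g y = g z)
            rw [hfib a ha, hfib z hz.1] at this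
            omega) (by
            intro y hy
            simp only [B, Finset.mem_insert, Finset.mem_union, Finset.mem_filter, Finset.mem_univ,
              true_and, not_or] at hy
            rw [hE]; simp only [R]; grind)
        rw [hV] at this
        omega)
      have h2 := Finset.le_card_sdiff (insert v B) Finset.univ
      have h3 := Finset.card_insert_le v B
      rw [hfib a ha] at h3
      rw [Finset.card_univ, hV] at h2
      have h4 : 3 * k - 3 ≤ (Finset.univ \ insert v B).card := by omega
      have h5 := (Nat.mul_le_mul_right (3 * k - 6) h4).trans h
      obtain ⟨l, rfl⟩ := Nat.exists_eq_add_of_le hk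
      have e1 : 3 * (3 + l) - 3 = 3 * l + 6 := by omega
      have e2 : 3 * (3 + l) - 6 = 3 * l + 3 := by omega
      rw [e1, e2] at h5
      nlinarith
  · intro φ hφ w hw
    rw [isCopy_TP3] at hφ
    simp only [hE, R] at hφ
    obtain ⟨h1, h2, h3⟩ := hφ
    have hi : ∀ i j, φ i = φ j → i = j := fun i j h => φ.injective h
    have n1 : φ 0 ≠ φ 4 := fun h => absurd (hi _ _ h) (by decide)
    have n2 : φ 0 ≠ φ 3 := fun h => absurd (hi _ _ h) (by decide)
    have n3 : φ 1 ≠ φ 4 := fun h => absurd (hi _ _ h) (by decide)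
    have hi' := hi
    clear hi
    have g0 := hg (φ 0)
    have g1 := hg (φ 1)
    have g2 := hg (φ 2)
    have g3 := hg (φ 3)
    have g4 := hg (φ 4)
    have gv := (hg v).2 rfl
    have n4 : φ 0 ≠ φ 1 := fun h => absurd (hi' _ _ h) (by decide)
    have n5 : φ 3 ≠ φ 4 := fun h => absurd (hi' _ _ h) (by decide)
    have n6 : φ 1 ≠ φ 3 := fun h => absurd (hi' _ _ h) (by decide)
    -- `φ 2` lies in all three edges. If it were `v`, the other four vertices would form a path in
    -- the link, hence lie in a single group of three.
    have n7 : φ 2 ≠ v := by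
      intro h
      have hcard : ({φ 0, φ 1, φ 3, φ 4} : Finset V).card = 4 := by
        simp [Finset.card_insert_of_notMem, n1, n2, n3, n4, n5, n6]
      have hsub : ({φ 0, φ 1, φ 3, φ 4} : Finset V) ⊆
          Finset.univ.filter fun z => g z = g (φ 0) := by
        intro z hz
        simp only [Finset.mem_insert, Finset.mem_singleton] at hz
        simp only [Finset.mem_filter, Finset.mem_univ, true_and]
        clear hg hfib hE hcard hi' w hw
        clear_value g v
        grind
      have := Finset.card_le_card hsub
      rw [hcard, hfib _ (by grind)] at this
      omega
    clear hg hfib hE hi'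
    clear_value g v
    fin_cases w <;> simp at hw <;> grind

/-! ### Lower bound for `K113`: a link made of cycles -/

section Cycle

variable {V : Type*} (v : V) (s : V ≃ V)

/-- Consecutive under the permutation `s`. -/
def Consec (a b : V) : Prop := s a = b ∨ s b = a

variable {s} in
theorem Consec.symm {a b : V} (h : Consec s a b) : Consec s b a := Or.symm h

/-- `v` with two consecutive vertices, or three vertices no two of which are consecutive. -/
def CycleRel (a b c : V) : Prop :=
  (a = v ∧ Consec s b c) ∨ (b = v ∧ Consec s a c) ∨ (c = v ∧ Consec s a b) ∨
    ((a ≠ v ∧ b ≠ v ∧ c ≠ v) ∧ ¬ Consec s a b ∧ ¬ Consec s a c ∧ ¬ Consec s b c)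

variable {v s}

theorem CycleRel.swap {a b c : V} (h : CycleRel v s a b c) : CycleRel v s b a c := by
  rcases h with h | h | h | ⟨h1, h2, h3, h4⟩
  · exact Or.inr (Or.inl h)
  · exact Or.inl h
  · exact Or.inr (Or.inr (Or.inl ⟨h.1, h.2.symm⟩))
  · exact Or.inr (Or.inr (Or.inr ⟨⟨h1.2.1, h1.1, h1.2.2⟩, fun h => h2 h.symm, h4, h3⟩))

theorem CycleRel.swap_right {a b c : V} (h : CycleRel v s a b c) : CycleRel v s a c b := by
  rcases h with h | h | h | ⟨h1, h2, h3, h4⟩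
  · exact Or.inl ⟨h.1, h.2.symm⟩
  · exact Or.inr (Or.inr (Or.inl h))
  · exact Or.inr (Or.inl h)
  · exact Or.inr (Or.inr (Or.inr ⟨⟨h1.1, h1.2.2, h1.2.1⟩, h3, h2, fun h => h4 h.symm⟩))

variable [Fintype V] [DecidableEq V]

theorem isEdge_cycleRel {a b c : V} :
    (ofRel (CycleRel v s)).IsEdge a b c ↔ a ≠ b ∧ a ≠ c ∧ b ≠ c ∧ CycleRel v s a b c :=
  isEdge_ofRel (R := CycleRel v s) (fun _ _ _ h => CycleRel.swap h)
    (fun _ _ _ h => CycleRel.swap_right h)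

/-- A pair containing `v` has codegree at most two, namely the successor and the predecessor of the
other vertex. A pair that forms an edge with `v` is consecutive and so lies in no other edge. Hence
`v` is neither in the common pair of a copy nor one of its three ends. -/
theorem cycleRel_avoids (hsv : s v = v) (φ : Fin 5 ↪ V)
    (hφ : K113.IsCopy (ofRel (CycleRel v s)) φ) (w : Fin 5) : φ w ≠ v := by
  intro hw
  have hsi : ∀ a b, s a = s b → a = b := fun a b h => s.injective h
  rw [isCopy_K113] at hφ
  obtain ⟨h1, h2, h3⟩ := hφ
  have hi : ∀ i j, φ i = φ j → i = j := fun i j h => φ.injective h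
  have n1 : φ 2 ≠ φ 3 := fun h => absurd (hi _ _ h) (by decide)
  have n2 : φ 2 ≠ φ 4 := fun h => absurd (hi _ _ h) (by decide)
  have n3 : φ 3 ≠ φ 4 := fun h => absurd (hi _ _ h) (by decide)
  have hA : ∀ b c, (ofRel (CycleRel v s)).IsEdge v b c → Consec s b c := by
    intro b c h
    have hn := h.ne
    rcases (isEdge_cycleRel.1 h).2.2.2 with h | h | h | h
    · exact h.2
    · exact absurd h.1.symm hn.1
    · exact absurd h.1.symm hn.2.1
    · exact absurd rfl h.1.1
  have hB : ∀ a b c, (ofRel (CycleRel v s)).IsEdge a b c → a ≠ v → b ≠ v → c ≠ v →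
      ¬ Consec s a b := by
    intro a b c h h1 h2 h3
    rcases (isEdge_cycleRel.1 h).2.2.2 with h | h | h | h
    exacts [absurd h.1 h1, absurd h.1 h2, absurd h.1 h3, h.2.1]
  have hC : ∀ a b c d e, (ofRel (CycleRel v s)).IsEdge a b c →
      (ofRel (CycleRel v s)).IsEdge a b d → (ofRel (CycleRel v s)).IsEdge a b e →
      c ≠ d → c ≠ e → d ≠ e → a ≠ v := by
    rintro a b c d e h1 h2 h3 hcd hce hde rfl
    rcases hA _ _ h1 with h1 | h1 <;> rcases hA _ _ h2 with h2 | h2 <;>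
      rcases hA _ _ h3 with h3 | h3 <;> grind
  have hD : ∀ a b c d, (ofRel (CycleRel v s)).IsEdge a b c →
      (ofRel (CycleRel v s)).IsEdge a b d → c ≠ d → c ≠ v := by
    rintro a b c d h1 h2 hcd rfl
    exact hB _ _ _ h2 h1.ne.2.1 h1.ne.2.2 hcd.symm (hA _ _ h1.swap_right.swap)
  have hw' : w = 0 ∨ w = 1 ∨ w = 2 ∨ w = 3 ∨ w = 4 := by
    clear * -; revert w; decide
  rcases hw' with rfl | rfl | rfl | rfl | rfl
  · exact hC _ _ _ _ _ h1 h2 h3 n1 n2 n3 hw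
  · exact hC _ _ _ _ _ h1.swap h2.swap h3.swap n1 n2 n3 hw
  · exact hD _ _ _ _ h1 h2 n1 hw
  · exact hD _ _ _ _ h2 h1 n1.symm hw
  · exact hD _ _ _ _ h3 h1 n2.symm hw

/-- The absence of short orbits makes a vertex, its two neighbours and its two vertices at distance
two all distinct. The codegree of a nonconsecutive pair loses `v` and two arcs of three vertices; at
distance two the arcs overlap, which gains one. -/
theorem hasUncovered_K113_of_perm {V : Type} [Fintype V] [DecidableEq V] {v : V} {s : V ≃ V}
    {m : ℕ} (hm : 8 ≤ m) (hV : Fintype.card V = m + 1) (hsv : s v = v)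
    (hs1 : ∀ a, a ≠ v → s a ≠ a) (hs2 : ∀ a, a ≠ v → s (s a) ≠ a)
    (hs3 : ∀ a, a ≠ v → s (s (s a)) ≠ a) (hs4 : ∀ a, a ≠ v → s (s (s (s a))) ≠ a) :
    HasUncovered K113 (m + 1) m := by
  have hsi : ∀ a b, s a = s b → a = b := fun a b h => s.injective h
  have hsn : ∀ a, a ≠ v → s a ≠ v := fun a h h' => h (hsi _ _ (h'.trans hsv.symm))
  have hsurj : ∀ a, a ≠ v → ∃ b, b ≠ v ∧ s b = a := fun a h => by
    obtain ⟨b, rfl⟩ := s.surjective a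
    exact ⟨b, fun h' => h (by rw [h', hsv]), rfl⟩
  have hvc : ∀ a b, a ≠ v → b ≠ v → a ≠ b → Consec s a b →
      (ofRel (CycleRel v s)).IsEdge a b v := fun a b ha hb hab h =>
    isEdge_cycleRel.2 ⟨hab, ha, hb, Or.inr (Or.inr (Or.inl ⟨rfl, h⟩))⟩
  have hva : ∀ a, a ≠ v → 2 ≤ ((ofRel (CycleRel v s)).nbr a v).card := by
    intro a ha
    obtain ⟨b, hb, rfl⟩ := hsurj a ha
    rw [← Finset.card_pair (hs2 b hb)]
    refine card_nbr_of_subset _ fun z hz => ?_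
    simp only [Finset.mem_insert, Finset.mem_singleton] at hz
    rcases hz with rfl | rfl
    · exact (hvc _ _ ha (hsn _ ha) (hs1 _ ha).symm (Or.inl rfl)).swap_right
    · exact (hvc _ _ ha hb (hs1 _ hb) (Or.inr rfl)).swap_right
  have hnc : ∀ a b, a ≠ v → b ≠ v → a ≠ b → ¬ Consec s a b →
      m - 6 ≤ ((ofRel (CycleRel v s)).nbr a b).card ∧
        (s (s a) = b → m - 5 ≤ ((ofRel (CycleRel v s)).nbr a b).card) := by
    intro a b ha hb hab hc
    obtain ⟨a, ha', rfl⟩ := hsurj a ha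
    obtain ⟨b, hb', rfl⟩ := hsurj b hb
    have key : ∀ z, z ∉ ({v, a, s a, s (s a), b, s b, s (s b)} : Finset V) →
        (ofRel (CycleRel v s)).IsEdge (s a) (s b) z := by
      intro z hz
      simp only [Finset.mem_insert, Finset.mem_singleton, not_or] at hz
      obtain ⟨z1, z2, z3, z4, z5, z6, z7⟩ := hz
      refine isEdge_cycleRel.2 ⟨hab, Ne.symm z3, Ne.symm z6, Or.inr (Or.inr (Or.inr
        ⟨⟨ha, hb, z1⟩, hc, ?_, ?_⟩))⟩
      · rintro (h | h)
        · exact z4 h.symm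
        · exact z2 (hsi _ _ h)
      · rintro (h | h)
        · exact z7 h.symm
        · exact z5 (hsi _ _ h)
    constructor
    · have := le_card_nbr _ 7 (by
        have h1 := Finset.card_insert_le v ({a, s a, s (s a), b, s b, s (s b)} : Finset V)
        have h2 := Finset.card_le_six (a := a) (b := s a) (c := s (s a)) (d := b) (e := s b)
          (f := s (s b))
        exact h1.trans (by omega)) key
      omega
    · intro h
      have h' : s (s a) = b := hsi _ _ h
      have := le_card_nbr _ 6 (by
        have h2 := Finset.card_le_six (a := v) (b := a) (c := s a) (d := b) (e := s b)
          (f := s (s b))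
        refine (Finset.card_le_card ?_).trans h2
        intro z hz
        simp only [Finset.mem_insert, Finset.mem_singleton, h'] at hz ⊢
        tauto) key
      omega
  refine ⟨V, inferInstance, inferInstance, ofRel (CycleRel v s), v, hV, fun a => ?_, ?_⟩
  · by_cases ha : a = v
    · subst ha
      have h := card_mul_le_two_mul_degree (ofRel (CycleRel a s)) a (Finset.univ.erase a) 2 (by
        intro z hz
        rw [nbr_comm]
        exact hva z (Finset.ne_of_mem_erase hz))
      rw [Finset.card_erase_of_mem (Finset.mem_univ _), Finset.card_univ, hV] at h
      omega
    · have hva := hva a ha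
      obtain ⟨b, hb, rfl⟩ := hsurj a ha
      obtain ⟨c, hc, rfl⟩ := hsurj b hb
      have d1 := hs1 c hc
      have d2 := hs2 c hc
      have d3 := hs3 c hc
      have d4 := hs4 c hc
      have d5 := hs1 _ hb
      have d6 := hs2 _ hb
      have d7 := hs3 _ hb
      have d8 := hs1 _ ha
      have d9 := hs2 _ ha
      have e1 := hsn _ ha
      have e2 := hsn _ e1
      have d10 := hs1 _ e1
      have k1 : 1 ≤ ((ofRel (CycleRel v s)).nbr (s (s c)) (s c)).card :=
        card_nbr_of_subset {v} fun z hz => by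
          rw [Finset.mem_singleton.1 hz]
          exact hvc _ _ ha hb d5 (Or.inr rfl)
      have k2 : 1 ≤ ((ofRel (CycleRel v s)).nbr (s (s c)) (s (s (s c)))).card :=
        card_nbr_of_subset {v} fun z hz => by
          rw [Finset.mem_singleton.1 hz]
          exact hvc _ _ ha e1 (Ne.symm d8) (Or.inl rfl)
      have k3 := (hnc _ _ ha e2 (Ne.symm d9) (by
        rintro (h | h)
        · exact d10 h.symm
        · exact hs3 _ ha h)).2 rfl
      have k4 := (hnc _ _ hc ha (Ne.symm d2) (by
        rintro (h | h)
        · exact d5 h.symm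
        · exact d3 h)).2 rfl
      rw [nbr_comm] at k4
      let P : Finset V := {v, c, s c, s (s c), s (s (s c)), s (s (s (s c)))}
      have hP : P.card ≤ 6 := Finset.card_le_six
      have h5 : m - 5 ≤ (Finset.univ \ P).card := by
        have h2 := Finset.le_card_sdiff P Finset.univ
        rw [Finset.card_univ, hV] at h2
        omega
      have h4 : (m - 5) * (m - 6) ≤
          ∑ z ∈ Finset.univ \ P, ((ofRel (CycleRel v s)).nbr (s (s c)) z).card := by
        refine (Nat.mul_le_mul_right _ h5).trans ?_
        rw [← smul_eq_mul]
        refine Finset.card_nsmul_le_sum _ _ _ fun z hz => ?_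
        simp only [P, Finset.mem_sdiff, Finset.mem_univ, Finset.mem_insert, Finset.mem_singleton,
          true_and, not_or] at hz
        obtain ⟨z1, z2, z3, z4, z5, z6⟩ := hz
        refine (hnc _ _ ha z1 (Ne.symm z4) ?_).1
        rintro (h | h)
        · exact z5 h.symm
        · exact z3 (hsi _ _ h)
      -- The codegrees with `v`, the two neighbours, the two vertices at distance two and the rest
      -- sum to at least `2 + 1 + 1 + 2(m - 5) + (m - 5)(m - 6)`, which equals `2m` at `m = 8`.
      have h6 := sum_card_nbr (ofRel (CycleRel v s)) (s (s c))
      rw [← Finset.sum_sdiff (Finset.subset_univ P),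
        Finset.sum_insert (by simp [Ne.symm hc, Ne.symm hb, Ne.symm ha, Ne.symm e1, Ne.symm e2]),
        Finset.sum_insert (by simp [Ne.symm d1, Ne.symm d2, Ne.symm d3, Ne.symm d4]),
        Finset.sum_insert (by simp [Ne.symm d5, Ne.symm d6, Ne.symm d7]),
        Finset.sum_insert (by simp [Ne.symm d8, Ne.symm d9]),
        Finset.sum_pair (Ne.symm d10)] at h6
      obtain ⟨k, rfl⟩ := Nat.exists_eq_add_of_le hm
      have x1 : 8 + k - 5 = k + 3 := by omega
      have x2 : 8 + k - 6 = k + 2 := by omega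
      rw [x1, x2] at h4
      rw [x1] at k3 k4
      have : 3 * k + 6 ≤ (k + 3) * (k + 2) := by nlinarith
      omega
  · exact cycleRel_avoids hsv

theorem hasUncovered_K113 {m : ℕ} (hm : 8 ≤ m) : HasUncovered K113 (m + 1) m := by
  have : NeZero m := ⟨by omega⟩
  have hc : ∀ j : ℕ, 0 < j → j < m → (j : ZMod m) ≠ 0 := by
    intro j h1 h2 h3
    rw [ZMod.natCast_eq_zero_iff] at h3
    exact absurd (Nat.le_of_dvd h1 h3) (by omega)
  refine hasUncovered_K113_of_perm (V := Option (ZMod m)) (v := none)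
    (s := Equiv.optionCongr (Equiv.addRight (1 : ZMod m))) hm (by simp [ZMod.card]) rfl ?_ ?_ ?_ ?_
  all_goals
    intro a ha
    obtain ⟨i, rfl⟩ := Option.ne_none_iff_exists'.1 ha
    simp only [Equiv.optionCongr_apply, Option.map_some, Equiv.coe_addRight, ne_eq,
      Option.some.injEq, add_assoc, add_eq_left]
  · simpa using hc 1 (by omega) (by omega)
  · have := hc 2 (by omega) (by omega); norm_num at this ⊢; exact this
  · have := hc 3 (by omega) (by omega); norm_num at this ⊢; exact this
  · have := hc 4 (by omega) (by omega); norm_num at this ⊢; exact this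

end Cycle

/-! ### Lower bound for `GS3`, even number of vertices -/

section ApexFamily

/-- On a base vertex `none`, an apex `some none` and two copies of `ZMod k`: the base and the apex
with any left vertex, two left vertices with the right vertex at their sum, three right vertices. -/
def ApexRel (k : ℕ) : Option (Option (ZMod k ⊕ ZMod k)) → Option (Option (ZMod k ⊕ ZMod k)) →
    Option (Option (ZMod k ⊕ ZMod k)) → Prop
  | none, some none, some (some (Sum.inl _)) => True
  | none, some (some (Sum.inl _)), some none => True
  | some none, none, some (some (Sum.inl _)) => True
  | some none, some (some (Sum.inl _)), none => True
  | some (some (Sum.inl _)), some none, none => True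
  | some (some (Sum.inl _)), none, some none => True
  | some (some (Sum.inl i)), some (some (Sum.inl j)), some (some (Sum.inr l)) => i + j = l
  | some (some (Sum.inl i)), some (some (Sum.inr l)), some (some (Sum.inl j)) => i + j = l
  | some (some (Sum.inr l)), some (some (Sum.inl i)), some (some (Sum.inl j)) => i + j = l
  | some (some (Sum.inr _)), some (some (Sum.inr _)), some (some (Sum.inr _)) => True
  | _, _, _ => False

theorem ApexRel.swap {k : ℕ} : ∀ a b c, ApexRel k a b c → ApexRel k b a c := by
  rintro (_ | _ | _ | _) (_ | _ | _ | _) (_ | _ | _ | _) <;> simp [ApexRel, add_comm]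

theorem ApexRel.swap_right {k : ℕ} : ∀ a b c, ApexRel k a b c → ApexRel k a c b := by
  rintro (_ | _ | _ | _) (_ | _ | _ | _) (_ | _ | _ | _) <;> simp [ApexRel, add_comm]

variable {k : ℕ}

theorem isEdge_apexRel [NeZero k] {a b c : Option (Option (ZMod k ⊕ ZMod k))} :
    (ofRel (ApexRel k)).IsEdge a b c ↔ a ≠ b ∧ a ≠ c ∧ b ≠ c ∧ ApexRel k a b c :=
  isEdge_ofRel (R := ApexRel k) ApexRel.swap ApexRel.swap_right

theorem ApexRel.of_none : ∀ {b c}, ApexRel k none b c → b = some none ∨ c = some none := by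
  rintro (_ | _ | _ | _) (_ | _ | _ | _) <;> simp [ApexRel]

theorem ApexRel.of_apex : ∀ {b c}, ApexRel k (some none) b c → b = none ∨ c = none := by
  rintro (_ | _ | _ | _) (_ | _ | _ | _) <;> simp [ApexRel]

theorem ApexRel.unique (i : ZMod k) : ∀ {b c d}, ApexRel k (some (some (Sum.inl i))) b c →
    ApexRel k (some (some (Sum.inl i))) b d → c = d := by
  rintro (_ | _ | j | j) (_ | _ | c | c) (_ | _ | d | d) <;> simp [ApexRel]
  · intro h1 h2; rw [← h1, h2]
  · intro h1 h2; exact add_left_cancel (h1.trans h2.symm)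

/-- By the place of the centre `φ 0`. At the base or the apex all edges share a second vertex, while
two edges of `GS3` meet only in the centre. At a left vertex all codegrees are at most one, while
`GS3` has a pair of codegree two. At a right vertex no edge contains the base vertex. -/
theorem apexRel_avoids [NeZero k] (φ : Fin 6 ↪ Option (Option (ZMod k ⊕ ZMod k)))
    (hφ : GS3.IsCopy (ofRel (ApexRel k)) φ) (w : Fin 6) : φ w ≠ none := by
  intro hw
  rw [isCopy_GS3] at hφ
  simp only [isEdge_apexRel] at hφ
  obtain ⟨⟨n1, n2, n3, h1⟩, ⟨-, n4, n5, h2⟩, n6, n7, n8, h3⟩ := hφ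
  have hinj : ∀ i j, i ≠ j → φ i ≠ φ j := fun i j h h' => h (φ.injective h')
  have m14 := hinj 1 4 (by decide)
  have m15 := hinj 1 5 (by decide)
  have m24 := hinj 2 4 (by decide)
  have m25 := hinj 2 5 (by decide)
  have m34 := hinj 3 4 (by decide)
  have m35 := hinj 3 5 (by decide)
  have m23 := hinj 2 3 (by decide)
  have hw' : w = 0 ∨ w = 1 ∨ w = 2 ∨ w = 3 ∨ w = 4 ∨ w = 5 := by
    clear * -; revert w; decide
  clear hinj
  have hright : ∀ l b, ¬ ApexRel k (some (some (Sum.inr l))) none b := by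
    rintro l (_ | _ | _ | _) <;> simp [ApexRel]
  generalize ha : φ 0 = a at *
  rcases a with _ | _ | i | l
  · have k1 := h1.of_none
    have k2 := h2.of_none
    have k3 := h3.of_none
    clear h1 h2 h3 hw hw' hright
    grind
  · have k1 := h1.of_apex
    have k2 := h2.of_apex
    have k3 := h3.of_apex
    clear h1 h2 h3 hw hw' hright
    grind
  · exact m23 (ApexRel.unique i h1 h2)
  · rcases hw' with rfl | rfl | rfl | rfl | rfl | rfl
    · rw [ha] at hw; simp at hw
    · rw [hw] at h1; exact hright _ _ h1
    · rw [hw] at h1; exact hright _ _ (ApexRel.swap_right _ _ _ h1)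
    · rw [hw] at h2; exact hright _ _ (ApexRel.swap_right _ _ _ h2)
    · rw [hw] at h3; exact hright _ _ h3
    · rw [hw] at h3; exact hright _ _ (ApexRel.swap_right _ _ _ h3)

theorem hasUncovered_GS3_even (hk : 6 ≤ k) : HasUncovered GS3 (2 * k + 2) k := by
  have : NeZero k := ⟨by omega⟩
  have hV : Fintype.card (Option (Option (ZMod k ⊕ ZMod k))) = 2 * k + 2 := by
    simp [ZMod.card]; omega
  have hL : (Finset.univ.image fun i : ZMod k =>
      (some (some (Sum.inl i)) : Option (Option (ZMod k ⊕ ZMod k)))).card = k := by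
    rw [Finset.card_image_of_injective _ (by intro i j; simp)]; simp [ZMod.card]
  have hR : (Finset.univ.image fun i : ZMod k =>
      (some (some (Sum.inr i)) : Option (Option (ZMod k ⊕ ZMod k)))).card = k := by
    rw [Finset.card_image_of_injective _ (by intro i j; simp)]; simp [ZMod.card]
  have hb : k ≤ ((ofRel (ApexRel k)).nbr none (some none)).card := by
    refine le_of_eq_of_le hL.symm (card_nbr_of_subset _ fun z hz => ?_)
    obtain ⟨i, -, rfl⟩ := Finset.mem_image.1 hz
    exact isEdge_apexRel.2 (by simp [ApexRel])
  refine ⟨_, inferInstance, inferInstance, ofRel (ApexRel k), none, hV, ?_, apexRel_avoids⟩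
  rintro (_ | _ | i | i)
  · exact hb.trans (card_nbr_le_degree _ _ _)
  · rw [nbr_comm] at hb; exact hb.trans (card_nbr_le_degree _ _ _)
  · have h := card_mul_le_two_mul_degree (ofRel (ApexRel k)) (some (some (Sum.inl i)))
      -- The link of a left vertex `i` matches all other vertices except the right vertex `i + i`,
      -- whose partner would be `i` itself. The matched vertices number `2k`.
      (Finset.univ \ {some (some (Sum.inl i)), some (some (Sum.inr (i + i)))}) 1 (by
        intro z hz
        simp only [Finset.mem_sdiff, Finset.mem_univ, Finset.mem_insert, Finset.mem_singleton,
          true_and, not_or] at hz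
        obtain ⟨z1, z2⟩ := hz
        rw [Nat.succ_le_iff, Finset.card_pos]
        rcases z with _ | _ | j | j
        · exact ⟨some none, mem_nbr.2 (isEdge_apexRel.2 (by simp [ApexRel]))⟩
        · exact ⟨none, mem_nbr.2 (isEdge_apexRel.2 (by simp [ApexRel]))⟩
        · refine ⟨some (some (Sum.inr (i + j))), mem_nbr.2 (isEdge_apexRel.2 ?_)⟩
          simp only [Option.some.injEq, Sum.inl.injEq] at z1
          simp [ApexRel, Ne.symm z1]
        · refine ⟨some (some (Sum.inl (j - i))), mem_nbr.2 (isEdge_apexRel.2 ?_)⟩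
          simp only [Option.some.injEq, Sum.inr.injEq] at z2
          simp only [ne_eq, ApexRel, Option.some.injEq, reduceCtorEq, not_false_eq_true,
            Sum.inl.injEq, add_sub_cancel, and_true, true_and]
          intro h
          exact z2 (by rw [eq_comm, sub_eq_iff_eq_add] at h; exact h))
    have h2 := Finset.le_card_sdiff ({some (some (Sum.inl i)), some (some (Sum.inr (i + i)))} :
      Finset (Option (Option (ZMod k ⊕ ZMod k)))) Finset.univ
    rw [Finset.card_univ, hV] at h2
    have h3 := Finset.card_le_two (a := (some (some (Sum.inl i)) :
      Option (Option (ZMod k ⊕ ZMod k)))) (b := some (some (Sum.inr (i + i))))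
    omega
  · set S := Finset.univ.image fun i : ZMod k =>
      (some (some (Sum.inr i)) : Option (Option (ZMod k ⊕ ZMod k))) with hS
    have h := card_mul_le_two_mul_degree (ofRel (ApexRel k)) (some (some (Sum.inr i)))
      (S.erase (some (some (Sum.inr i)))) (k - 2) (by
        intro z hz
        obtain ⟨hzi, hz⟩ := Finset.mem_erase.1 hz
        have : ((S.erase (some (some (Sum.inr i)))).erase z).card = k - 2 := by
          rw [Finset.card_erase_of_mem (Finset.mem_erase.2 ⟨hzi, hz⟩),
            Finset.card_erase_of_mem (by simp [hS]), hR]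
          omega
        rw [← this]
        refine card_nbr_of_subset _ fun y hy => ?_
        obtain ⟨hyz, hy1⟩ := Finset.mem_erase.1 hy
        obtain ⟨hyi, hy2⟩ := Finset.mem_erase.1 hy1
        refine isEdge_apexRel.2 ⟨Ne.symm hzi, Ne.symm hyi, Ne.symm hyz, ?_⟩
        obtain ⟨j, -, rfl⟩ := Finset.mem_image.1 hz
        obtain ⟨l, -, rfl⟩ := Finset.mem_image.1 hy2
        simp [ApexRel])
    rw [Finset.card_erase_of_mem (by simp [hS]), hR] at h
    obtain ⟨l, rfl⟩ := Nat.exists_eq_add_of_le hk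
    have x1 : 6 + l - 1 = l + 5 := by omega
    have x2 : 6 + l - 2 = l + 4 := by omega
    rw [x1, x2] at h
    nlinarith

end ApexFamily

/-! ### Lower bound for `GS3`, odd number of vertices -/

section PairedFamily

/-- On a group `A` (without `0`) and `p` further pairs of vertices: the triples of group elements
with sum `0`, and each pair with any group element. -/
def PairedRel (A : Type) [AddCommGroup A] (p : ℕ) :
    {a : A // a ≠ 0} ⊕ (Fin p × Bool) → {a : A // a ≠ 0} ⊕ (Fin p × Bool) →
    {a : A // a ≠ 0} ⊕ (Fin p × Bool) → Prop
  | Sum.inl a, Sum.inl b, Sum.inl c => a.1 + b.1 + c.1 = 0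
  | Sum.inl _, Sum.inr x, Sum.inr y => x.1 = y.1
  | Sum.inr x, Sum.inl _, Sum.inr y => x.1 = y.1
  | Sum.inr x, Sum.inr y, Sum.inl _ => x.1 = y.1
  | _, _, _ => False

variable {A : Type} [AddCommGroup A] {p : ℕ}

theorem PairedRel.swap : ∀ a b c, PairedRel A p a b c → PairedRel A p b a c := by
  rintro (a | a) (b | b) (c | c) <;> simp only [PairedRel, imp_self, eq_comm]
  rw [add_comm b.1]; exact id

theorem PairedRel.swap_right : ∀ a b c, PairedRel A p a b c → PairedRel A p a c b := by
  rintro (a | a) (b | b) (c | c) <;> simp only [PairedRel, imp_self, eq_comm]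
  rw [add_right_comm]; exact id

variable [Fintype A] [DecidableEq A]

theorem isEdge_pairedRel {a b c : {a : A // a ≠ 0} ⊕ (Fin p × Bool)} :
    (ofRel (PairedRel A p)).IsEdge a b c ↔ a ≠ b ∧ a ≠ c ∧ b ≠ c ∧ PairedRel A p a b c :=
  isEdge_ofRel (R := PairedRel A p) PairedRel.swap PairedRel.swap_right

theorem eq_of_fst_eq_of_bool {x y z : Fin p × Bool} (hxy : x ≠ y) (hxz : x ≠ z) (h1 : x.1 = y.1)
    (h2 : x.1 = z.1) : y = z := by
  obtain ⟨x1, x2⟩ := x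
  obtain ⟨y1, y2⟩ := y
  obtain ⟨z1, z2⟩ := z
  simp only at h1 h2
  subst h1 h2
  cases x2 <;> cases y2 <;> cases z2 <;> simp_all

/-- There is no copy at all. A group element has codegree at most one with every vertex, so it is
not the centre; and all edges at a vertex of a pair contain its partner, while two edges of `GS3`
meet only in the centre. -/
theorem pairedRel_avoids (φ : Fin 6 ↪ {a : A // a ≠ 0} ⊕ (Fin p × Bool))
    (hφ : GS3.IsCopy (ofRel (PairedRel A p)) φ) : False := by
  rw [isCopy_GS3] at hφ
  simp only [isEdge_pairedRel] at hφ
  obtain ⟨⟨n1, n2, n3, h1⟩, ⟨-, n4, n5, h2⟩, n6, n7, n8, h3⟩ := hφ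
  have hinj : ∀ i j, i ≠ j → φ i ≠ φ j := fun i j h h' => h (φ.injective h')
  have m14 := hinj 1 4 (by decide)
  have m15 := hinj 1 5 (by decide)
  have m23 := hinj 2 3 (by decide)
  clear hinj
  generalize φ 0 = a at *
  generalize φ 1 = b at *
  generalize φ 2 = c at *
  generalize φ 3 = d at *
  generalize φ 4 = e at *
  generalize φ 5 = f at *
  rcases a with a | a <;> rcases b with b | b <;> rcases c with c | c <;>
    rcases d with d | d <;> simp only [PairedRel] at h1 h2
  · exact m23 (congrArg Sum.inl (Subtype.ext (add_left_cancel (h1.trans h2.symm))))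
  · simp only [ne_eq, Sum.inr.injEq] at n3 n5 m23
    exact m23 (eq_of_fst_eq_of_bool n3 n5 h1 h2)
  · simp only [ne_eq, Sum.inr.injEq] at n2 n4 m23
    exact m23 (eq_of_fst_eq_of_bool n2 n4 h1 h2)
  · rcases e with e | e <;> rcases f with f | f <;> simp only [PairedRel] at h3
    · simp only [ne_eq, Sum.inr.injEq] at n1 n7 m15
      exact m15 (eq_of_fst_eq_of_bool n1 n7 h1 h3)
    · simp only [ne_eq, Sum.inr.injEq] at n1 n6 m14
      exact m14 (eq_of_fst_eq_of_bool n1 n6 h1 h3)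

/-- In an elementary abelian 2-group the zero-sum triples of nonzero elements form a Steiner triple
system, so the link of a group element is a perfect matching on the other vertices. A paired vertex
has degree `2q - 1`, which suffices as `p ≤ q`. -/
theorem hasUncovered_GS3_paired {q : ℕ} (hA : Fintype.card A = 2 * q) (hq : 1 < q) (hp : p ≤ q)
    (h2 : ∀ a : A, a + a = 0) :
    HasUncovered GS3 (2 * (q + p) - 1) (q + p - 1) := by
  have hS : Fintype.card {a : A // a ≠ 0} = 2 * q - 1 := by
    rw [Fintype.card_subtype_compl, Fintype.card_subtype_eq, hA]
  have hV : Fintype.card ({a : A // a ≠ 0} ⊕ (Fin p × Bool)) = 2 * (q + p) - 1 := by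
    rw [Fintype.card_sum, hS, Fintype.card_prod, Fintype.card_fin, Fintype.card_bool]; omega
  have hneg : ∀ a b : A, a + b = 0 ↔ a = b := fun a b => by
    rw [← h2 b, add_left_inj]
  obtain ⟨a₀⟩ : Nonempty {a : A // a ≠ 0} := by rw [← Fintype.card_pos_iff, hS]; omega
  refine ⟨_, inferInstance, inferInstance, ofRel (PairedRel A p), Sum.inl a₀, hV, ?_,
    fun φ hφ => (pairedRel_avoids φ hφ).elim⟩
  have hinv : ∀ x : Fin p × Bool, x ≠ (x.1, !x.2) := by
    rintro ⟨i, b⟩ h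
    cases b <;> simp at h
  rintro (a | x)
  · have h := card_mul_le_two_mul_degree (ofRel (PairedRel A p)) (Sum.inl a)
      (Finset.univ.erase (Sum.inl a)) 1 (by
        intro z hz
        have hz := Finset.ne_of_mem_erase hz
        rw [Nat.succ_le_iff, Finset.card_pos]
        rcases z with b | x
        · have hab : b.1 ≠ a.1 := fun h => hz (congrArg Sum.inl (Subtype.ext h))
          refine ⟨Sum.inl ⟨a.1 + b.1, fun h => hab ((hneg _ _).1 h).symm⟩,
            mem_nbr.2 (isEdge_pairedRel.2 ⟨Ne.symm hz, ?_, ?_, ?_⟩)⟩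
          · intro h
            have := congrArg Subtype.val (Sum.inl.inj h)
            exact b.2 (left_eq_add.1 this)
          · intro h
            have := congrArg Subtype.val (Sum.inl.inj h)
            exact a.2 (right_eq_add.1 this)
          · exact h2 _
        · exact ⟨Sum.inr (x.1, !x.2), mem_nbr.2 (isEdge_pairedRel.2
            ⟨by simp, by simp, fun h => hinv x (Sum.inr.inj h), rfl⟩)⟩)
    rw [Finset.card_erase_of_mem (Finset.mem_univ _), Finset.card_univ, hV] at h
    omega
  · refine le_trans ?_ (card_nbr_le_degree _ _ (Sum.inr (x.1, !x.2)))
    have h := card_nbr_of_subset (H := ofRel (PairedRel A p)) (a := Sum.inr x)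
      (b := Sum.inr (x.1, !x.2)) (Finset.univ.image Sum.inl) (by
        intro z hz
        obtain ⟨a, -, rfl⟩ := Finset.mem_image.1 hz
        exact isEdge_pairedRel.2 ⟨fun h => hinv x (Sum.inr.inj h), by simp, by simp, rfl⟩)
    rw [Finset.card_image_of_injective _ Sum.inl_injective, Finset.card_univ, hS] at h
    omega

end PairedFamily

theorem hasUncovered_GS3 {n : ℕ} (hn : 13 ≤ n) : HasUncovered GS3 n ((n - 1) / 2) := by
  rcases Nat.even_or_odd' n with ⟨k, rfl | rfl⟩
  · have h := hasUncovered_GS3_even (k := k - 1) (by omega)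
    have e1 : 2 * (k - 1) + 2 = 2 * k := by omega
    have e2 : (2 * k - 1) / 2 = k - 1 := by omega
    rwa [e1, ← e2] at h
  -- With `n = 2k + 1`, take `2 ^ r` the largest power of two not exceeding `k + 1`; then the number
  -- `k + 1 - 2 ^ r` of pairs is below `2 ^ r`.
  · set r := Nat.log 2 (k + 1) with hr
    have h1 : 2 ^ r ≤ k + 1 := Nat.pow_log_le_self 2 (by omega)
    have h2 : k + 1 < 2 ^ (r + 1) := Nat.lt_pow_succ_log_self (by norm_num) _
    rw [pow_succ] at h2
    have h := hasUncovered_GS3_paired (A := Fin (r + 1) → ZMod 2) (q := 2 ^ r)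
      (p := k + 1 - 2 ^ r) (by simp [ZMod.card, pow_succ, mul_comm]) (by omega) (by omega)
      (fun a => by ext i; exact CharTwo.add_self_eq_zero _)
    have e1 : 2 * (2 ^ r + (k + 1 - 2 ^ r)) - 1 = 2 * k + 1 := by omega
    have e2 : 2 ^ r + (k + 1 - 2 ^ r) - 1 = (2 * k + 1 - 1) / 2 := by omega
    rwa [e1, e2] at h

/-! ### Upper bounds for `K113`, `GS3` and `TP3` -/

section Upper

variable {V : Type*} [DecidableEq V] {H : UniformHypergraph V 3} {v : V}

/-- A path `a b c d` in the link gives the tight path `a, b, v, c, d`. -/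
theorem no_path_TP3 (h : Avoids TP3 H v) {a b c d : V} (h1 : H.IsEdge v a b) (h2 : H.IsEdge v b c)
    (h3 : H.IsEdge v c d) (hac : a ≠ c) (had : a ≠ d) (hbd : b ≠ d) : False := by
  have n1 := h1.ne
  have n2 := h2.ne
  have n3 := h3.ne
  exact no_TP3 h h1.rot h2.swap h3 (by simp; grind) (by simp)

variable [Fintype V]

theorem sum_erase_card_nbr (H : UniformHypergraph V 3) (v : V) :
    ∑ x ∈ Finset.univ.erase v, (H.nbr v x).card = 2 * H.degree {v} := by
  rw [← sum_card_nbr, ← Finset.add_sum_erase _ _ (Finset.mem_univ v), nbr_self]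
  simp

theorem two_mul_degree_le {t : ℕ} (h : ∀ x, x ≠ v → (H.nbr v x).card ≤ t) :
    2 * H.degree {v} ≤ (Fintype.card V - 1) * t := by
  rw [← sum_erase_card_nbr, ← Finset.card_univ, ← Finset.card_erase_of_mem (Finset.mem_univ v),
    ← smul_eq_mul]
  exact Finset.sum_le_card_nsmul _ _ _ fun x hx => h x (Finset.ne_of_mem_erase hx)

theorem degree_le_add_off (y : V) {a : V} (hay : a ≠ y) :
    H.degree {y} ≤ (H.nbr y a).card + (H.off y {a}).card := by
  have := off_le_step H y ∅ hay
  rw [degree_singleton]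
  simpa using this

theorem degree_le_of_cover (y : V) {a : V} (hay : a ≠ y)
    (h : ∀ p q, H.IsEdge y p q → p = a ∨ q = a) : H.degree {y} ≤ (H.nbr y a).card := by
  have h1 := degree_le_add_off (H := H) y hay
  have h2 := off_eq_zero (H := H) y {a} (by
    intro p q h1 h2 h3
    rw [Finset.mem_singleton] at h2 h3
    exact (h p q h1).elim h2 h3)
  omega

theorem covered_K113 (hdeg : Fintype.card V ≤ H.degree {v})
    (h : ∀ φ : Fin 5 ↪ V, K113.IsCopy H φ → ∀ w, φ w ≠ v) : False := by
  have h1 : ∀ x, x ≠ v → (H.nbr v x).card ≤ 2 := by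
    intro x hx
    by_contra hlt
    obtain ⟨c, hc, d, hd, e, he, hcd, hce, hde⟩ := Finset.two_lt_card.1 (not_le.1 hlt)
    rw [mem_nbr] at hc hd he
    have c1 := hc.ne
    have d1 := hd.ne
    have e1 := he.ne
    exact no_K113 h hc hd he (by simp; grind) (by simp)
  have h2 := two_mul_degree_le h1
  have h3 : 0 < Fintype.card V := Fintype.card_pos_iff.2 ⟨v⟩
  omega

/-- A graph of at least seven edges in which no path with two edges misses an edge is a star or a
matching; here for the link of `v`. -/
theorem star_or_matching (hdeg : 7 ≤ H.degree {v})
    (h : ∀ a x y p q, H.IsEdge v a x → H.IsEdge v a y → x ≠ y → H.IsEdge v p q →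
      p ≠ a → p ≠ x → p ≠ y → q ≠ a → q ≠ x → q ≠ y → False) :
    (∃ x, x ≠ v ∧ ∀ p q, H.IsEdge v p q → p = x ∨ q = x) ∨
      ∀ x, (H.nbr v x).card ≤ 1 := by
  -- A vertex with four link neighbours keeps two of them outside any given link edge, so every link
  -- edge contains it.
  by_cases hd : ∃ x, 4 ≤ (H.nbr v x).card
  · left
    obtain ⟨x, hx⟩ := hd
    have hxv : x ≠ v := by rintro rfl; rw [nbr_self] at hx; simp at hx
    refine ⟨x, hxv, fun p q hpq => ?_⟩
    by_contra hne
    rw [not_or] at hne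
    have h1 := Finset.le_card_sdiff {p, q} (H.nbr v x)
    have h2 := Finset.card_le_two (a := p) (b := q)
    obtain ⟨a, b, ha, hb, hab⟩ := Finset.one_lt_card_iff.1
      (show 1 < (H.nbr v x \ {p, q}).card by omega)
    simp only [Finset.mem_sdiff, mem_nbr, Finset.mem_insert, Finset.mem_singleton, not_or] at ha hb
    exact h x a b p q ha.1 hb.1 hab hpq hne.1 (Ne.symm ha.2.1) (Ne.symm hb.2.1) hne.2
      (Ne.symm ha.2.2) (Ne.symm hb.2.2)
  · right
    push Not at hd
    by_contra hx
    push Not at hx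
    obtain ⟨b, hb⟩ := hx
    obtain ⟨a, c, ha, hc, hac⟩ := Finset.one_lt_card_iff.1 hb
    rw [mem_nbr] at ha hc
    have na := ha.ne
    have nc := hc.ne
    have o1 := degree_le_add_off (H := H) v (Ne.symm na.1)
    have o2 := off_le_step H v {b} (Ne.symm na.2.1)
    have o3 := off_le_step H v {a, b} (Ne.symm nc.2.1)
    -- All link edges meet the path `a b c`, so with degrees at most three there are at most `3 + 2
    -- + 2 = 7`. Equality is forced: `a` and `c` are not adjacent, and `a` has two further
    -- neighbours, giving a path centred at `a` that misses `bc`.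
    have o4 : (H.off v {c, a, b}).card = 0 := off_eq_zero v _ (by
      intro p q hpq hp hq
      simp only [Finset.mem_insert, Finset.mem_singleton, not_or] at hp hq
      exact h b a c p q ha hc hac hpq hp.2.2 hp.2.1 hp.1 hq.2.2 hq.2.1 hq.1)
    rw [o4] at o3
    have d1 := hd b
    have d2 := hd a
    have d3 := hd c
    have hba : b ∈ H.nbr v a := mem_nbr.2 ha.swap_right
    have hbc : b ∈ H.nbr v c := mem_nbr.2 hc.swap_right
    have e1 : (H.nbr v a \ {b}).card = (H.nbr v a).card - 1 := by
      rw [Finset.sdiff_singleton_eq_erase, Finset.card_erase_of_mem hba]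
    have e2 : (H.nbr v c \ {a, b}).card ≤ (H.nbr v c).card - 1 := by
      rw [← Finset.card_erase_of_mem hbc]
      refine Finset.card_le_card fun z hz => ?_
      simp only [Finset.mem_sdiff, Finset.mem_insert, Finset.mem_singleton, not_or] at hz
      exact Finset.mem_erase.2 ⟨hz.2.2, hz.1⟩
    have hca : ¬ H.IsEdge v a c := by
      intro hac'
      have : (H.nbr v c \ {a, b}).card ≤ (H.nbr v c).card - 2 := by
        rw [Finset.card_sdiff_of_subset, Finset.card_pair (Ne.symm na.2.2)]
        intro z hz
        rcases Finset.mem_insert.1 hz with rfl | hz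
        · exact mem_nbr.2 hac'.swap_right
        · rwa [Finset.mem_singleton.1 hz]
      omega
    obtain ⟨p, q, hp, hq, hpq⟩ := Finset.one_lt_card_iff.1
      (show 1 < (H.nbr v a \ {b}).card by omega)
    simp only [Finset.mem_sdiff, mem_nbr, Finset.mem_singleton] at hp hq
    refine h a p q b c hp.1 hq.1 hpq hc na.2.2 (Ne.symm hp.2) (Ne.symm hq.2) (Ne.symm hac) ?_ ?_
    · rintro rfl; exact hca hp.1
    · rintro rfl; exact hca hq.1

/-- A matching has too few edges. If the link is a star with centre `x`, then by symmetry every edge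
at `x` contains `v`. For a leaf `y` the edge `{v, x, y}` then meets the other edges at `y` only in
`y`, so a pair `{y, z}` of codegree two would complete a copy. Thus the link of `y` is a matching,
and `y` has too small a degree. -/
theorem covered_GS3 (hn : 13 ≤ Fintype.card V)
    (hdeg : ∀ x, (Fintype.card V - 1) / 2 + 1 ≤ H.degree {x})
    (h : ∀ φ : Fin 6 ↪ V, GS3.IsCopy H φ → ∀ w, φ w ≠ v) : False := by
  have hv := hdeg v
  have h1 := star_or_matching (H := H) (v := v) (by omega) (by
    intro a x y p q hax hay hxy hpq h1 h2 h3 h4 h5 h6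
    have nax := hax.ne
    have nay := hay.ne
    have npq := hpq.ne
    exact no_GS3 h hax hay hpq (by simp; grind) (by simp))
  rcases h1 with ⟨x, hxv, hx⟩ | hm
  · have hxd := degree_le_of_cover v hxv hx
    have hxe : ∀ p q, H.IsEdge x p q → p = v ∨ q = v := by
      intro p q hpq
      by_contra hne
      rw [not_or] at hne
      have h1 := Finset.le_card_sdiff {p, q} (H.nbr v x)
      have h2 := Finset.card_le_two (a := p) (b := q)
      obtain ⟨a, b, ha, hb, hab⟩ := Finset.one_lt_card_iff.1
        (show 1 < (H.nbr v x \ {p, q}).card by omega)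
      simp only [Finset.mem_sdiff, mem_nbr, Finset.mem_insert, Finset.mem_singleton,
        not_or] at ha hb
      have n1 := ha.1.ne
      have n2 := hb.1.ne
      have n3 := hpq.ne
      exact no_GS3 h ha.1.swap hb.1.swap hpq (by simp; grind) (by simp)
    obtain ⟨y, hy⟩ := Finset.card_pos.1 (show 0 < (H.nbr v x).card by omega)
    rw [mem_nbr] at hy
    have ny := hy.ne
    have h2 := two_mul_degree_le (H := H) (v := y) (t := 1) (by
      intro z hz
      rw [Finset.card_le_one]
      intro c hc d hd
      rw [mem_nbr] at hc hd
      by_cases hzv : z = v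
      · subst hzv
        have k1 := hx _ _ hc.swap
        have k2 := hx _ _ hd.swap
        grind
      by_cases hzx : z = x
      · subst hzx
        have k1 := hxe _ _ hc.swap
        have k2 := hxe _ _ hd.swap
        grind
      by_contra hcd
      have nc := hc.ne
      have nd := hd.ne
      have k1 : ∀ c, H.IsEdge y z c → c ≠ v := by
        rintro c hc rfl
        have := hx _ _ hc.swap_right.swap
        grind
      have k2 : ∀ c, H.IsEdge y z c → c ≠ x := by
        rintro c hc rfl
        have := hxe _ _ hc.swap_right.swap
        grind
      have := k1 c hc
      have := k1 d hd
      have := k2 c hc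
      have := k2 d hd
      exact no_GS3 h hc hd hy.swap_right.swap (by simp; grind) (by simp))
    have := hdeg y
    omega
  · have h2 := two_mul_degree_le (H := H) (v := v) (t := 1) fun x _ => hm x
    omega

/-! ### The link of a vertex in no tight path -/

section TightPath

/-- A graph without three-edge paths in which some vertex has degree at least three has all
neighbours of that vertex as leaves. Charging these leaves to it shows that the average degree can
reach two only if all degrees equal two. -/
theorem card_nbr_eq_two (h : Avoids TP3 H v) (hdeg : Fintype.card V - 1 ≤ H.degree {v}) {x : V} (hx : x ≠ v) :
    (H.nbr v x).card = 2 := by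
  set S : Finset V := Finset.univ.erase v with hS
  have hSc : S.card = Fintype.card V - 1 := by
    rw [hS, Finset.card_erase_of_mem (Finset.mem_univ _), Finset.card_univ]
  have hsum := sum_erase_card_nbr H v
  rw [← hS] at hsum
  set d : V → ℕ := fun x => (H.nbr v x).card with hd
  have hmem : ∀ {x y}, H.IsEdge v x y → y ∈ S := fun h => by
    rw [hS]; exact Finset.mem_erase.2 ⟨Ne.symm h.ne.2.1, Finset.mem_univ _⟩
  have hleaf : ∀ x y, 3 ≤ d x → H.IsEdge v x y → d y = 1 := by
    intro x y hx hxy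
    refine Finset.card_eq_one.2 ⟨x, Finset.eq_singleton_iff_unique_mem.2
      ⟨mem_nbr.2 hxy.swap_right, fun z hz => ?_⟩⟩
    by_contra hzx
    rw [mem_nbr] at hz
    have h1 := Finset.le_card_sdiff {y, z} (H.nbr v x)
    have h2 := Finset.card_le_two (a := y) (b := z)
    obtain ⟨w, hw⟩ := Finset.card_pos.1 (show 0 < (H.nbr v x \ {y, z}).card by simp only [hd] at hx; omega)
    simp only [Finset.mem_sdiff, mem_nbr, Finset.mem_insert, Finset.mem_singleton, not_or] at hw
    exact no_path_TP3 h hw.1.swap_right hxy hz hw.2.1 hw.2.2 (Ne.symm hzx)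
  have hbig : ∑ x ∈ S.filter (fun x => 3 ≤ d x), d x ≤ (S.filter fun x => d x = 1).card := by
    rw [← Finset.card_biUnion]
    · refine Finset.card_le_card fun y hy => ?_
      obtain ⟨x, hx, hxy⟩ := Finset.mem_biUnion.1 hy
      rw [mem_nbr] at hxy
      exact Finset.mem_filter.2 ⟨hmem hxy, hleaf x y (Finset.mem_filter.1 hx).2 hxy⟩
    · intro x hx y hy hxy
      rw [Function.onFun, Finset.disjoint_left]
      intro z hz hz'
      rw [mem_nbr] at hz hz'
      have := hleaf x z (Finset.mem_filter.1 hx).2 hz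
      exact hxy (Finset.card_le_one.1 this.le _ (mem_nbr.2 hz.swap_right) _
        (mem_nbr.2 hz'.swap_right))
  -- Summed, the leaf term on the left outweighs the sum of the big degrees on the right by `hbig`,
  -- leaving `deg v` plus the number of big vertices at most `n - 1`.
  have hpt : ∑ x ∈ S, (d x + (if 3 ≤ d x then 2 else 0) + (if d x = 1 then 1 else 0)) ≤
      ∑ x ∈ S, (2 + if 3 ≤ d x then d x else 0) := by
    refine Finset.sum_le_sum fun x _ => ?_
    split_ifs <;> omega
  rw [Finset.sum_add_distrib, Finset.sum_add_distrib, Finset.sum_add_distrib,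
    ← Finset.sum_filter, ← Finset.sum_filter, ← Finset.sum_filter, hsum, Finset.sum_const,
    Finset.sum_const, Finset.sum_const, hSc] at hpt
  simp only [smul_eq_mul, mul_one] at hpt
  have hno : S.filter (fun x => 3 ≤ d x) = ∅ := by
    rw [← Finset.card_eq_zero]; omega
  have hle : ∀ x ∈ S, d x ≤ 2 := by
    intro x hx
    by_contra hlt
    have : x ∈ S.filter fun x => 3 ≤ d x := Finset.mem_filter.2 ⟨hx, by omega⟩
    rw [hno] at this
    simp at this
  have hxS : x ∈ S := by rw [hS]; exact Finset.mem_erase.2 ⟨hx, Finset.mem_univ _⟩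
  refine le_antisymm (hle x hxS) ?_
  by_contra hlt
  have : ∑ x ∈ S, d x < ∑ x ∈ S, 2 :=
    Finset.sum_lt_sum hle ⟨x, hxS, not_le.1 hlt⟩
  rw [hsum, Finset.sum_const, hSc, smul_eq_mul] at this
  omega

theorem exists_triangle (h : Avoids TP3 H v) (hdeg : Fintype.card V - 1 ≤ H.degree {v}) {x : V} (hx : x ≠ v) :
    ∃ y z, H.IsEdge v x y ∧ H.IsEdge v x z ∧ H.IsEdge v y z ∧
      H.nbr v x = {y, z} ∧ H.nbr v y = {x, z} ∧ H.nbr v z = {x, y} := by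
  have key : ∀ {x y z}, x ≠ v → y ≠ z → H.nbr v x = {y, z} → H.IsEdge v x y → H.IsEdge v x z →
      H.nbr v y = {x, z} := by
    intro x y z hx hyz hN hy hz
    obtain ⟨a, b, hab, hN'⟩ := Finset.card_eq_two.1 (card_nbr_eq_two h hdeg (Ne.symm hy.ne.2.1))
    have hxN : x ∈ H.nbr v y := mem_nbr.2 hy.swap_right
    have : ∀ w, H.IsEdge v y w → w = x ∨ w = z := by
      intro w hw
      by_contra hne
      rw [not_or] at hne
      exact no_path_TP3 h hz.swap_right hy hw (Ne.symm hyz) (Ne.symm hne.2) (Ne.symm hne.1)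
    refine Finset.eq_of_subset_of_card_le (fun w hw => ?_) ?_
    · rcases this w (mem_nbr.1 hw) with rfl | rfl <;> simp
    · rw [card_nbr_eq_two h hdeg (Ne.symm hy.ne.2.1)]; exact Finset.card_le_two
  obtain ⟨y, z, hyz, hN⟩ := Finset.card_eq_two.1 (card_nbr_eq_two h hdeg hx)
  have hy : H.IsEdge v x y := mem_nbr.1 (by rw [hN]; simp)
  have hz : H.IsEdge v x z := mem_nbr.1 (by rw [hN]; simp)
  have hNy := key hx hyz hN hy hz
  have hNz := key hx hyz.symm (by rw [hN, Finset.pair_comm]) hz hy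
  exact ⟨y, z, hy, hz, mem_nbr.1 (by rw [hNy]; simp), hN, hNy, hNz⟩

/-- The closed neighbourhoods in the link are its triangles, and they partition the other vertices.
-/
theorem three_dvd (h : Avoids TP3 H v) (hdeg : Fintype.card V - 1 ≤ H.degree {v}) : 3 ∣ Fintype.card V - 1 := by
  rw [← Finset.card_univ, ← Finset.card_erase_of_mem (Finset.mem_univ v),
    Finset.card_eq_sum_card_image (fun x => insert x (H.nbr v x))]
  refine Finset.dvd_sum fun c hc => ?_
  obtain ⟨x, hx, rfl⟩ := Finset.mem_image.1 hc
  have hx := Finset.ne_of_mem_erase hx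
  obtain ⟨y, z, hy, hz, hyz, hN, hNy, hNz⟩ := exists_triangle h hdeg hx
  have n1 := hy.ne
  have n2 := hz.ne
  have n3 := hyz.ne
  have : (Finset.univ.erase v).filter (fun w => insert w (H.nbr v w) = insert x (H.nbr v x)) =
      {x, y, z} := by
    ext w
    simp only [Finset.mem_filter, Finset.mem_erase, Finset.mem_univ, and_true,
      Finset.mem_insert, Finset.mem_singleton]
    constructor
    · rintro ⟨hw, he⟩
      have : w ∈ insert x (H.nbr v x) := by rw [← he]; simp
      rw [hN] at this
      simpa using this
    · rintro (rfl | rfl | rfl)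
      · exact ⟨hx, rfl⟩
      · refine ⟨Ne.symm n1.2.1, ?_⟩
        rw [hN, hNy, Finset.insert_comm]
      · refine ⟨Ne.symm n2.2.1, ?_⟩
        rw [hN, hNz]
        ext; simp; tauto
  rw [this, Finset.card_eq_three.2 ⟨x, y, z, n1.2.2, n2.2.2, n3.2.2, rfl⟩]

theorem degree_le_TP3 (h : Avoids TP3 H v) : H.degree {v} ≤ Fintype.card V - 1 := by
  by_contra hlt
  have := two_mul_degree_le (H := H) (v := v) (t := 2) fun x hx =>
    (card_nbr_eq_two h (by omega) hx).le
  omega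

/-- The link consists of two triangles. An edge avoiding `v` that contains two vertices of one
triangle is that triangle, so `t` has at most two edges through `v` and one other. -/
theorem covered_TP3_seven (h : Avoids TP3 H v) (hV : Fintype.card V = 7) (hdeg : ∀ x, 6 ≤ H.degree {x}) : False := by
  have hd : Fintype.card V - 1 ≤ H.degree {v} := by rw [hV]; exact hdeg v
  obtain ⟨t, ht⟩ : ∃ t : V, t ≠ v := by
    have : 1 < Fintype.card V := by omega
    obtain ⟨a, b, hab⟩ := Fintype.one_lt_card_iff.1 this
    by_cases ha : a = v
    · exact ⟨b, fun hb => hab (ha.trans hb.symm)⟩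
    · exact ⟨a, ha⟩
  obtain ⟨a, b, ha, hb, hab, hN, hNa, hNb⟩ := exists_triangle h hd ht
  have na := ha.ne
  have nb := hb.ne
  have nab := hab.ne
  -- Otherwise the second link neighbour `w` of `x` gives the tight path `w, v, x, y, z`.
  have key : ∀ {x y z}, H.IsEdge v x y → H.IsEdge x y z → z ≠ v → H.IsEdge v x z := by
    intro x y z hxy hxyz hz
    by_contra hne
    obtain ⟨w, hw⟩ := Finset.card_pos.1 (show 0 < (H.nbr v x \ {y}).card by
      rw [Finset.sdiff_singleton_eq_erase, Finset.card_erase_of_mem (mem_nbr.2 hxy),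
        card_nbr_eq_two h hd (Ne.symm hxy.ne.1)]
      norm_num)
    simp only [Finset.mem_sdiff, mem_nbr, Finset.mem_singleton] at hw
    have n1 := hw.1.ne
    have n2 := hxy.ne
    have n3 := hxyz.ne
    have n4 : w ≠ z := by rintro rfl; exact hne hw.1
    exact no_TP3 h hw.1.swap_right.swap hxy hxyz
      (by simp; grind) (by simp)
  have hout : ∀ p q, p ≠ v → q ≠ v → p ≠ q → p ∉ ({t, a, b} : Finset V) →
      q ∉ ({t, a, b} : Finset V) → H.IsEdge v p q := by
    intro p q hp hq hpq hp' hq'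
    simp only [Finset.mem_insert, Finset.mem_singleton, not_or] at hp' hq'
    have hsub : H.nbr v p ⊆ Finset.univ \ {v, t, a, b, p} := by
      intro z hz
      rw [mem_nbr] at hz
      simp only [Finset.mem_sdiff, Finset.mem_univ, Finset.mem_insert, Finset.mem_singleton,
        true_and, not_or]
      have hzz := mem_nbr.2 hz.swap_right
      refine ⟨Ne.symm hz.ne.2.1, ?_, ?_, ?_, Ne.symm hz.ne.2.2⟩ <;> rintro rfl
      · rw [hN] at hzz; simp at hzz; tauto
      · rw [hNa] at hzz; simp at hzz; tauto
      · rw [hNb] at hzz; simp at hzz; tauto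
    have hcard : (Finset.univ \ {v, t, a, b, p} : Finset V).card = 2 := by
      rw [Finset.card_sdiff_of_subset (Finset.subset_univ _), Finset.card_univ, hV]
      rw [Finset.card_insert_of_notMem (by simp; grind), Finset.card_insert_of_notMem
        (by simp; grind), Finset.card_insert_of_notMem (by simp; grind),
        Finset.card_pair (Ne.symm hp'.2.2)]
    have heq := Finset.eq_of_subset_of_card_le hsub (by rw [hcard, card_nbr_eq_two h hd hp])
    rw [← mem_nbr, heq]
    simp only [Finset.mem_sdiff, Finset.mem_univ, Finset.mem_insert, Finset.mem_singleton,
      true_and, not_or]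
    exact ⟨hq, hq'.1, hq'.2.1, hq'.2.2, Ne.symm hpq⟩
  have h1 := degree_le_add_off (H := H) t (Ne.symm ht)
  rw [nbr_comm, card_nbr_eq_two h hd ht] at h1
  have h2 : (H.off t {v}).card ≤ ({{a, b}} : Finset (Finset V)).card := by
    refine off_le_card t {v} _ fun p q hpq hp hq => ?_
    rw [Finset.mem_singleton] at hp hq
    have npq := hpq.ne
    have k1 : ∀ p q, H.IsEdge t p q → p = a ∨ p = b → q ≠ v → q = a ∨ q = b := by
      intro p q hpq hp hq
      have : H.IsEdge v t p := by rcases hp with rfl | rfl <;> assumption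
      have := mem_nbr.2 (key this hpq hq)
      rw [hN] at this
      simpa using this
    have k2 : p = a ∨ p = b := by
      by_contra hpn
      have hqn : ¬ (q = a ∨ q = b) := fun hqn => hpn (k1 q p hpq.swap_right hqn hp)
      rw [not_or] at hpn hqn
      have h3 := hout p q hp hq npq.2.2 (by simp; exact ⟨Ne.symm npq.1, hpn⟩)
        (by simp; exact ⟨Ne.symm npq.2.1, hqn⟩)
      have h4 := mem_nbr.2 (key h3 hpq.rot (Ne.symm ha.ne.1)).swap_right
      rw [hN] at h4
      simp at h4
      tauto
    have k3 := k1 p q hpq k2 hq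
    rw [Finset.mem_singleton]
    rcases k2 with rfl | rfl <;> rcases k3 with rfl | rfl
    · exact absurd rfl npq.2.2
    · rfl
    · exact Finset.pair_comm _ _
    · exact absurd rfl npq.2.2
  rw [Finset.card_singleton] at h2
  have := hdeg t
  omega

end TightPath

theorem coveredAbove_TP3 {n : ℕ} (hn : 6 ≤ n) :
    CoveredAbove TP3 n (if n % 3 = 1 ∧ n ≠ 7 then n - 1 else n - 2) := by
  intro H v hdeg h
  have h1 := degree_le_TP3 h
  have h2 := hdeg v
  rw [Fintype.card_fin] at h1
  by_cases hc : n % 3 = 1 ∧ n ≠ 7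
  · rw [if_pos hc] at h2; omega
  · rw [if_neg hc] at h2
    by_cases h7 : n = 7
    · subst h7
      exact covered_TP3_seven h (by simp) fun x => by simpa using hdeg x
    · have := three_dvd h (by rw [Fintype.card_fin]; omega)
      rw [Fintype.card_fin] at this
      omega

theorem hasUncovered_TP3_ite {n : ℕ} (hn : 6 ≤ n) :
    HasUncovered TP3 n (if n % 3 = 1 ∧ n ≠ 7 then n - 1 else n - 2) := by
  split_ifs with hc
  · have h := hasUncovered_TP3_of_mod (k := n / 3) (by omega)
    have e1 : 3 * (n / 3) + 1 = n := by omega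
    have e2 : 3 * (n / 3) = n - 1 := by omega
    rwa [e1, e2] at h
  · exact hasUncovered_TP3 hn

end Upper

/-- Pairwise intersecting pairs: two edges `ab`, `bc` and one missing `b` force the triangle `abc`,
and no other pair meets all its sides. -/
theorem star_or_triangle {V : Type*} [DecidableEq V] {R : V → V → Prop}
    (hs : ∀ a b, R a b → R b a) (hirr : ∀ a b, R a b → a ≠ b) (v : V)
    (h : ∀ p q r s, R p q → R r s → (p = r ∨ p = s) ∨ q = r ∨ q = s) :
    (∃ c, ∀ p q, R p q → p = c ∨ q = c) ∨
      ∃ T : Finset V, T.card ≤ 3 ∧ ∀ p q, R p q → p ∈ T ∧ q ∈ T := by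
  by_contra hne
  rw [not_or] at hne
  obtain ⟨h1, h2⟩ := hne
  push Not at h1 h2
  -- The given vertex serves as a trial centre only to produce some pair.
  obtain ⟨a, b, hab, -, -⟩ := h1 v
  obtain ⟨p, q, hpq, hpa, hqa⟩ := h1 a
  obtain ⟨r, s, hrs, hrb, hsb⟩ := h1 b
  obtain ⟨c, hbc, hca⟩ : ∃ c, R b c ∧ c ≠ a := by
    have := h _ _ _ _ hab hpq
    rcases this with (h | h) | h | h
    · exact absurd h.symm hpa
    · exact absurd h.symm hqa
    · exact ⟨q, h ▸ hpq, hqa⟩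
    · exact ⟨p, h ▸ hs _ _ hpq, hpa⟩
  have hac : R a c := by
    have k1 := h _ _ _ _ hab hrs
    have k2 := h _ _ _ _ hbc hrs
    have k3 := hs _ _ hrs
    clear h h1 h2
    grind
  have n1 := hirr _ _ hab
  have n2 := hirr _ _ hbc
  obtain ⟨x, y, hxy, hT⟩ := h2 {a, b, c} Finset.card_le_three
  have k1 := h _ _ _ _ hab hxy
  have k2 := h _ _ _ _ hbc hxy
  have k3 := h _ _ _ _ hac hxy
  simp only [Finset.mem_insert, Finset.mem_singleton] at hT
  clear h h1 h2 hs hirr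
  grind

/-! ### Upper bounds for `GP3` and `S3` -/

section Upper

variable {V : Type*} [DecidableEq V] {H : UniformHypergraph V 3} {v : V}

/-- Otherwise `wav`, `avy`, `ypq` is a copy. -/
theorem meets_of_cherry_GP3 (h : Avoids GP3 H v) {y a w p q : V} (h1 : H.IsEdge v y a)
    (h2 : H.IsEdge v a w) (hyw : y ≠ w) (h3 : H.IsEdge y p q) (hp : p ≠ v) (hq : q ≠ v) :
    (p = a ∨ q = a) ∨ p = w ∨ q = w := by
  by_contra hne
  simp only [not_or] at hne
  have n1 := h1.ne
  have n2 := h2.ne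
  have n3 := h3.ne
  exact no_GP3 h h2.rot.swap h1.swap_right.swap h3 (by clear h h1 h2 h3; simp; grind) (by simp)

/-- Otherwise `zya`, `yav`, `vcd` is a copy. -/
theorem codegree_of_matching_GP3 (h : Avoids GP3 H v) {y a c d z : V} (h1 : H.IsEdge v y a)
    (h2 : H.IsEdge v c d) (hyc : y ≠ c) (hyd : y ≠ d) (hac : a ≠ c) (had : a ≠ d)
    (h3 : H.IsEdge y a z) (hz : z ≠ v) : z = c ∨ z = d := by
  by_contra hne
  rw [not_or] at hne
  have n1 := h1.ne
  have n2 := h2.ne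
  have n3 := h3.ne
  exact no_GP3 h h3.rot.rot h1.rot h2 (by clear h h1 h2 h3; simp; grind) (by simp)

theorem off_le_six {X T : Finset V} (hT : T.card ≤ 4)
    (h : ∀ p q, H.IsEdge v p q → p ∉ X → q ∉ X → p ∈ T ∧ q ∈ T) : (H.off v X).card ≤ 6 := by
  have key : (H.off v X).card ≤ (T.powersetCard 2).card := by
    refine off_le_card v X _ fun p q hpq hp hq => ?_
    have := h p q hpq hp hq
    rw [Finset.mem_powersetCard]
    refine ⟨fun z hz => ?_, Finset.card_pair hpq.ne.2.2⟩
    simp only [Finset.mem_insert, Finset.mem_singleton] at hz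
    rcases hz with rfl | rfl
    exacts [this.1, this.2]
  rw [Finset.card_powersetCard] at key
  have : T.card.choose 2 ≤ Nat.choose 4 2 := Nat.choose_le_choose 2 hT
  have : Nat.choose 4 2 = 6 := by decide
  omega

variable [Fintype V]

theorem exists_isEdge_notMem {x y : V} (S : Finset V) (h : S.card < (H.nbr x y).card) :
    ∃ z, H.IsEdge x y z ∧ z ∉ S := by
  obtain ⟨z, hz, hzS⟩ := Finset.exists_mem_notMem_of_card_lt_card h
  exact ⟨z, mem_nbr.1 hz, hzS⟩

theorem exists_isEdge_of_off_pos {X : Finset V} (h : 0 < (H.off v X).card) :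
    ∃ p q, H.IsEdge v p q ∧ p ∉ X ∧ q ∉ X := by
  by_contra hne
  push Not at hne
  have := off_eq_zero (H := H) v X fun p q h1 h2 h3 => h3 (hne p q h1 h2)
  omega

theorem degree_le_codegree_add_off {y : V} (hy : y ≠ v) :
    H.degree {y} ≤ (H.nbr v y).card + (H.off y {v}).card := by
  rw [nbr_comm]
  exact degree_le_add_off y (Ne.symm hy)

theorem card_sdiff_lt_of_isEdge {X : Finset V} {x y : V} (h : H.IsEdge v x y) (hy : y ∈ X) :
    (H.nbr v x \ X).card < (H.nbr v x).card := by
  refine Finset.card_lt_card (Finset.ssubset_iff_subset_ne.2 ⟨Finset.sdiff_subset, fun he => ?_⟩)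
  have : y ∈ H.nbr v x \ X := by rw [he]; exact mem_nbr.2 h
  exact (Finset.mem_sdiff.1 this).2 hy

section GP3

theorem meets_of_four_le_GP3 (h : Avoids GP3 H v) {y a p q : V} (h1 : H.IsEdge v y a)
    (ha : 4 ≤ (H.nbr v a).card) (h3 : H.IsEdge y p q) (hp : p ≠ v) (hq : q ≠ v) :
    p = a ∨ q = a := by
  obtain ⟨w, hw, hwS⟩ := exists_isEdge_notMem (H := H) (x := v) (y := a) {y, p, q}
    (lt_of_le_of_lt Finset.card_le_three (by omega))
  simp only [Finset.mem_insert, Finset.mem_singleton, not_or] at hwS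
  have := meets_of_cherry_GP3 h h1 hw (Ne.symm hwS.1) h3 hp hq
  grind

/-- Large link degree spreads. Edges at `b` avoiding `v` are confined to three pairs, so `b` has
link degree at least `n - 4`; a link neighbour `s` of `b` outside `a`, `c` then has at least `n -
3`. Common neighbours `t`, `u` of `b` and `s` have it too, and an edge at `s` avoiding `v` would
have to contain `b`, `t` and `u`. -/
theorem not_cherry_disjoint_GP3 (h : Avoids GP3 H v) (hn : 14 ≤ Fintype.card V)
    (hdeg : ∀ x, Fintype.card V - 1 ≤ H.degree {x}) {a b c p q : V}
    (ha : 3 ≤ (H.nbr v a).card) (hb : H.IsEdge v a b) (hc : H.IsEdge v a c) (hbc : b ≠ c)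
    (hpq : H.IsEdge v p q) (hpa : p ≠ a) (hpb : p ≠ b) (hpc : p ≠ c) (hqa : q ≠ a) (hqb : q ≠ b)
    (hqc : q ≠ c) : False := by
  have nb := hb.ne
  have nc := hc.ne
  obtain ⟨w, hw, hwS⟩ := exists_isEdge_notMem (H := H) (x := v) (y := a) {b, c}
    (lt_of_le_of_lt Finset.card_le_two (by omega))
  simp only [Finset.mem_insert, Finset.mem_singleton, not_or] at hwS
  have hdb : Fintype.card V - 4 ≤ (H.nbr v b).card := by
    have h1 := degree_le_codegree_add_off (H := H) (Ne.symm nb.2.1)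
    have h2 : (H.off b {v}).card ≤ ({{a, p}, {a, q}, {c, w}} : Finset (Finset V)).card := by
      refine off_le_card b {v} _ fun r s hrs hr hs => ?_
      rw [Finset.mem_singleton] at hr hs
      have k1 := meets_of_cherry_GP3 h hb.swap_right hc hbc hrs hr hs
      have k2 := meets_of_cherry_GP3 h hb.swap_right hw (Ne.symm hwS.1) hrs hr hs
      have k3 : ∀ s, H.IsEdge b a s → s ≠ v → s = p ∨ s = q := fun s hs =>
        codegree_of_matching_GP3 h hb.swap_right hpq (Ne.symm hpb) (Ne.symm hqb) (Ne.symm hpa)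
          (Ne.symm hqa) hs
      simp only [Finset.mem_insert, Finset.mem_singleton]
      by_cases hra : r = a
      · subst hra
        rcases k3 _ hrs hs with rfl | rfl <;> simp
      by_cases hsa : s = a
      · subst hsa
        rcases k3 _ hrs.swap_right hr with rfl | rfl <;> simp [Finset.pair_comm]
      right; right
      have hrs' := hrs.ne
      have : (r = c ∧ s = w) ∨ (r = w ∧ s = c) := by
        clear k3 hrs hdeg h h1
        grind
      rcases this with ⟨rfl, rfl⟩ | ⟨rfl, rfl⟩
      · rfl
      · exact Finset.pair_comm _ _
    have h3 : ({{a, p}, {a, q}, {c, w}} : Finset (Finset V)).card ≤ 3 := Finset.card_le_three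
    have := hdeg b
    omega
  have hds : ∀ s, H.IsEdge v b s → s ≠ a → s ≠ c → Fintype.card V - 3 ≤ (H.nbr v s).card := by
    intro s hs hsa hsc
    have ns := hs.ne
    have h1 := degree_le_codegree_add_off (H := H) (Ne.symm ns.2.1)
    have h2 : (H.off s {v}).card ≤ ({{b, a}, {b, c}} : Finset (Finset V)).card := by
      refine off_le_card s {v} _ fun r t hrt hr ht => ?_
      rw [Finset.mem_singleton] at hr ht
      have k1 := meets_of_four_le_GP3 h hs.swap_right (by omega) hrt hr ht
      have k3 : ∀ t, H.IsEdge s b t → t ≠ v → t = a ∨ t = c := fun t ht =>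
        codegree_of_matching_GP3 h hs.swap_right hc hsa hsc (Ne.symm nb.2.2) hbc ht
      simp only [Finset.mem_insert, Finset.mem_singleton]
      rcases k1 with rfl | rfl
      · rcases k3 _ hrt ht with rfl | rfl <;> simp
      · rcases k3 _ hrt.swap_right hr with rfl | rfl <;> simp [Finset.pair_comm]
    have h3 : ({{b, a}, {b, c}} : Finset (Finset V)).card ≤ 2 := Finset.card_le_two
    have := hdeg s
    omega
  obtain ⟨s, hs, hsS⟩ := exists_isEdge_notMem (H := H) (x := v) (y := b) {a, c}
    (lt_of_le_of_lt Finset.card_le_two (by omega))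
  simp only [Finset.mem_insert, Finset.mem_singleton, not_or] at hsS
  have ns := hs.ne
  have hdss := hds s hs hsS.1 hsS.2
  have hcap : 7 ≤ (H.nbr v b ∩ H.nbr v s).card := by
    have h1 := Finset.card_union_add_card_inter (H.nbr v b) (H.nbr v s)
    have h2 := Finset.card_le_univ (H.nbr v b ∪ H.nbr v s)
    omega
  have hS := Finset.le_card_sdiff {a, c} (H.nbr v b ∩ H.nbr v s)
  have hS2 := Finset.card_le_two (a := a) (b := c)
  obtain ⟨t, u, ht, hu, htu⟩ := Finset.one_lt_card_iff.1
    (show 1 < ((H.nbr v b ∩ H.nbr v s) \ {a, c}).card by omega)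
  simp only [Finset.mem_sdiff, Finset.mem_inter, mem_nbr, Finset.mem_insert,
    Finset.mem_singleton, not_or] at ht hu
  have hdt := hds t ht.1.1 ht.2.1 ht.2.2
  have hdu := hds u hu.1.1 hu.2.1 hu.2.2
  have h0 : (H.off s {v}).card = 0 := off_eq_zero s _ fun x y hxy hx hy => by
    rw [Finset.mem_singleton] at hx hy
    have k1 := meets_of_four_le_GP3 h hs.swap_right (by omega) hxy hx hy
    have k2 := meets_of_four_le_GP3 h ht.1.2 (by omega) hxy hx hy
    have k3 := meets_of_four_le_GP3 h hu.1.2 (by omega) hxy hx hy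
    have n1 := ht.1.1.ne
    have n2 := hu.1.1.ne
    clear hdeg h hds hs ht hu hb hc hpq hw hxy
    grind
  have h1 := degree_le_codegree_add_off (H := H) (Ne.symm ns.2.1)
  have h2 := card_nbr_add_two_le H ns.2.1
  have := hdeg s
  omega

theorem covered_GP3 (hn : 14 ≤ Fintype.card V)
    (hdeg : ∀ x, Fintype.card V - 1 ≤ H.degree {x}) (h : Avoids GP3 H v) : False := by
  have hv := hdeg v
  by_cases h4 : ∃ a, 4 ≤ (H.nbr v a).card
  · obtain ⟨a, ha⟩ := h4
    have hav : a ≠ v := by rintro rfl; rw [nbr_self] at ha; simp at ha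
    have h1 := degree_le_add_off (H := H) v hav
    have h2 := card_nbr_add_two_le H (Ne.symm hav)
    obtain ⟨p, q, hpq, hp, hq⟩ := exists_isEdge_of_off_pos (H := H) (v := v) (X := {a}) (by omega)
    have hS := Finset.le_card_sdiff {p, q} (H.nbr v a)
    have hS2 := Finset.card_le_two (a := p) (b := q)
    obtain ⟨b, c, hb, hc, hbc⟩ := Finset.one_lt_card_iff.1
      (show 1 < (H.nbr v a \ {p, q}).card by omega)
    simp only [Finset.mem_sdiff, mem_nbr, Finset.mem_insert, Finset.mem_singleton,
      not_or] at hb hc hp hq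
    exact not_cherry_disjoint_GP3 h hn hdeg (by omega) hb.1 hc.1 hbc hpq hp (Ne.symm hb.2.1)
      (Ne.symm hc.2.1) hq (Ne.symm hb.2.2) (Ne.symm hc.2.2)
  push Not at h4
  -- Link degrees are at most three, so three vertices meet at most nine of at least thirteen link
  -- edges.
  have hex : ∀ a b c, a ≠ v → b ≠ v → c ≠ v →
      ∃ p q, H.IsEdge v p q ∧ p ∉ ({c, b, a} : Finset V) ∧ q ∉ ({c, b, a} : Finset V) := by
    intro a b c ha hb hc
    have o1 := degree_le_add_off (H := H) v ha
    have o2 := off_le_step H v {a} hb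
    have o3 := off_le_step H v {b, a} hc
    have d1 := h4 a
    have d2 := (Finset.card_le_card (Finset.sdiff_subset (s := H.nbr v b) (t := {a}))).trans_lt (h4 b)
    have d3 := (Finset.card_le_card (Finset.sdiff_subset (s := H.nbr v c) (t := {b, a}))).trans_lt
      (h4 c)
    exact exists_isEdge_of_off_pos (by omega)
  by_cases h3 : ∃ a, 3 ≤ (H.nbr v a).card
  · obtain ⟨a, ha⟩ := h3
    obtain ⟨b, c, hb, hc, hbc⟩ := Finset.one_lt_card_iff.1 (show 1 < (H.nbr v a).card by omega)
    rw [mem_nbr] at hb hc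
    obtain ⟨p, q, hpq, hp, hq⟩ := hex a b c (Ne.symm hb.ne.1) (Ne.symm hb.ne.2.1)
      (Ne.symm hc.ne.2.1)
    simp only [Finset.mem_insert, Finset.mem_singleton, not_or] at hp hq
    exact not_cherry_disjoint_GP3 h hn hdeg ha hb hc hbc hpq hp.2.2 hp.2.1 hp.1 hq.2.2 hq.2.1 hq.1
  push Not at h3
  by_cases h2 : ∃ a, 2 ≤ (H.nbr v a).card
  · obtain ⟨a, ha⟩ := h2
    obtain ⟨y, w, hy, hw, hyw⟩ := Finset.one_lt_card_iff.1 ha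
    rw [mem_nbr] at hy hw
    have ny := hy.ne
    have nw := hw.ne
    have k1 := degree_le_codegree_add_off (H := H) (Ne.symm ny.2.1)
    -- Now link degrees are at most two. Edges at `y` avoiding `v` contain `w` but not `a`, so `y`
    -- has degree at most `2 + (n - 4)`.
    have k2 : (H.off y {v}).card ≤
        ((Finset.univ \ {v, y, w, a}).image fun z => ({w, z} : Finset V)).card := by
      refine off_le_card y {v} _ fun p q hpq hp hq => ?_
      rw [Finset.mem_singleton] at hp hq
      have npq := hpq.ne
      have hz : ∀ z, H.IsEdge y a z → z = v := by
        intro z hz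
        by_contra hzv
        obtain ⟨r, s, hrs, hr, hs⟩ := hex y a z (Ne.symm ny.2.1) (Ne.symm ny.1) hzv
        simp only [Finset.mem_insert, Finset.mem_singleton, not_or] at hr hs
        have := codegree_of_matching_GP3 h hy.swap_right hrs (Ne.symm hr.2.2) (Ne.symm hs.2.2)
          (Ne.symm hr.2.1) (Ne.symm hs.2.1) hz hzv
        exact this.elim (Ne.symm hr.1) (Ne.symm hs.1)
      have hpa : p ≠ a := by rintro rfl; exact hq (hz _ hpq)
      have hqa : q ≠ a := by rintro rfl; exact hp (hz _ hpq.swap_right)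
      have := meets_of_cherry_GP3 h hy.swap_right hw hyw hpq hp hq
      simp only [Finset.mem_image, Finset.mem_sdiff, Finset.mem_univ, Finset.mem_insert,
        Finset.mem_singleton, true_and, not_or]
      rcases this with (rfl | rfl) | rfl | rfl
      · exact absurd rfl hpa
      · exact absurd rfl hqa
      · exact ⟨q, ⟨hq, Ne.symm npq.2.1, Ne.symm npq.2.2, hqa⟩, rfl⟩
      · exact ⟨p, ⟨hp, Ne.symm npq.1, npq.2.2, hpa⟩, Finset.pair_comm _ _⟩
    have k3 : (Finset.univ \ {v, y, w, a} : Finset V).card = Fintype.card V - 4 := by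
      rw [Finset.card_sdiff_of_subset (Finset.subset_univ _), Finset.card_univ,
        Finset.card_insert_of_notMem (by simp; grind), Finset.card_insert_of_notMem
        (by simp; grind), Finset.card_pair (Ne.symm nw.2.2)]
    have k4 := k2.trans Finset.card_image_le
    have := h3 y
    have := hdeg y
    omega
  · push Not at h2
    have := two_mul_degree_le (H := H) (v := v) (t := 1) fun x _ => by have := h2 x; omega
    omega

end GP3

section S3

/-- The remaining pairs at `y` intersect: a star has at most `n - 4` of them, its leaves avoiding
`v`, `x`, `y` and the centre, and a triangle has three. -/
theorem off_le_card_sub_four (hn : 7 ≤ Fintype.card V) {x y : V} (hxy : H.IsEdge v y x)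
    (h : ∀ p q r s, H.IsEdge y p q → H.IsEdge y r s → p ≠ v → p ≠ x → q ≠ v → q ≠ x →
      r ≠ v → r ≠ x → s ≠ v → s ≠ x → (p = r ∨ p = s) ∨ q = r ∨ q = s) :
    (H.off y {x, v}).card ≤ Fintype.card V - 4 := by
  have nxy := hxy.ne
  rcases star_or_triangle
    (R := fun p q => H.IsEdge y p q ∧ (p ≠ v ∧ p ≠ x) ∧ q ≠ v ∧ q ≠ x)
    (fun a b h => ⟨h.1.swap_right, h.2.2, h.2.1⟩) (fun a b h => h.1.ne.2.2) v
    (fun p q r s h1 h2 => h p q r s h1.1 h2.1 h1.2.1.1 h1.2.1.2 h1.2.2.1 h1.2.2.2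
      h2.2.1.1 h2.2.1.2 h2.2.2.1 h2.2.2.2) with ⟨c, hc⟩ | ⟨T, hT, hT'⟩
  · have key : (H.off y {x, v}).card ≤
        ((Finset.univ \ {v, x, y, c}).image fun z => ({c, z} : Finset V)).card := by
      refine off_le_card y _ _ fun p q hpq hp hq => ?_
      simp only [Finset.mem_insert, Finset.mem_singleton, not_or] at hp hq
      have npq := hpq.ne
      simp only [Finset.mem_image, Finset.mem_sdiff, Finset.mem_univ, Finset.mem_insert,
        Finset.mem_singleton, true_and, not_or]
      rcases hc p q ⟨hpq, hp.symm, hq.symm⟩ with rfl | rfl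
      · exact ⟨q, ⟨hq.2, hq.1, Ne.symm npq.2.1, Ne.symm npq.2.2⟩, rfl⟩
      · exact ⟨p, ⟨hp.2, hp.1, Ne.symm npq.1, npq.2.2⟩, Finset.pair_comm _ _⟩
    by_cases hcm : c = v ∨ c = x ∨ c = y
    · have : (H.off y {x, v}).card = 0 := off_eq_zero y _ fun p q hpq hp hq => by
        simp only [Finset.mem_insert, Finset.mem_singleton, not_or] at hp hq
        have npq := hpq.ne
        have := hc p q ⟨hpq, hp.symm, hq.symm⟩
        clear hc h key
        grind
      omega
    · simp only [not_or] at hcm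
      have k3 : (Finset.univ \ {v, x, y, c} : Finset V).card = Fintype.card V - 4 := by
        rw [Finset.card_sdiff_of_subset (Finset.subset_univ _), Finset.card_univ,
          Finset.card_insert_of_notMem (by simp; grind), Finset.card_insert_of_notMem
          (by simp; grind), Finset.card_pair (Ne.symm hcm.2.2)]
      exact key.trans (Finset.card_image_le.trans k3.le)
  · have key : (H.off y {x, v}).card ≤ (T.powersetCard 2).card := by
      refine off_le_card y _ _ fun p q hpq hp hq => ?_
      simp only [Finset.mem_insert, Finset.mem_singleton, not_or] at hp hq
      have := hT' p q ⟨hpq, hp.symm, hq.symm⟩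
      rw [Finset.mem_powersetCard]
      refine ⟨fun z hz => ?_, Finset.card_pair hpq.ne.2.2⟩
      simp only [Finset.mem_insert, Finset.mem_singleton] at hz
      rcases hz with rfl | rfl
      exacts [this.1, this.2]
    rw [Finset.card_powersetCard] at key
    have : T.card.choose 2 ≤ Nat.choose 3 2 := Nat.choose_le_choose 2 hT
    have : Nat.choose 3 2 = 3 := by decide
    omega

/-- The degree condition gives each `y` in `Y` at least two edges through `x` avoiding `v`. But the
pairs at `x` avoiding `v` intersect: in a star only the centre has two such edges, and a triangle
has only three vertices. -/
theorem not_four_light_S3 (h : Avoids S3 H v) (hn : 7 ≤ Fintype.card V)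
    (hdeg : ∀ x, Fintype.card V ≤ H.degree {x}) {x : V}
    (hx : 5 ≤ (H.nbr v x).card) (Y : Finset V) (hY : 4 ≤ Y.card)
    (hYx : ∀ y ∈ Y, H.IsEdge v x y ∧ (H.nbr v y).card ≤ 2) : False := by
  have hleaf : ∀ {c a p q r s}, H.IsEdge v c a → H.IsEdge c p q → H.IsEdge c r s → p ≠ v → p ≠ a →
      q ≠ v → q ≠ a → r ≠ v → r ≠ a → s ≠ v → s ≠ a → (p = r ∨ p = s) ∨ q = r ∨ q = s := by
    intro c a p q r s h1 h2 h3 e1 e2 e3 e4 e5 e6 e7 e8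
    by_contra hne
    simp only [not_or] at hne
    have n1 := h1.ne
    have n2 := h2.ne
    have n3 := h3.ne
    exact no_S3 h h1.swap h2 h3 (by clear h h1 h2 h3 hdeg hYx; simp; grind) (by simp)
  have htwo : ∀ y ∈ Y, 2 ≤ (H.nbr y x \ {v}).card := by
    intro y hy
    obtain ⟨h1, h2⟩ := hYx y hy
    have n1 := h1.ne
    have k1 := degree_le_codegree_add_off (H := H) (Ne.symm n1.2.1)
    have k2 := off_le_step H y {v} n1.2.2
    have k3 := off_le_card_sub_four hn h1.swap_right (fun p q r s hp hq => hleaf h1.swap_right hp hq)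
    have := hdeg y
    omega
  have hint : ∀ p q r s, H.IsEdge x p q → H.IsEdge x r s → p ≠ v → q ≠ v → r ≠ v → s ≠ v →
      (p = r ∨ p = s) ∨ q = r ∨ q = s := by
    intro p q r s h1 h2 e1 e2 e3 e4
    obtain ⟨a, ha, haS⟩ := exists_isEdge_notMem (H := H) (x := v) (y := x) {p, q, r, s}
      (lt_of_le_of_lt Finset.card_le_four (by omega))
    simp only [Finset.mem_insert, Finset.mem_singleton, not_or] at haS
    exact hleaf ha h1 h2 e1 (Ne.symm haS.1) e2 (Ne.symm haS.2.1) e3 (Ne.symm haS.2.2.1) e4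
      (Ne.symm haS.2.2.2)
  rcases star_or_triangle (R := fun p q => H.IsEdge x p q ∧ p ≠ v ∧ q ≠ v)
    (fun a b h => ⟨h.1.swap_right, h.2.2, h.2.1⟩) (fun a b h => h.1.ne.2.2) v
    (fun p q r s h1 h2 => hint p q r s h1.1 h2.1 h1.2.1 h1.2.2 h2.2.1 h2.2.2)
    with ⟨c, hc⟩ | ⟨T, hT, hT'⟩
  · obtain ⟨y, hy, hyc⟩ := Finset.exists_mem_ne (show 1 < Y.card by omega) c
    obtain ⟨p, q, hp, hq, hpq⟩ := Finset.one_lt_card_iff.1 (htwo y hy)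
    simp only [Finset.mem_sdiff, mem_nbr, Finset.mem_singleton] at hp hq
    have hyv := (hYx y hy).1.ne.2.1
    have k1 := (hc y p ⟨hp.1.swap, Ne.symm hyv, hp.2⟩).resolve_left hyc
    have k2 := (hc y q ⟨hq.1.swap, Ne.symm hyv, hq.2⟩).resolve_left hyc
    exact hpq (k1.trans k2.symm)
  · have : Y ⊆ T := by
      intro y hy
      obtain ⟨p, hp⟩ := Finset.card_pos.1 (show 0 < (H.nbr y x \ {v}).card by
        have := htwo y hy; omega)
      simp only [Finset.mem_sdiff, mem_nbr, Finset.mem_singleton] at hp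
      exact (hT' y p ⟨hp.1.swap, Ne.symm (hYx y hy).1.ne.2.1, hp.2⟩).1
    have := Finset.card_le_card this
    omega

/-- By the maximum link degree. If it is at least five, the link edges missing `x` intersect, and
`x` has four link neighbours of link degree at most two. If it is at most four, the absence of three
disjoint edges allows at most ten link edges. -/
theorem covered_S3 (hn : 11 ≤ Fintype.card V)
    (hdeg : ∀ x, Fintype.card V ≤ H.degree {x}) (h : Avoids S3 H v) : False := by
  have hv := hdeg v
  have hM : ∀ {a b c d e f}, H.IsEdge v a b → H.IsEdge v c d → H.IsEdge v e f →
      [a, b, c, d, e, f].Nodup → False := by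
    intro a b c d e f h1 h2 h3 hnd
    have n1 := h1.ne
    have n2 := h2.ne
    have n3 := h3.ne
    refine no_S3 h h1 h2 h3 (List.nodup_cons.2 ⟨?_, hnd⟩) (by simp)
    simp only [List.mem_cons, List.not_mem_nil, or_false, not_or]
    exact ⟨n1.1, n1.2.1, n2.1, n2.2.1, n3.1, n3.2.1⟩
  have hM2 : ∀ {x a b c d}, H.IsEdge v a b → H.IsEdge v c d → a ≠ x → b ≠ x → c ≠ x → d ≠ x →
      a ≠ c → a ≠ d → b ≠ c → b ≠ d → ∀ z, H.IsEdge v x z → z ∈ ({a, b, c, d} : Finset V) := by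
    intro x a b c d h1 h2 e1 e2 e3 e4 e5 e6 e7 e8 z hz
    by_contra hzS
    simp only [Finset.mem_insert, Finset.mem_singleton, not_or] at hzS
    have n1 := h1.ne
    have n2 := h2.ne
    have n3 := hz.ne
    exact hM h1 h2 hz (by clear hM h hdeg h1 h2 hz; simp; grind)
  by_cases h5 : ∃ x, 5 ≤ (H.nbr v x).card
  · obtain ⟨x, hx⟩ := h5
    have hxv : x ≠ v := by rintro rfl; rw [nbr_self] at hx; simp at hx
    rcases star_or_triangle (R := fun p q => H.IsEdge v p q ∧ p ≠ x ∧ q ≠ x)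
      (fun a b h => ⟨h.1.swap_right, h.2.2, h.2.1⟩) (fun a b h => h.1.ne.2.2) v
      (fun p q r s h1 h2 => by
        by_contra hne
        simp only [not_or] at hne
        have hsub : H.nbr v x ⊆ {p, q, r, s} := fun z hz =>
          hM2 h1.1 h2.1 h1.2.1 h1.2.2 h2.2.1 h2.2.2 hne.1.1 hne.1.2 hne.2.1 hne.2.2 z
            (mem_nbr.1 hz)
        have := (Finset.card_le_card hsub).trans Finset.card_le_four
        omega) with ⟨c, hc⟩ | ⟨T, hT, hT'⟩
    · refine not_four_light_S3 h (by omega) hdeg hx ((H.nbr v x).erase c) ?_ ?_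
      · have := Finset.pred_card_le_card_erase (s := H.nbr v x) (a := c)
        omega
      · intro y hy
        obtain ⟨hyc, hy⟩ := Finset.mem_erase.1 hy
        rw [mem_nbr] at hy
        refine ⟨hy, (Finset.card_le_card fun z hz => ?_).trans (Finset.card_le_two (a := x) (b := c))⟩
        rw [mem_nbr] at hz
        by_cases hzx : z = x
        · simp [hzx]
        · have := (hc y z ⟨hz, Ne.symm hy.ne.2.2, hzx⟩).resolve_left hyc
          simp [this]
    · have h1 := degree_le_add_off (H := H) v hxv
      have h2 : (H.off v {x}).card ≤ (T.powersetCard 2).card := by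
        refine off_le_card v _ _ fun p q hpq hp hq => ?_
        rw [Finset.mem_singleton] at hp hq
        have := hT' p q ⟨hpq, hp, hq⟩
        rw [Finset.mem_powersetCard]
        refine ⟨fun z hz => ?_, Finset.card_pair hpq.ne.2.2⟩
        simp only [Finset.mem_insert, Finset.mem_singleton] at hz
        rcases hz with rfl | rfl
        exacts [this.1, this.2]
      rw [Finset.card_powersetCard] at h2
      have h3 : T.card.choose 2 ≤ Nat.choose 3 2 := Nat.choose_le_choose 2 hT
      have h4 : Nat.choose 3 2 = 3 := by decide
      refine not_four_light_S3 h (by omega) hdeg hx (H.nbr v x \ T) ?_ ?_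
      · have := Finset.le_card_sdiff T (H.nbr v x)
        omega
      · intro y hy
        obtain ⟨hy, hyT⟩ := Finset.mem_sdiff.1 hy
        rw [mem_nbr] at hy
        refine ⟨hy, (Finset.card_le_card fun z hz => ?_).trans (Finset.card_le_two (a := x) (b := x))⟩
        rw [mem_nbr] at hz
        by_cases hzx : z = x
        · simp [hzx]
        · exact absurd (hT' y z ⟨hz, Ne.symm hy.ne.2.2, hzx⟩).1 hyT
  push Not at h5
  by_cases h4 : ∃ x, 4 ≤ (H.nbr v x).card
  · obtain ⟨x, hx⟩ := h4
    have hxv : x ≠ v := by rintro rfl; rw [nbr_self] at hx; simp at hx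
    have hx5 := h5 x
    have h1 := degree_le_add_off (H := H) v hxv
    suffices h6 : (H.off v {x}).card ≤ 6 by omega
    by_cases hint : ∀ p q r s, (H.IsEdge v p q ∧ p ≠ x ∧ q ≠ x) →
        (H.IsEdge v r s ∧ r ≠ x ∧ s ≠ x) → (p = r ∨ p = s) ∨ q = r ∨ q = s
    · rcases star_or_triangle (R := fun p q => H.IsEdge v p q ∧ p ≠ x ∧ q ≠ x)
        (fun a b h => ⟨h.1.swap_right, h.2.2, h.2.1⟩) (fun a b h => h.1.ne.2.2) v hint
        with ⟨c, hc⟩ | ⟨T, hT, hT'⟩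
      · by_cases hcv : c = v
        · have : (H.off v {x}).card = 0 := off_eq_zero v _ fun p q hpq hp hq => by
            rw [Finset.mem_singleton] at hp hq
            rcases hc p q ⟨hpq, hp, hq⟩ with h | h
            · exact hpq.ne.1 (hcv.symm.trans h.symm)
            · exact hpq.ne.2.1 (hcv.symm.trans h.symm)
          omega
        · have k1 := off_le_step H v {x} hcv
          have k2 : (H.off v {c, x}).card = 0 := off_eq_zero v _ fun p q hpq hp hq => by
            simp only [Finset.mem_insert, Finset.mem_singleton, not_or] at hp hq
            exact (hc p q ⟨hpq, hp.2, hq.2⟩).elim hp.1 hq.1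
          have k3 := (Finset.card_le_card
            (Finset.sdiff_subset (s := H.nbr v c) (t := {x}))).trans_lt (h5 c)
          omega
      · exact off_le_six (T := T) (by omega) fun p q hpq hp hq => by
          rw [Finset.mem_singleton] at hp hq
          exact hT' p q ⟨hpq, hp, hq⟩
    · push Not at hint
      obtain ⟨a, b, c, d, ⟨hab, ha, hb⟩, ⟨hcd, hc, hd⟩, ⟨hac, had⟩, hbc, hbd⟩ := hint
      have hN : H.nbr v x = {a, b, c, d} :=
        Finset.eq_of_subset_of_card_le (fun z hz =>
          hM2 hab hcd ha hb hc hd hac had hbc hbd z (mem_nbr.1 hz))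
          (Finset.card_le_four.trans hx)
      -- A link edge leaving the four neighbours of `x` is disjoint from `ab` or `cd`, and this new
      -- matching confines those neighbours to three vertices. So the edges missing `x` lie in a
      -- complete graph on four vertices, which has six edges.
      have key : ∀ p q, H.IsEdge v p q → p ≠ x → q ≠ x → p ∈ H.nbr v x := by
        intro p q hpq hp hq
        by_contra hpN
        have hpN' := hpN
        rw [hN] at hpN
        simp only [Finset.mem_insert, Finset.mem_singleton, not_or] at hpN
        obtain ⟨p1, p2, p3, p4⟩ := hpN
        have hcase : (q ≠ a ∧ q ≠ b) ∨ (q ≠ c ∧ q ≠ d) := by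
          clear hM hM2 h hdeg h5 hN hpN' h1
          grind
        rcases hcase with hq' | hq'
        · have hsub : H.nbr v x ⊆ ({a, b, p, q} : Finset V).erase p := fun z hz =>
            Finset.mem_erase.2 ⟨fun hzp => hpN' (hzp ▸ hz),
              hM2 hab hpq ha hb hp hq (Ne.symm p1) (Ne.symm hq'.1) (Ne.symm p2) (Ne.symm hq'.2) z
                (mem_nbr.1 hz)⟩
          have k := Finset.card_le_card hsub
          rw [Finset.card_erase_of_mem (by simp)] at k
          have := Finset.card_le_four (a := a) (b := b) (c := p) (d := q)
          omega
        · have hsub : H.nbr v x ⊆ ({c, d, p, q} : Finset V).erase p := fun z hz =>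
            Finset.mem_erase.2 ⟨fun hzp => hpN' (hzp ▸ hz),
              hM2 hcd hpq hc hd hp hq (Ne.symm p3) (Ne.symm hq'.1) (Ne.symm p4) (Ne.symm hq'.2) z
                (mem_nbr.1 hz)⟩
          have k := Finset.card_le_card hsub
          rw [Finset.card_erase_of_mem (by simp)] at k
          have := Finset.card_le_four (a := c) (b := d) (c := p) (d := q)
          omega
      exact off_le_six (T := H.nbr v x) (by omega) fun p q hpq hp hq => by
        rw [Finset.mem_singleton] at hp hq
        exact ⟨key p q hpq hp hq, key q p hpq.swap_right hq hp⟩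
  · push Not at h4
    -- With link degrees at most three an edge meets at most five edges, itself included. Eleven
    -- edges thus allow three disjoint ones to be chosen greedily.
    have hstep : ∀ (X : Finset V) {a b : V}, H.IsEdge v a b →
        (H.off v X).card ≤ 5 + (H.off v (insert b (insert a X))).card := by
      intro X a b hab
      have k1 := off_le_step H v X (Ne.symm hab.ne.1)
      have k2 := off_le_step H v (insert a X) (Ne.symm hab.ne.2.1)
      have k3 := (Finset.card_le_card
        (Finset.sdiff_subset (s := H.nbr v a) (t := X))).trans_lt (h4 a)
      have k4 := (card_sdiff_lt_of_isEdge (X := insert a X) hab.swap_right (by simp)).trans_le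
        (Nat.lt_succ_iff.1 (h4 b))
      omega
    rw [degree_singleton] at hv
    obtain ⟨a, b, hab, -, -⟩ := exists_isEdge_of_off_pos (H := H) (v := v) (X := ∅) (by omega)
    have k1 := hstep ∅ hab
    obtain ⟨c, d, hcd, hc, hd⟩ := exists_isEdge_of_off_pos (H := H) (v := v) (X := {b, a}) (by
      simp only [insert_empty_eq] at k1; omega)
    have k2 := hstep {b, a} hcd
    obtain ⟨e, f, hef, he, hf⟩ := exists_isEdge_of_off_pos (H := H) (v := v) (X := {d, c, b, a}) (by
      simp only [insert_empty_eq] at k1; omega)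
    simp only [Finset.mem_insert, Finset.mem_singleton, not_or] at hc hd he hf
    have n1 := hab.ne
    have n2 := hcd.ne
    have n3 := hef.ne
    exact hM hab hcd hef (by clear hM hM2 h hdeg h5 h4 hstep hab hcd hef k1 k2; simp; grind)

end S3

end Upper

/-! ### Upper bound for `LP3` -/

section LP3

variable {V : Type*} [DecidableEq V] {H : UniformHypergraph V 3} {v : V}

/-- Otherwise `cdv`, `vay`, `ypq` is a linear path. -/
theorem meets_of_matching_LP3 (h : Avoids LP3 H v) {y a c d p q : V} (h1 : H.IsEdge v y a)
    (h2 : H.IsEdge v c d) (hyc : y ≠ c) (hyd : y ≠ d) (hac : a ≠ c) (had : a ≠ d)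
    (h3 : H.IsEdge y p q) (hp : p ≠ v) (hq : q ≠ v) :
    p ∈ ({a, c, d} : Finset V) ∨ q ∈ ({a, c, d} : Finset V) := by
  by_contra hne
  simp only [Finset.mem_insert, Finset.mem_singleton, not_or] at hne
  have n1 := h1.ne
  have n2 := h2.ne
  have n3 := h3.ne
  exact no_LP3 h h2.rot h1.swap_right h3 (by clear h h1 h2 h3; simp; grind) (by simp)

theorem no_end_LP3 (h : Avoids LP3 H v) {y a c d z q : V} (h1 : H.IsEdge v d c)
    (h2 : H.IsEdge c z y) (h3 : H.IsEdge y a q) (had : a ≠ d) (hac : a ≠ c) (hyd : y ≠ d)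
    (hyv : y ≠ v) (hav : a ≠ v) (hza : z ≠ a) (hzd : z ≠ d) (hzv : z ≠ v) (hqv : q ≠ v)
    (hqc : q ≠ c) (hqd : q ≠ d) (hqz : q ≠ z) : False := by
  have n1 := h1.ne
  have n2 := h2.ne
  have n3 := h3.ne
  exact no_LP3 h h1 h2 h3 (by clear h h1 h2 h3; simp; grind) (by simp)

variable [Fintype V]

/-- Link neighbours `s` of `x` and `t` of `y` can be chosen off the edge, so meeting `{s, y, t}`
means containing `y`. -/
theorem mem_of_two_big_LP3 (h : Avoids LP3 H v) {x y p q : V} (hxy : x ≠ y)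
    (hx : 5 ≤ (H.nbr v x).card) (hy : 5 ≤ (H.nbr v y).card) (h3 : H.IsEdge x p q)
    (hp : p ≠ v) (hq : q ≠ v) : p = y ∨ q = y := by
  by_contra hne
  rw [not_or] at hne
  obtain ⟨t, ht, htS⟩ := exists_isEdge_notMem (H := H) (x := v) (y := y) {p, q, x}
    (lt_of_le_of_lt Finset.card_le_three (by omega))
  obtain ⟨s, hs, hsS⟩ := exists_isEdge_notMem (H := H) (x := v) (y := x) {p, q, y, t}
    (lt_of_le_of_lt Finset.card_le_four (by omega))
  simp only [Finset.mem_insert, Finset.mem_singleton, not_or] at htS hsS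
  have := meets_of_matching_LP3 h hs ht hxy (Ne.symm htS.2.2) hsS.2.2.1 hsS.2.2.2 h3 hp hq
  simp only [Finset.mem_insert, Finset.mem_singleton] at this
  clear h hs ht h3
  grind

theorem not_four_big_LP3 (h : Avoids LP3 H v) (hdeg : ∀ x, Fintype.card V - 1 ≤ H.degree {x})
    {x a b c : V} (hxv : x ≠ v) (hxa : x ≠ a) (hxb : x ≠ b) (hxc : x ≠ c) (hab : a ≠ b)
    (hac : a ≠ c) (hbc : b ≠ c) (hx : 5 ≤ (H.nbr v x).card) (ha : 5 ≤ (H.nbr v a).card)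
    (hb : 5 ≤ (H.nbr v b).card) (hc : 5 ≤ (H.nbr v c).card) : False := by
  have h0 : (H.off x {v}).card = 0 := off_eq_zero x _ fun p q hpq hp hq => by
    rw [Finset.mem_singleton] at hp hq
    have k1 := mem_of_two_big_LP3 h hxa hx ha hpq hp hq
    have k2 := mem_of_two_big_LP3 h hxb hx hb hpq hp hq
    have k3 := mem_of_two_big_LP3 h hxc hx hc hpq hp hq
    clear h hdeg hx ha hb hc hpq
    grind
  have h1 := degree_le_codegree_add_off (H := H) hxv
  have h2 := card_nbr_add_two_le H (Ne.symm hxv)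
  have h3 := hdeg x
  omega

/-- The degree of a vertex of a link edge whose pair has small codegree. -/
theorem degree_le_of_off {y a : V} (hya : H.IsEdge v y a) :
    H.degree {y} ≤ (H.nbr v y).card + (H.nbr y a \ {v}).card + (H.off y {a, v}).card := by
  have k1 := degree_le_codegree_add_off (H := H) (Ne.symm hya.ne.1)
  have k2 := off_le_step H y {v} (Ne.symm hya.ne.2.2)
  omega

/-- Three disjoint link edges, the codegrees of which are small. -/
theorem five_le_of_three_matching_LP3 (h : Avoids LP3 H v) (hn : 13 ≤ Fintype.card V)
    (hdeg : ∀ x, Fintype.card V - 1 ≤ H.degree {x}) {y a b c d e : V} (h1 : H.IsEdge v y a)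
    (h2 : H.IsEdge v b c) (h3 : H.IsEdge v d e) (hsm : (H.nbr y a \ {v}).card ≤ 3)
    (hnd : [y, a, b, c, d, e].Nodup) : 5 ≤ (H.nbr v y).card := by
  simp only [List.nodup_cons, List.mem_cons, List.not_mem_nil, or_false, not_or,
    not_false_eq_true, List.nodup_nil, and_true] at hnd
  obtain ⟨⟨-, n1, n2, n3, n4⟩, ⟨n5, n6, n7, n8⟩, ⟨-, n9, n10⟩, ⟨n11, n12⟩, -⟩ := hnd
  have k1 := degree_le_of_off h1
  -- Such an edge meets both `bc` and `de`, hence four possible pairs; `(n - 1) - 3 - 4` is at least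
  -- five from `n = 13` on.
  have k2 : (H.off y {a, v}).card ≤
      ({{b, d}, {b, e}, {c, d}, {c, e}} : Finset (Finset V)).card := by
    refine off_le_card y _ _ fun p q hpq hp hq => ?_
    simp only [Finset.mem_insert, Finset.mem_singleton, not_or] at hp hq
    have m1 := meets_of_matching_LP3 h h1 h2 n1 n2 n5 n6 hpq hp.2 hq.2
    have m2 := meets_of_matching_LP3 h h1 h3 n3 n4 n7 n8 hpq hp.2 hq.2
    simp only [Finset.mem_insert, Finset.mem_singleton] at m1 m2 ⊢
    have : ((p = b ∨ p = c) ∧ (q = d ∨ q = e)) ∨ ((q = b ∨ q = c) ∧ (p = d ∨ p = e)) := by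
      clear h hdeg h1 h2 h3 hsm k1 hpq
      grind
    rcases this with ⟨rfl | rfl, rfl | rfl⟩ | ⟨rfl | rfl, rfl | rfl⟩ <;>
      simp [Finset.pair_comm]
  have k3 : ({{b, d}, {b, e}, {c, d}, {c, e}} : Finset (Finset V)).card ≤ 4 := Finset.card_le_four
  have := hdeg y
  omega

theorem no_edge_of_four_le_LP3 (h : Avoids LP3 H v) {y a c d z : V} (h1 : H.IsEdge v y a)
    (h2 : H.IsEdge v c d) (hyd : y ≠ d) (hac : a ≠ c) (had : a ≠ d)
    (hm : 4 ≤ (H.nbr y a \ {v}).card) (h3 : H.IsEdge c y z) (hz : z ≠ v) : z = a ∨ z = d := by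
  by_contra hne
  rw [not_or] at hne
  obtain ⟨q, hq, hqS⟩ := Finset.exists_mem_notMem_of_card_lt_card
    (show ({c, d, z} : Finset V).card < (H.nbr y a \ {v}).card from
      lt_of_le_of_lt Finset.card_le_three (by omega))
  simp only [Finset.mem_sdiff, mem_nbr, Finset.mem_insert, Finset.mem_singleton, not_or] at hq hqS
  exact no_end_LP3 h h2.swap_right h3.swap_right hq.1 had hac hyd (Ne.symm h1.ne.1)
    (Ne.symm h1.ne.2.1) hne.1 hne.2 hz hq.2 hqS.1 hqS.2.1 hqS.2.2

/-- If a pair of the link matching has large codegree, then the other one has few other edges. -/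
theorem mem_of_four_le_LP3 (h : Avoids LP3 H v) {y a c d p q : V} (h1 : H.IsEdge v y a)
    (h2 : H.IsEdge v c d) (hyc : y ≠ c) (hyd : y ≠ d) (hac : a ≠ c) (had : a ≠ d)
    (hm : 4 ≤ (H.nbr y a \ {v}).card) (h3 : H.IsEdge c p q) (hp : p ≠ v) (hq : q ≠ v) :
    (p = d ∨ q = d) ∨ (p = y ∧ q = a) ∨ (p = a ∧ q = y) := by
  have hm' : 4 ≤ (H.nbr a y \ {v}).card := by rwa [nbr_comm]
  have k := meets_of_matching_LP3 h h2 h1 (Ne.symm hyc) (Ne.symm hac) (Ne.symm hyd)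
    (Ne.symm had) h3 hp hq
  simp only [Finset.mem_insert, Finset.mem_singleton] at k
  have k1 : ∀ z, H.IsEdge c y z → z ≠ v → z = a ∨ z = d := fun z =>
    no_edge_of_four_le_LP3 h h1 h2 hyd hac had hm
  have k2 : ∀ z, H.IsEdge c a z → z ≠ v → z = y ∨ z = d := fun z =>
    no_edge_of_four_le_LP3 h h1.swap_right h2 had hyc hyd hm'
  have h4 := h3.swap_right
  rcases k with (rfl | rfl | rfl) | rfl | rfl | rfl
  · exact Or.inl (Or.inl rfl)
  · rcases k1 _ h3 hq with rfl | rfl <;> simp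
  · rcases k2 _ h3 hq with rfl | rfl <;> simp
  · exact Or.inl (Or.inr rfl)
  · rcases k1 _ h4 hp with rfl | rfl <;> simp
  · rcases k2 _ h4 hp with rfl | rfl <;> simp

/-- The large codegree of `ya` leaves at `c` and at `d` a single pair off `v` and off each other, so
both have link degree at least `n - 5`. A common link neighbour `s` outside `ya` then has no edge
avoiding `v`. -/
theorem not_large_small_LP3 (h : Avoids LP3 H v) (hn : 13 ≤ Fintype.card V)
    (hdeg : ∀ x, Fintype.card V - 1 ≤ H.degree {x}) {y a c d : V} (h1 : H.IsEdge v y a)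
    (h2 : H.IsEdge v c d) (hyc : y ≠ c) (hyd : y ≠ d) (hac : a ≠ c) (had : a ≠ d)
    (hm : 4 ≤ (H.nbr y a \ {v}).card) (hm' : (H.nbr c d \ {v}).card ≤ 3) : False := by
  have hbig : ∀ c d, H.IsEdge v c d → y ≠ c → y ≠ d → a ≠ c → a ≠ d →
      (H.nbr c d \ {v}).card ≤ 3 → Fintype.card V - 5 ≤ (H.nbr v c).card := by
    intro c d h2 hyc hyd hac had hm'
    have k1 := degree_le_of_off h2
    have k2 : (H.off c {d, v}).card ≤ ({{y, a}} : Finset (Finset V)).card := by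
      refine off_le_card c _ _ fun p q hpq hp hq => ?_
      simp only [Finset.mem_insert, Finset.mem_singleton, not_or] at hp hq ⊢
      rcases mem_of_four_le_LP3 h h1 h2 hyc hyd hac had hm hpq hp.2 hq.2 with
        (h | h) | ⟨rfl, rfl⟩ | ⟨rfl, rfl⟩
      · exact absurd h hp.1
      · exact absurd h hq.1
      · rfl
      · exact Finset.pair_comm _ _
    rw [Finset.card_singleton] at k2
    have := hdeg c
    omega
  have hcb := hbig c d h2 hyc hyd hac had hm'
  have hdb := hbig d c h2.swap_right hyd hyc had hac (by rwa [nbr_comm])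
  have hfew : ∀ c d, H.IsEdge v c d → y ≠ c → y ≠ d → a ≠ c → a ≠ d →
      Fintype.card V - 5 ≤ (H.nbr v c).card → ∀ s q, s ≠ y → s ≠ a → s ≠ d → s ≠ v → q ≠ v →
      H.IsEdge c s q → False := by
    intro c d h2 hyc hyd hac had hcb s q hsy hsa hsd hsv hqv hcs
    have k1 := mem_of_four_le_LP3 h h1 h2 hyc hyd hac had hm hcs hsv hqv
    have hqd : q = d := by
      clear h hdeg h1 h2 hcs hcb hbig hdb
      grind
    obtain ⟨t, ht, htS⟩ := exists_isEdge_notMem (H := H) (x := v) (y := c) {s, y, a, d}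
      (lt_of_le_of_lt Finset.card_le_four (by omega))
    simp only [Finset.mem_insert, Finset.mem_singleton, not_or] at htS
    have k2 := meets_of_matching_LP3 h ht h1 (Ne.symm hyc) (Ne.symm hac) htS.2.1 htS.2.2.1
      hcs hsv hqv
    simp only [Finset.mem_insert, Finset.mem_singleton] at k2
    clear h hdeg h1 h2 hcs hcb hbig hdb ht
    grind
  have hcap : 4 ≤ (H.nbr v c ∩ H.nbr v d).card := by
    have k1 := Finset.card_union_add_card_inter (H.nbr v c) (H.nbr v d)
    have k2 : H.nbr v c ∪ H.nbr v d ⊆ Finset.univ.erase v := by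
      intro z hz
      rw [Finset.mem_union, mem_nbr, mem_nbr] at hz
      rw [Finset.mem_erase]
      exact ⟨hz.elim (fun h => Ne.symm h.ne.2.1) (fun h => Ne.symm h.ne.2.1), Finset.mem_univ _⟩
    have k3 := Finset.card_le_card k2
    rw [Finset.card_erase_of_mem (Finset.mem_univ _), Finset.card_univ] at k3
    omega
  have hS := Finset.le_card_sdiff {y, a} (H.nbr v c ∩ H.nbr v d)
  have hS2 := Finset.card_le_two (a := y) (b := a)
  obtain ⟨s, hs⟩ := Finset.card_pos.1
    (show 0 < ((H.nbr v c ∩ H.nbr v d) \ {y, a}).card by omega)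
  simp only [Finset.mem_sdiff, Finset.mem_inter, mem_nbr, Finset.mem_insert,
    Finset.mem_singleton, not_or] at hs
  obtain ⟨⟨hcs, hds⟩, hsy, hsa⟩ := hs
  have nc := hcs.ne
  have nd := hds.ne
  have h0 : (H.off s {v}).card = 0 := off_eq_zero s _ fun p q hpq hp hq => by
    rw [Finset.mem_singleton] at hp hq
    have hfc : ∀ q, H.IsEdge s c q → q ≠ v → False := fun q hsq hqv =>
      hfew c d h2 hyc hyd hac had hcb s q hsy hsa (Ne.symm nd.2.2) (Ne.symm nc.2.1) hqv hsq.swap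
    have hfd : ∀ q, H.IsEdge s d q → q ≠ v → False := fun q hsq hqv =>
      hfew d c h2.swap_right hyd hyc had hac hdb s q hsy hsa (Ne.symm nc.2.2) (Ne.symm nd.2.1)
        hqv hsq.swap
    have p1 : p ≠ c := by rintro rfl; exact hfc _ hpq hq
    have p2 : q ≠ c := by rintro rfl; exact hfc _ hpq.swap_right hp
    have p3 : p ≠ d := by rintro rfl; exact hfd _ hpq hq
    have p4 : q ≠ d := by rintro rfl; exact hfd _ hpq.swap_right hp
    obtain ⟨t, ht, htS⟩ := exists_isEdge_notMem (H := H) (x := v) (y := d) {s, c, p, q}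
      (lt_of_le_of_lt Finset.card_le_four (by omega))
    simp only [Finset.mem_insert, Finset.mem_singleton, not_or] at htS
    have k2 := meets_of_matching_LP3 h hcs.swap_right ht (Ne.symm nd.2.2) (Ne.symm htS.1)
      h2.ne.2.2 (Ne.symm htS.2.1) hpq hp hq
    simp only [Finset.mem_insert, Finset.mem_singleton] at k2
    clear h hdeg h1 h2 hcb hbig hdb ht hfew hfc hfd hpq
    grind
  have k1 := degree_le_codegree_add_off (H := H) (Ne.symm nc.2.1)
  have k2 := card_nbr_add_two_le H nc.2.1
  have k3 := hdeg s
  omega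

/-- A further link neighbour `s` of `c` gives the linear path `yav`, `vsc`, `cdq`, with `q` chosen
thanks to the codegree of `cd`. -/
theorem nbr_subset_of_four_le_LP3 (h : Avoids LP3 H v) {y a c d s : V} (h1 : H.IsEdge v y a)
    (h2 : H.IsEdge v c d) (hyc : y ≠ c) (hyd : y ≠ d) (hac : a ≠ c) (had : a ≠ d)
    (hm : 4 ≤ (H.nbr c d \ {v}).card) (hs : H.IsEdge v c s) : s = d ∨ s = y ∨ s = a := by
  by_contra hne
  simp only [not_or] at hne
  obtain ⟨q, hq, hqS⟩ := Finset.exists_mem_notMem_of_card_lt_card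
    (show ({s, y, a} : Finset V).card < (H.nbr c d \ {v}).card from
      lt_of_le_of_lt Finset.card_le_three (by omega))
  simp only [Finset.mem_sdiff, mem_nbr, Finset.mem_singleton] at hq
  have k := meets_of_matching_LP3 h hs h1 (Ne.symm hyc) (Ne.symm hac) hne.2.1 hne.2.2 hq.1
    (Ne.symm h2.ne.2.1) hq.2
  rcases k with k | k
  · simp only [Finset.mem_insert, Finset.mem_singleton] at k
    rcases k with rfl | rfl | rfl
    · exact hne.1 rfl
    · exact hyd rfl
    · exact had rfl
  · exact hqS k

/-- If `ya` had large codegree, so would every link edge disjoint from it. Two disjoint edges cannot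
carry the whole link, so there is a third; this isolates `ya`, then every other link edge, and a
matching has too few edges. -/
theorem small_codegree_LP3 (h : Avoids LP3 H v) (hn : 13 ≤ Fintype.card V)
    (hdeg : ∀ x, Fintype.card V - 1 ≤ H.degree {x}) {y a c d : V} (h1 : H.IsEdge v y a)
    (h2 : H.IsEdge v c d) (hyc : y ≠ c) (hyd : y ≠ d) (hac : a ≠ c) (had : a ≠ d) :
    (H.nbr y a \ {v}).card ≤ 3 := by
  by_contra hlt
  have hm : 4 ≤ (H.nbr y a \ {v}).card := by omega
  have hall : ∀ c d, H.IsEdge v c d → y ≠ c → y ≠ d → a ≠ c → a ≠ d →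
      4 ≤ (H.nbr c d \ {v}).card := by
    intro c d h2 hyc hyd hac had
    by_contra hlt
    exact not_large_small_LP3 h hn hdeg h1 h2 hyc hyd hac had hm (by omega)
  have hv := hdeg v
  rw [degree_singleton] at hv
  have hm2 := hall c d h2 hyc hyd hac had
  have hm' : 4 ≤ (H.nbr a y \ {v}).card := by rwa [nbr_comm]
  have hm2' : 4 ≤ (H.nbr d c \ {v}).card := by rwa [nbr_comm]
  -- every link edge is disjoint from the four vertices or inside them
  have hY : ∀ s, H.IsEdge v y s → s = a ∨ s = c ∨ s = d := fun s =>
    nbr_subset_of_four_le_LP3 h h2 h1 (Ne.symm hyc) (Ne.symm hac) (Ne.symm hyd) (Ne.symm had) hm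
  have hA : ∀ s, H.IsEdge v a s → s = y ∨ s = c ∨ s = d := fun s =>
    nbr_subset_of_four_le_LP3 h h2 h1.swap_right (Ne.symm hac) (Ne.symm hyc) (Ne.symm had)
      (Ne.symm hyd) hm'
  have hC : ∀ s, H.IsEdge v c s → s = d ∨ s = y ∨ s = a := fun s =>
    nbr_subset_of_four_le_LP3 h h1 h2 hyc hyd hac had hm2
  have hD : ∀ s, H.IsEdge v d s → s = c ∨ s = y ∨ s = a := fun s =>
    nbr_subset_of_four_le_LP3 h h1 h2.swap_right hyd hyc had hac hm2'
  have hin : ∀ p q, H.IsEdge v p q → p ∈ ({y, a, c, d} : Finset V) →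
      q ∈ ({y, a, c, d} : Finset V) := by
    intro p q hpq hp
    simp only [Finset.mem_insert, Finset.mem_singleton] at hp ⊢
    rcases hp with rfl | rfl | rfl | rfl
    · have := hY _ hpq; tauto
    · have := hA _ hpq; tauto
    · have := hC _ hpq; tauto
    · have := hD _ hpq; tauto
  have hdis : ∃ e f, H.IsEdge v e f ∧ e ∉ ({y, a, c, d} : Finset V) ∧
      f ∉ ({y, a, c, d} : Finset V) := by
    by_contra hne
    push Not at hne
    have := off_le_six (H := H) (v := v) (X := ∅) (T := {y, a, c, d}) Finset.card_le_four
      (fun p q hpq _ _ => by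
        by_cases hp : p ∈ ({y, a, c, d} : Finset V)
        · exact ⟨hp, hin p q hpq hp⟩
        · have hq := hne p q hpq hp
          exact ⟨hin q p hpq.swap_right hq, hq⟩)
    omega
  obtain ⟨e, f, hef, he, hf⟩ := hdis
  simp only [Finset.mem_insert, Finset.mem_singleton, not_or] at he hf
  have hme := hall e f hef (Ne.symm he.1) (Ne.symm hf.1) (Ne.symm he.2.1) (Ne.symm hf.2.1)
  have hY' : ∀ s, H.IsEdge v y s → s = a ∨ s = e ∨ s = f := fun s =>
    nbr_subset_of_four_le_LP3 h hef h1 he.1 he.2.1 hf.1 hf.2.1 hm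
  have hA' : ∀ s, H.IsEdge v a s → s = y ∨ s = e ∨ s = f := fun s =>
    nbr_subset_of_four_le_LP3 h hef h1.swap_right he.2.1 he.1 hf.2.1 hf.1 hm'
  have hmatch : ∀ x, (H.nbr v x).card ≤ 1 := by
    intro x
    rw [Finset.card_le_one]
    have hya : ∀ s, H.IsEdge v y s → s = a := by
      intro s hs
      have k1 := hY s hs
      have k2 := hY' s hs
      clear * - he hf k1 k2
      grind
    have hay : ∀ s, H.IsEdge v a s → s = y := by
      intro s hs
      have k1 := hA s hs
      have k2 := hA' s hs
      clear * - he hf k1 k2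
      grind
    intro p hp q hq
    rw [mem_nbr] at hp hq
    by_cases hxy : x = y
    · subst hxy; rw [hya p hp, hya q hq]
    by_cases hxa : x = a
    · subst hxa; rw [hay p hp, hay q hq]
    have hpy : ∀ p, H.IsEdge v x p → p ≠ y ∧ p ≠ a := by
      intro p hp
      constructor
      · rintro rfl; exact hxa (hya _ hp.swap_right)
      · rintro rfl; exact hxy (hay _ hp.swap_right)
    have hp' := hpy p hp
    have hq' := hpy q hq
    have hmp := hall x p hp (Ne.symm hxy) (Ne.symm hp'.1) (Ne.symm hxa) (Ne.symm hp'.2)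
    have := nbr_subset_of_four_le_LP3 h h1 hp (Ne.symm hxy) (Ne.symm hp'.1) (Ne.symm hxa)
      (Ne.symm hp'.2) hmp hq
    rcases this with h | h | h
    · exact h.symm
    · exact absurd h hq'.1
    · exact absurd h hq'.2
  have := two_mul_degree_le (H := H) (v := v) (t := 1) fun x _ => hmatch x
  have := hdeg v
  omega

/-- The link is neither a star nor a matching, so it has a path `b a w` and a disjoint edge `cd`.
Small codegrees give `b` a link neighbour `s` outside these; the three disjoint edges `bs`, `cd`,
`aw` then make `a`, `b`, `c`, `d` all of link degree at least five. -/
theorem covered_LP3 (hn : 13 ≤ Fintype.card V)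
    (hdeg : ∀ x, Fintype.card V - 1 ≤ H.degree {x}) (h : Avoids LP3 H v) : False := by
  have hv := hdeg v
  have hex : ∃ a b c p q, H.IsEdge v a b ∧ H.IsEdge v a c ∧ b ≠ c ∧ H.IsEdge v p q ∧
      p ≠ a ∧ p ≠ b ∧ p ≠ c ∧ q ≠ a ∧ q ≠ b ∧ q ≠ c := by
    by_contra hne
    rcases star_or_matching (H := H) (v := v) (by omega) (fun a b c p q h1 h2 h3 h4 e1 e2 e3 e4 e5
      e6 => hne ⟨a, b, c, p, q, h1, h2, h3, h4, e1, e2, e3, e4, e5, e6⟩) with ⟨x, hxv, hx⟩ | hm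
    · have h1 := degree_le_of_cover v hxv hx
      have h2 := card_nbr_add_two_le H (Ne.symm hxv)
      omega
    · have := two_mul_degree_le (H := H) (v := v) (t := 1) fun x _ => hm x
      omega
  obtain ⟨a, b, w, c, d, hab, haw, hbw, hcd, hca, hcb, hcw, hda, hdb, hdw⟩ := hex
  have nab := hab.ne
  have naw := haw.ne
  have ncd := hcd.ne
  have hsmall : ∀ {y a c d}, H.IsEdge v y a → H.IsEdge v c d → y ≠ c → y ≠ d → a ≠ c → a ≠ d →
      (H.nbr y a \ {v}).card ≤ 3 := fun h1 h2 => small_codegree_LP3 h hn hdeg h1 h2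
  have hb6 : 6 ≤ (H.nbr v b).card := by
    have k1 := degree_le_of_off hab.swap_right
    have k2 := hsmall hab.swap_right hcd (Ne.symm hcb) (Ne.symm hdb) (Ne.symm hca) (Ne.symm hda)
    have k3 : (H.off b {a, v}).card ≤ ({{c, d}, {c, w}, {d, w}} : Finset (Finset V)).card := by
      refine off_le_card b _ _ fun p q hpq hp hq => ?_
      simp only [Finset.mem_insert, Finset.mem_singleton, not_or] at hp hq ⊢
      have m := meets_of_matching_LP3 h hab.swap_right hcd (Ne.symm hcb) (Ne.symm hdb)
        (Ne.symm hca) (Ne.symm hda) hpq hp.2 hq.2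
      have hc : ∀ z, H.IsEdge b c z → z ≠ v → z ≠ a → z = d ∨ z = w := by
        intro z hz hzv hza
        have := meets_of_matching_LP3 h hcd haw hca hcw hda hdw hz.swap (Ne.symm nab.2.1) hzv
        simp only [Finset.mem_insert, Finset.mem_singleton] at this
        clear h hdeg hsmall
        grind
      have hd : ∀ z, H.IsEdge b d z → z ≠ v → z ≠ a → z = c ∨ z = w := by
        intro z hz hzv hza
        have := meets_of_matching_LP3 h hcd.swap_right haw hda hdw hca hcw hz.swap
          (Ne.symm nab.2.1) hzv
        simp only [Finset.mem_insert, Finset.mem_singleton] at this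
        clear h hdeg hsmall
        grind
      simp only [Finset.mem_insert, Finset.mem_singleton] at m
      rcases m with (rfl | rfl | rfl) | rfl | rfl | rfl
      · exact absurd rfl hp.1
      · rcases hc _ hpq hq.2 hq.1 with rfl | rfl <;> simp
      · rcases hd _ hpq hq.2 hq.1 with rfl | rfl <;> simp [Finset.pair_comm]
      · exact absurd rfl hq.1
      · rcases hc _ hpq.swap_right hp.2 hp.1 with rfl | rfl <;> simp [Finset.pair_comm]
      · rcases hd _ hpq.swap_right hp.2 hp.1 with rfl | rfl <;> simp [Finset.pair_comm]
    have k4 : ({{c, d}, {c, w}, {d, w}} : Finset (Finset V)).card ≤ 3 := Finset.card_le_three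
    have := hdeg b
    omega
  obtain ⟨s, hs, hsS⟩ := exists_isEdge_notMem (H := H) (x := v) (y := b) {a, c, d, w}
    (lt_of_le_of_lt Finset.card_le_four (by omega))
  simp only [Finset.mem_insert, Finset.mem_singleton, not_or] at hsS
  obtain ⟨sa, sc, sd, sw⟩ := hsS
  have ns := hs.ne
  have hb5 : 5 ≤ (H.nbr v b).card := by omega
  have m1 := hsmall hcd hs hcb (Ne.symm sc) hdb (Ne.symm sd)
  have m2 := hsmall hs hcd (Ne.symm hcb) (Ne.symm hdb) sc sd
  have m3 := hsmall haw hcd (Ne.symm hca) (Ne.symm hda) (Ne.symm hcw) (Ne.symm hdw)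
  have hc5 := five_le_of_three_matching_LP3 h hn hdeg hcd hs haw m1
    (by clear * - nab naw ncd ns hca hcb hcw hda hdb hdw hbw sa sc sd sw; simp; grind)
  have hd5 := five_le_of_three_matching_LP3 h hn hdeg hcd.swap_right hs haw (by rwa [nbr_comm])
    (by clear * - nab naw ncd ns hca hcb hcw hda hdb hdw hbw sa sc sd sw; simp; grind)
  have ha5 := five_le_of_three_matching_LP3 h hn hdeg haw hcd hs m3
    (by clear * - nab naw ncd ns hca hcb hcw hda hdb hdw hbw sa sc sd sw; simp; grind)
  exact not_four_big_LP3 h hdeg (Ne.symm nab.2.1) (Ne.symm hcb) (Ne.symm hdb) (Ne.symm nab.2.2)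
    ncd.2.2 hca hda hb5 hc5 hd5 ha5

end LP3

end UniformHypergraph

/-! ### The six thresholds -/

open UniformHypergraph

theorem theorem3 :
    (∀ n : ℕ, 13 ≤ n → LP3.IsCoveringThreshold 1 n (n - 2)) ∧
    (∀ n : ℕ, 6 ≤ n →
      TP3.IsCoveringThreshold 1 n (if n % 3 = 1 ∧ n ≠ 7 then n - 1 else n - 2)) ∧
    (∀ n : ℕ, 14 ≤ n → GP3.IsCoveringThreshold 1 n (n - 2)) ∧
    (∀ n : ℕ, 9 ≤ n → K113.IsCoveringThreshold 1 n (n - 1)) ∧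
    (∀ n : ℕ, 11 ≤ n → S3.IsCoveringThreshold 1 n (n - 1)) ∧
    (∀ n : ℕ, 13 ≤ n → GS3.IsCoveringThreshold 1 n ((n - 1) / 2)) := by
  refine ⟨fun n hn => ?_, fun n hn => ?_, fun n hn => ?_, fun n hn => ?_, fun n hn => ?_,
    fun n hn => ?_⟩
  · refine isCoveringThreshold_of (by omega) (hasUncovered_LP3 (by omega)) fun H v hdeg h =>
      covered_LP3 (H := H) (v := v) (by simpa using hn) (fun x => ?_) h
    have := hdeg x
    rw [Fintype.card_fin]
    omega
  · exact isCoveringThreshold_of (by omega) (hasUncovered_TP3_ite hn) (coveredAbove_TP3 hn)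
  · refine isCoveringThreshold_of (by omega) (hasUncovered_GP3 (by omega)) fun H v hdeg h =>
      covered_GP3 (H := H) (v := v) (by simpa using hn) (fun x => ?_) h
    have := hdeg x
    rw [Fintype.card_fin]
    omega
  · obtain ⟨m, rfl⟩ : ∃ m, n = m + 1 := ⟨n - 1, by omega⟩
    refine isCoveringThreshold_of (by omega) (hasUncovered_K113 (by omega)) fun H v hdeg h =>
      covered_K113 (H := H) (v := v) ?_ h
    rw [Fintype.card_fin]
    exact hdeg v
  · refine isCoveringThreshold_of (by omega) (hasUncovered_S3 (by omega)) fun H v hdeg h =>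
      covered_S3 (H := H) (v := v) (by simpa using hn) (fun x => ?_) h
    have := hdeg x
    rw [Fintype.card_fin]
    omega
  · refine isCoveringThreshold_of (by omega) (hasUncovered_GS3 hn) fun H v hdeg h =>
      covered_GS3 (H := H) (v := v) (by simpa using hn) (fun x => ?_) h
    have := hdeg x
    rw [Fintype.card_fin]
    exact this
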